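/- **Setting.** Let $\mathcal E$ be a locally cartesian closed category with finite limits and finite colimits. *Moore structures.* A Moore structure on $\mathcal E$ is a pullback-preserving endofunctor $M$ with maps, natural in all variables, $r_X:X\to MX$, $s_X,t_X:MX\to X$, $\mu_X:MX\times_XMX\to MX$ (defined on pairs $(p,q)$ with $t(p)=s(q)$), $\Gamma_X:MX\to MMX$ and $\alpha_{X,Y}:X\times MY\to M(X\times Y)$ such that: 1. $(X,MX,r,s,t,\mu)$ is an internal category for every $X$; 2. $(M,s,\Gamma)$ is a comonad; 3. $\alpha$ is a strength (associative, and $M\pi_2\circ\alpha=\pi_2$), and $s,t,r,\mu,\Gamma$ are strong with respect to it; 4. $\Gamma r=r_{MX}\,r$, $\;t_{MX}\Gamma=r\,t$, and $Mt\circ\Gamma$ sends $p$ to the constant path $\mathrm c(t(p),|p|)$, where $|p|\in M1$ is the image of $p$ under $M(X\to1)$ and $\mathrm c(x,l)=M\pi_1(\alpha_{X,1}(x,l))$; 5. $\Gamma\mu(p,q)=\mu\bigl(M\mu(\Gamma p,\mathrm c(q,|p|)),\Gamma q\bigr)$ whenever $t(p)=s(q)$, where $M\mu$ is regarded as defined on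 $MMX\times_{MX}MMX\cong M(MX\times_XMX)$. It is two-sided if moreover it is equipped with $\Gamma^*_X:MX\to MMX$ such that interchanging $s$ and $t$ and replacing $\mu$ by $\mu(p_2,p_1)$ and $\Gamma$ by $\Gamma^*$ yields again a Moore structure, $\mu$ is left and right cancellable, and $M\mu(\Gamma^*p,\Gamma p)=\mathrm c(p,|p|)$. It is symmetric if it is also equipped with a natural $\tau_X:MX\to MX$ with $\tau\tau=1$, $\tau r=r$, $s\tau=t$, $t\tau=s$, $\tau\mu(p,q)=\mu(\tau q,\tau p)$, $\tau\,\mathrm c(x,l)=\mathrm c(x,\tau l)$ and $\Gamma^*=\tau_{MX}\circ M\tau\circ\Gamma\circ\tau$. *Dominances.* A dominance is a class $\Sigma$ of monomorphisms (effective cofibrations) containing the isomorphisms, closed under composition, stable under pullback, and such that the category of members of $\Sigma$ and pullback squares has a terminal object. We assume in addition that $\Sigma$ is closed under binary unions of subobjects and contains all maps $0\to A$ and $r_X:X\to MX$. *Mould squares.* A hyperdeformation retract (HDR) structure on $i:A\to B$ consists of $j:B\to A$ and $H:B\to MB$ with $ji=1$, $sH=1$, $tH=ij$ and $MH\circ H=\Gamma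 H$. A morphism of HDRs $(i',j',H')\to(i,j,H)$ is a pair $(m:A'\to A,\;m':B'\to B)$ with $m'i'=im$, $jm'=mj'$ and $Mm'\circ H'=Hm'$. HDRs $i_0:A\to B$, $i_1:B\to C$ compose: $i_1i_0$ gets the retraction $j_0j_1$ and the homotopy $\mu(H_1,\,Mi_1\circ H_0\circ j_1)$. A mould square is a morphism of HDRs $(m,m')$ such that $jm'=mj'$ is a pullback square and $m\in\Sigma$. Mould squares compose horizontally (by composing HDRs) and vertically (by composing $m$'s and $m'$'s); the pullback of a mould square along a morphism of HDRs is again a mould square. *Effective fibrations.* An effective fibration is a map $p:Y\to X$ with a choice, for every mould square $(m,m'):i'\to i$ ($i':A'\to B'$, $i:A\to B$) and all $a:B'\to Y$, $k:A\to Y$, $b:B\to X$ with $ai'=km$, $pa=bm'$, $pk=bi$, of a filler $\ell:B\to Y$ with $\ell m'=a$, $\ell i=k$, $p\ell=b$, such that * (horizontal) the filler for a horizontal composite is the filler for the second square obtained from the filler for the first one; * (vertical) the filler for a vertical composite is the filler for the lower square obtained from the filler for the upper one; * (perpendicular) if a mould square over $i_1:A_1\to B_1$ is the pullback of a mould square over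 $i_0:A_0\to B_0$ along a morphism of HDRs $(u,w):i_1\to i_0$, then precomposing the chosen filler $B_0\to Y$ with $w$ gives the chosen filler for the problem obtained by precomposition. A morphism of effective fibrations $p'\to p$ is a commutative square $(y,x)$, $py=xp'$, such that composition with it sends the chosen fillers for $p'$ to those for $p$. Let $\mathbf{EffFib}$ be the category of effective fibrations. The pullback of an effective fibration along any map is canonically an effective fibration. Let $\mathbf{EffFib}\times_{\mathcal E}\mathbf{EffFib}$ be the category whose objects are composable pairs $(g:Y\to X,\;f:Z\to Y)$ of effective fibrations, and whose morphisms are pairs of morphisms of effective fibrations $(z,y):f'\to f$, $(y,x):g'\to g$ with common side $y$, of which the second is a pullback square. For $X\in\mathcal E$, let $\mathbf{EffFib}_X$ be the category of effective fibrations with codomain $X$ and all maps over $X$; call a map over $X$ structure-preserving if it is a morphism of effective fibrations. For $g:Y\to X$ let $\Pi_g:\mathcal E/Y\to\mathcal E/X$ be the right adjoint of pullback along $g$ (pushforward); a morphism $(g',f')\to(g,f)$ of composable pairs whose $g$-square is a pullback induces a canonical square $\Pi_{g'}f'\to\Pi_gf$, and in this way $(g,f)\mapsto\Pi_gf$ is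 a functor to the arrow category of $\mathcal E$. **Theorem (pushforward for effective fibrations).** Let $\mathcal E$ be a finitely cocomplete locally cartesian closed category with a symmetric Moore structure and a dominance satisfying the additional conditions above. Then the pushforward $\Pi_gf$ of an effective fibration $f$ along an effective fibration $g$ is again an effective fibration. More precisely, there is a functor $$\Pi_{(-)}(-):\mathbf{EffFib}\times_{\mathcal E}\mathbf{EffFib}\longrightarrow\mathbf{EffFib}$$ whose value at $(g,f)$ has the pushforward $\Pi_gf$ as underlying map, and whose action on morphisms is the canonical one. For every effective fibration $g:Y\to X$, the pushforward lifts to a functor $\Pi_g:\mathbf{EffFib}_Y\to\mathbf{EffFib}_X$, given on objects by $f\mapsto\Pi_g f$ with this effective fibration structure, and $\Pi_g$ is right adjoint to pullback $g^*:\mathbf{EffFib}_X\to\mathbf{EffFib}_Y$; moreover, the transpose $h\to\Pi_gf$ of a structure-preserving map $g^*h\to f$ is structure-preserving. -/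

import Mathlib

open CategoryTheory Limits

universe v u

namespace MooreCat

noncomputable section

/-! ### Locally cartesian closed categories and pushforward -/

/-- A category with pullbacks is locally cartesian closed if every pullback functor
`f^* : E / Y ⥤ E / X` has a right adjoint. -/
class LocallyCartesianClosed (E : Type u) [Category.{v} E] [HasPullbacks E] : Prop where
  isLeftAdjoint : ∀ {X Y : E} (f : X ⟶ Y), (Over.pullback f).IsLeftAdjoint

section Pushforward

variable {E : Type u} [Category.{v} E] [HasPullbacks E] [LocallyCartesianClosed E]

/-- The pushforward functor `Π_g : E / Y ⥤ E / X` along `g : Y ⟶ X`: the right adjoint of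
pullback along `g`. -/
def pushforward {X Y : E} (g : Y ⟶ X) : Over Y ⥤ Over X :=
  haveI := LocallyCartesianClosed.isLeftAdjoint g
  (Over.pullback g).rightAdjoint

/-- The adjunction `g^* ⊣ Π_g` on slice categories. -/
def pushforwardAdj {X Y : E} (g : Y ⟶ X) : Over.pullback g ⊣ pushforward g :=
  haveI := LocallyCartesianClosed.isLeftAdjoint g
  Adjunction.ofIsLeftAdjoint (Over.pullback g)

/-- The morphism `Π_g f` of `E`, for `f : Z ⟶ Y` and `g : Y ⟶ X`. -/
abbrev pushforwardHom {X Y Z : E} (g : Y ⟶ X) (f : Z ⟶ Y) :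
    ((pushforward g).obj (Over.mk f)).left ⟶ X :=
  ((pushforward g).obj (Over.mk f)).hom

/-- Evaluation of generalized elements: a `T`-element of `Π_g f` and a `T`-element of `Y` with the
same image in `X` give a `T`-element of `Z`. -/
def evalAt {X Y Z : E} (g : Y ⟶ X) (f : Z ⟶ Y) {T : E}
    (a : T ⟶ ((pushforward g).obj (Over.mk f)).left) (b : T ⟶ Y)
    (h : a ≫ pushforwardHom g f = b ≫ g) : T ⟶ Z :=
  pullback.lift a b h ≫ ((pushforwardAdj g).counit.app (Over.mk f)).left

theorem evalAt_comp {X Y Z : E} (g : Y ⟶ X) (f : Z ⟶ Y) {T : E}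
    (a : T ⟶ ((pushforward g).obj (Over.mk f)).left) (b : T ⟶ Y)
    (h : a ≫ pushforwardHom g f = b ≫ g) : evalAt g f a b h ≫ f = b := by
  have := Over.w ((pushforwardAdj g).counit.app (Over.mk f))
  dsimp at this
  unfold evalAt
  rw [Category.assoc, this]
  exact pullback.lift_snd _ _ _

theorem comp_evalAt {X Y Z : E} (g : Y ⟶ X) (f : Z ⟶ Y) {S T : E} (e : S ⟶ T)
    (a : T ⟶ ((pushforward g).obj (Over.mk f)).left) (b : T ⟶ Y)
    (h : a ≫ pushforwardHom g f = b ≫ g) :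
    e ≫ evalAt g f a b h = evalAt g f (e ≫ a) (e ≫ b) (by simp [h]) := by
  unfold evalAt
  rw [← Category.assoc]
  congr 1
  apply pullback.hom_ext
  · rw [Category.assoc, pullback.lift_fst, pullback.lift_fst]
  · rw [Category.assoc, pullback.lift_snd, pullback.lift_snd]

/-- A map into `Π_g f` over `X` is determined by its values. -/
theorem pushforward_ext {X Y Z : E} (g : Y ⟶ X) (f : Z ⟶ Y) {W : E}
    {k l : W ⟶ ((pushforward g).obj (Over.mk f)).left}
    (hkl : k ≫ pushforwardHom g f = l ≫ pushforwardHom g f)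
    (h : ∀ {T : E} (a : T ⟶ W) (b : T ⟶ Y) (hk : (a ≫ k) ≫ pushforwardHom g f = b ≫ g)
      (hl : (a ≫ l) ≫ pushforwardHom g f = b ≫ g),
      evalAt g f (a ≫ k) b hk = evalAt g f (a ≫ l) b hl) : k = l := by
  let A : Over X := Over.mk (k ≫ pushforwardHom g f)
  let k' : A ⟶ (pushforward g).obj (Over.mk f) := Over.homMk k rfl
  let l' : A ⟶ (pushforward g).obj (Over.mk f) := Over.homMk l hkl.symm
  suffices k' = l' from congrArg (fun m => m.left) this
  apply ((pushforwardAdj g).homEquiv A (Over.mk f)).symm.injective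
  rw [Adjunction.homEquiv_counit, Adjunction.homEquiv_counit]
  ext
  have hc : pullback.fst A.hom g ≫ A.hom = pullback.snd A.hom g ≫ g := pullback.condition
  have := h (pullback.fst A.hom g) (pullback.snd A.hom g)
    (by rw [Category.assoc]; exact hc) (by rw [Category.assoc, ← hkl]; exact hc)
  exact this

/-- A composable pair `Z ⟶ Y ⟶ X`. -/
structure CartPair (E : Type u) [Category.{v} E] where
  {X Y Z : E}
  /-- the first component, along which one pushes forward -/
  g : Y ⟶ X
  /-- the second component, which is pushed forward -/
  f : Z ⟶ Y

/-- A morphism of composable pairs: a pair of commutative squares with a common side, of which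
the square between the maps along which one pushes forward is a pullback. -/
@[ext]
structure CartPair.Hom {E : Type u} [Category.{v} E] (p q : CartPair E) where
  x : p.X ⟶ q.X
  y : p.Y ⟶ q.Y
  z : p.Z ⟶ q.Z
  comm : z ≫ q.f = p.f ≫ y
  cart : IsPullback y p.g q.g x

@[simps]
instance CartPair.instCategory {E : Type u} [Category.{v} E] : Category (CartPair E) where
  Hom := CartPair.Hom
  id p := ⟨𝟙 _, 𝟙 _, 𝟙 _, by simp, IsPullback.id_horiz _⟩
  comp a b := ⟨a.x ≫ b.x, a.y ≫ b.y, a.z ≫ b.z,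
    by rw [Category.assoc, b.comm, ← Category.assoc, a.comm, Category.assoc],
    a.cart.paste_horiz b.cart⟩

/-- The map `Π_{g'} f' ⟶ Π_g f` induced by a morphism `(g', f') ⟶ (g, f)`: it is the transpose of
`(Π_{g'} f') ×_X Y ≅ (Π_{g'} f') ×_{X'} Y' ⟶ Z' ⟶ Z`. -/
def pushforwardMap {p q : CartPair E} (u : CartPair.Hom p q) :
    ((pushforward p.g).obj (Over.mk p.f)).left ⟶ ((pushforward q.g).obj (Over.mk q.f)).left :=
  let W : Over q.X := Over.mk (pushforwardHom p.g p.f ≫ u.x)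
  have hW : pullback.snd W.hom q.g ≫ q.g = (pullback.fst W.hom q.g ≫ pushforwardHom p.g p.f) ≫ u.x :=
    by rw [← pullback.condition, Category.assoc]; rfl
  (((pushforwardAdj q.g).homEquiv W (Over.mk q.f))
    (Over.homMk
      (evalAt p.g p.f (pullback.fst W.hom q.g) (u.cart.lift (pullback.snd W.hom q.g) _ hW)
        (u.cart.lift_snd _ _ hW).symm ≫ u.z)
      (by
        dsimp
        rw [Category.assoc, u.comm, ← Category.assoc, evalAt_comp]
        exact u.cart.lift_fst _ _ _))).left

theorem pushforwardMap_comp_hom {p q : CartPair E} (u : CartPair.Hom p q) :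
    pushforwardMap u ≫ pushforwardHom q.g q.f = pushforwardHom p.g p.f ≫ u.x := by
  unfold pushforwardMap
  exact Over.w _

theorem evalAt_pushforwardMap {p q : CartPair E} (u : CartPair.Hom p q) {T : E}
    (a : T ⟶ ((pushforward p.g).obj (Over.mk p.f)).left) (b : T ⟶ p.Y)
    (h : a ≫ pushforwardHom p.g p.f = b ≫ p.g)
    (h' : (a ≫ pushforwardMap u) ≫ pushforwardHom q.g q.f = (b ≫ u.y) ≫ q.g) :
    evalAt q.g q.f (a ≫ pushforwardMap u) (b ≫ u.y) h' = evalAt p.g p.f a b h ≫ u.z := by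
  let W : Over q.X := Over.mk (pushforwardHom p.g p.f ≫ u.x)
  have hW : pullback.snd W.hom q.g ≫ q.g = (pullback.fst W.hom q.g ≫ pushforwardHom p.g p.f) ≫ u.x :=
    by rw [← pullback.condition, Category.assoc]; rfl
  let θ : (Over.pullback q.g).obj W ⟶ Over.mk q.f := Over.homMk
      (evalAt p.g p.f (pullback.fst W.hom q.g) (u.cart.lift (pullback.snd W.hom q.g) _ hW)
        (u.cart.lift_snd _ _ hW).symm ≫ u.z)
      (by
        dsimp
        rw [Category.assoc, u.comm, ← Category.assoc, evalAt_comp]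
        exact u.cart.lift_fst _ _ _)
  let K := (pushforwardAdj q.g).homEquiv W (Over.mk q.f) θ
  have hK : (Over.pullback q.g).map K ≫ (pushforwardAdj q.g).counit.app (Over.mk q.f) = θ := by
    have h0 : ((pushforwardAdj q.g).homEquiv W (Over.mk q.f)).symm K = θ :=
      Equiv.symm_apply_apply _ _
    rw [Adjunction.homEquiv_counit] at h0
    exact h0
  have hb : a ≫ W.hom = (b ≫ u.y) ≫ q.g := by
    change a ≫ pushforwardHom p.g p.f ≫ u.x = _
    rw [← Category.assoc, h, Category.assoc, Category.assoc, u.cart.w]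
  have h1 : evalAt q.g q.f (a ≫ pushforwardMap u) (b ≫ u.y) h'
      = pullback.lift a (b ≫ u.y) hb ≫ ((Over.pullback q.g).map K ≫
        (pushforwardAdj q.g).counit.app (Over.mk q.f)).left := by
    unfold evalAt
    rw [Over.comp_left, ← Category.assoc]
    congr 1
    apply pullback.hom_ext
    · rw [Category.assoc]
      change _ = pullback.lift a (b ≫ u.y) hb ≫ pullback.lift _ _ _ ≫ pullback.fst _ _
      rw [pullback.lift_fst, pullback.lift_fst, ← Category.assoc, pullback.lift_fst]
      rfl
    · rw [Category.assoc]
      change _ = pullback.lift a (b ≫ u.y) hb ≫ pullback.lift _ _ _ ≫ pullback.snd _ _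
      rw [pullback.lift_snd, pullback.lift_snd, pullback.lift_snd]
  rw [h1, hK]
  change pullback.lift a (b ≫ u.y) hb ≫ (evalAt p.g p.f _ _ _ ≫ u.z) = _
  rw [← Category.assoc, comp_evalAt]
  congr 2
  · exact pullback.lift_fst _ _ _
  · apply u.cart.hom_ext
    · rw [Category.assoc, u.cart.lift_fst, pullback.lift_snd]
    · rw [Category.assoc, u.cart.lift_snd, ← Category.assoc, pullback.lift_fst, h]

/-- `pushforwardMap u` is the only map over `u.x` which is compatible with evaluation. -/
theorem eq_pushforwardMap {p q : CartPair E} (u : CartPair.Hom p q)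
    (k : ((pushforward p.g).obj (Over.mk p.f)).left ⟶ ((pushforward q.g).obj (Over.mk q.f)).left)
    (hk : k ≫ pushforwardHom q.g q.f = pushforwardHom p.g p.f ≫ u.x)
    (he : ∀ {T : E} (a : T ⟶ ((pushforward p.g).obj (Over.mk p.f)).left) (b : T ⟶ p.Y)
      (h : a ≫ pushforwardHom p.g p.f = b ≫ p.g)
      (h' : (a ≫ k) ≫ pushforwardHom q.g q.f = (b ≫ u.y) ≫ q.g),
      evalAt q.g q.f (a ≫ k) (b ≫ u.y) h' = evalAt p.g p.f a b h ≫ u.z) :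
    k = pushforwardMap u := by
  apply pushforward_ext _ _ (hk.trans (pushforwardMap_comp_hom u).symm)
  intro T a b h1 h2
  have hab : b ≫ q.g = (a ≫ pushforwardHom p.g p.f) ≫ u.x := by
    rw [← h1, Category.assoc, hk, Category.assoc]
  obtain ⟨c, hc1, hc2⟩ : ∃ c : T ⟶ p.Y, c ≫ u.y = b ∧ c ≫ p.g = a ≫ pushforwardHom p.g p.f :=
    ⟨u.cart.lift _ _ hab, u.cart.lift_fst _ _ _, u.cart.lift_snd _ _ _⟩
  subst hc1
  rw [he a c hc2.symm h1, evalAt_pushforwardMap u a c hc2.symm h2]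

/-- Pushforward as a functor from composable pairs to arrows. -/
def pushforwardFunctor (E : Type u) [Category.{v} E] [HasPullbacks E] [LocallyCartesianClosed E] :
    CartPair E ⥤ Arrow E where
  obj p := Arrow.mk (pushforwardHom p.g p.f)
  map {p q} u := Arrow.homMk (pushforwardMap u) u.x (pushforwardMap_comp_hom u)
  map_id p := by
    ext
    · symm
      refine eq_pushforwardMap (𝟙 p : p ⟶ p) _ (by simp) ?_
      intro T a b h h'
      simp
    · rfl
  map_comp {p q r} u w := by
    ext
    · symm
      refine eq_pushforwardMap (u ≫ w : p ⟶ r) (pushforwardMap u ≫ pushforwardMap w) ?_ ?_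
      · rw [Category.assoc, pushforwardMap_comp_hom, ← Category.assoc, pushforwardMap_comp_hom,
          Category.assoc]
        rfl
      · intro T a b h h'
        have h1 : (a ≫ pushforwardMap u) ≫ pushforwardHom q.g q.f = (b ≫ u.y) ≫ q.g := by
          rw [Category.assoc, pushforwardMap_comp_hom, ← Category.assoc, h, Category.assoc,
            Category.assoc, u.cart.w]
        have h2 := evalAt_pushforwardMap u a b h h1
        have h3 := evalAt_pushforwardMap w (a ≫ pushforwardMap u) (b ≫ u.y) h1 (by
          simpa using h')
        rw [h2] at h3
        simpa using h3
    · rfl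

end Pushforward

/-! ### Moore structures -/

/-- The raw data of a Moore structure: an endofunctor `M` (paths) preserving pullbacks, trivial
paths `r`, sources `s`, targets `t`, concatenation `μ` of pairs of paths `(p, q)` with
`t p = s q`, the path contraction `Γ` and the strength `α`. -/
structure PathData (E : Type u) [Category.{v} E] [HasFiniteLimits E] where
  M : E ⥤ E
  preservesPullbacks : PreservesLimitsOfShape WalkingCospan M
  r : ∀ X : E, X ⟶ M.obj X
  s : ∀ X : E, M.obj X ⟶ X
  t : ∀ X : E, M.obj X ⟶ X
  μ : ∀ X : E, pullback (t X) (s X) ⟶ M.obj X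
  Γ : ∀ X : E, M.obj X ⟶ M.obj (M.obj X)
  α : ∀ X Y : E, X ⨯ M.obj Y ⟶ M.obj (X ⨯ Y)

attribute [instance] PathData.preservesPullbacks

namespace PathData

attribute [local simp] pullback.lift_fst pullback.lift_snd pullback.lift_fst_assoc
  pullback.lift_snd_assoc prod.lift_fst prod.lift_snd prod.lift_fst_assoc prod.lift_snd_assoc

variable {E : Type u} [Category.{v} E] [HasFiniteLimits E] (P : PathData E)

/-- Concatenation `μ.(p, q)` of generalized paths. -/
def conc {X T : E} (p q : T ⟶ P.M.obj X) (h : p ≫ P.t X = q ≫ P.s X) : T ⟶ P.M.obj X :=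
  pullback.lift p q h ≫ P.μ X

/-- Pointwise concatenation `Mμ.ν.(p, q)`, where `ν : MMX ×_{MX} MMX ⟶ M (MX ×_X MX)` is the
isomorphism expressing that `M` preserves pullbacks. -/
def mapConc {X T : E} (p q : T ⟶ P.M.obj (P.M.obj X))
    (h : p ≫ P.M.map (P.t X) = q ≫ P.M.map (P.s X)) : T ⟶ P.M.obj (P.M.obj X) :=
  pullback.lift p q h ≫ (PreservesPullback.iso P.M (P.t X) (P.s X)).inv ≫ P.M.map (P.μ X)

/-- The length `M!.p` of a generalized path. -/
def len {X T : E} (p : T ⟶ P.M.obj X) : T ⟶ P.M.obj (⊤_ E) :=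
  p ≫ P.M.map (terminal.from X)

/-- The constant path `θ.α_{X,1}.(x, l)` on `x` of length `l`, where `θ = M p₁`. -/
def const {X T : E} (x : T ⟶ X) (l : T ⟶ P.M.obj (⊤_ E)) : T ⟶ P.M.obj X :=
  prod.lift x l ≫ P.α X (⊤_ E) ≫ P.M.map prod.fst

/-- The axioms of a Moore structure, except for the distributive law. -/
structure IsPreMoore : Prop where
  r_nat : ∀ {X Y : E} (f : X ⟶ Y), f ≫ P.r Y = P.r X ≫ P.M.map f
  s_nat : ∀ {X Y : E} (f : X ⟶ Y), P.M.map f ≫ P.s Y = P.s X ≫ f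
  t_nat : ∀ {X Y : E} (f : X ⟶ Y), P.M.map f ≫ P.t Y = P.t X ≫ f
  μ_nat : ∀ {X Y : E} (f : X ⟶ Y),
    pullback.map (P.t X) (P.s X) (P.t Y) (P.s Y) (P.M.map f) (P.M.map f) f (t_nat f).symm
      (s_nat f).symm ≫ P.μ Y = P.μ X ≫ P.M.map f
  Γ_nat : ∀ {X Y : E} (f : X ⟶ Y), P.M.map f ≫ P.Γ Y = P.Γ X ≫ P.M.map (P.M.map f)
  α_nat : ∀ {X X' Y Y' : E} (f : X ⟶ X') (g : Y ⟶ Y'),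
    prod.map f (P.M.map g) ≫ P.α X' Y' = P.α X Y ≫ P.M.map (prod.map f g)
  -- every object is the object of objects of an internal category
  r_s : ∀ X : E, P.r X ≫ P.s X = 𝟙 X
  r_t : ∀ X : E, P.r X ≫ P.t X = 𝟙 X
  μ_s : ∀ X : E, P.μ X ≫ P.s X = pullback.fst _ _ ≫ P.s X
  μ_t : ∀ X : E, P.μ X ≫ P.t X = pullback.snd _ _ ≫ P.t X
  r_conc : ∀ X : E, P.conc (P.s X ≫ P.r X) (𝟙 _) (by simp [r_t]) = 𝟙 (P.M.obj X)
  conc_r : ∀ X : E, P.conc (𝟙 _) (P.t X ≫ P.r X) (by simp [r_s]) = 𝟙 (P.M.obj X)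
  conc_assoc : ∀ {X T : E} (p q w : T ⟶ P.M.obj X) (h₁ : p ≫ P.t X = q ≫ P.s X)
    (h₂ : q ≫ P.t X = w ≫ P.s X),
    P.conc (P.conc p q h₁) w (by simp [conc, μ_t, h₂]) =
      P.conc p (P.conc q w h₂) (by simp [conc, μ_s, h₁])
  -- `(M, s, Γ)` is a comonad
  Γ_s : ∀ X : E, P.Γ X ≫ P.s (P.M.obj X) = 𝟙 _
  Γ_map_s : ∀ X : E, P.Γ X ≫ P.M.map (P.s X) = 𝟙 _
  Γ_Γ : ∀ X : E, P.Γ X ≫ P.Γ (P.M.obj X) = P.Γ X ≫ P.M.map (P.Γ X)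
  -- `α` is a strength
  α_assoc : ∀ X Y Z : E, P.α (X ⨯ Y) Z ≫ P.M.map (prod.associator X Y Z).hom =
    (prod.associator X Y (P.M.obj Z)).hom ≫ prod.map (𝟙 X) (P.α Y Z) ≫ P.α X (Y ⨯ Z)
  α_snd : ∀ X Y : E, P.α X Y ≫ P.M.map prod.snd = prod.snd
  -- the previous structure is strong
  α_s : ∀ X Y : E, P.α X Y ≫ P.s (X ⨯ Y) = prod.map (𝟙 X) (P.s Y)
  α_t : ∀ X Y : E, P.α X Y ≫ P.t (X ⨯ Y) = prod.map (𝟙 X) (P.t Y)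
  α_r : ∀ X Y : E, prod.map (𝟙 X) (P.r Y) ≫ P.α X Y = P.r (X ⨯ Y)
  α_conc : ∀ {X Y T : E} (x : T ⟶ X) (p q : T ⟶ P.M.obj Y) (h : p ≫ P.t Y = q ≫ P.s Y),
    prod.lift x (P.conc p q h) ≫ P.α X Y =
      P.conc (prod.lift x p ≫ P.α X Y) (prod.lift x q ≫ P.α X Y) (by simp [α_s, α_t, h])
  α_Γ : ∀ X Y : E, P.α X Y ≫ P.Γ (X ⨯ Y) =
    prod.map (𝟙 X) (P.Γ Y) ≫ P.α X (P.M.obj Y) ≫ P.M.map (P.α X Y)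
  -- interaction of `Γ` with `r` and `t`
  r_Γ : ∀ X : E, P.r X ≫ P.Γ X = P.r X ≫ P.r (P.M.obj X)
  Γ_t : ∀ X : E, P.Γ X ≫ P.t (P.M.obj X) = P.t X ≫ P.r X
  Γ_map_t : ∀ X : E, P.Γ X ≫ P.M.map (P.t X) = P.const (P.t X) (P.len (𝟙 _))

section lemmas

variable {P}

theorem comp_conc {X S T : E} (e : S ⟶ T) (p q : T ⟶ P.M.obj X) (h : p ≫ P.t X = q ≫ P.s X) :
    e ≫ P.conc p q h = P.conc (e ≫ p) (e ≫ q) (by simp [h]) := by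
  unfold conc
  rw [← Category.assoc]
  congr 1
  ext <;> simp

theorem comp_mapConc {X S T : E} (e : S ⟶ T) (p q : T ⟶ P.M.obj (P.M.obj X))
    (h : p ≫ P.M.map (P.t X) = q ≫ P.M.map (P.s X)) :
    e ≫ P.mapConc p q h = P.mapConc (e ≫ p) (e ≫ q) (by simp [h]) := by
  unfold mapConc
  rw [← Category.assoc]
  congr 1
  ext <;> simp

theorem comp_len {X S T : E} (e : S ⟶ T) (p : T ⟶ P.M.obj X) : e ≫ P.len p = P.len (e ≫ p) := by
  simp [len]

theorem len_map {X Y T : E} (p : T ⟶ P.M.obj X) (f : X ⟶ Y) : P.len (p ≫ P.M.map f) = P.len p := by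
  simp [len, ← Functor.map_comp]

theorem comp_const {X S T : E} (e : S ⟶ T) (x : T ⟶ X) (l : T ⟶ P.M.obj (⊤_ E)) :
    e ≫ P.const x l = P.const (e ≫ x) (e ≫ l) := by
  simp [const, ← Category.assoc]

/-- If `(a, b) : A ⟶ MX ×_X MX` then `Mμ.M(a, b) = Mμ.ν.(Ma, Mb)`. -/
theorem map_conc {X A : E} (a b : A ⟶ P.M.obj X) (h : a ≫ P.t X = b ≫ P.s X) :
    P.M.map (P.conc a b h) = P.mapConc (P.M.map a) (P.M.map b)
      (by rw [← Functor.map_comp, h, Functor.map_comp]) := by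
  unfold conc mapConc
  rw [Functor.map_comp, ← Category.assoc]
  congr 1
  rw [Iso.eq_comp_inv]
  ext <;> simp

namespace IsPreMoore

theorem conc_s (hP : P.IsPreMoore) {X T : E} (p q : T ⟶ P.M.obj X) (h : p ≫ P.t X = q ≫ P.s X) :
    P.conc p q h ≫ P.s X = p ≫ P.s X := by simp [conc, hP.μ_s]

theorem conc_t (hP : P.IsPreMoore) {X T : E} (p q : T ⟶ P.M.obj X) (h : p ≫ P.t X = q ≫ P.s X) :
    P.conc p q h ≫ P.t X = q ≫ P.t X := by simp [conc, hP.μ_t]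

theorem conc_map (hP : P.IsPreMoore) {X Y T : E} (p q : T ⟶ P.M.obj X)
    (h : p ≫ P.t X = q ≫ P.s X) (f : X ⟶ Y) :
    P.conc p q h ≫ P.M.map f = P.conc (p ≫ P.M.map f) (q ≫ P.M.map f)
      (by simp only [Category.assoc, hP.t_nat, hP.s_nat, reassoc_of% h]) := by
  unfold conc
  rw [Category.assoc, ← hP.μ_nat, ← Category.assoc]
  congr 1
  ext <;> simp

theorem conc_r_right (hP : P.IsPreMoore) {X T : E} (p : T ⟶ P.M.obj X) (x : T ⟶ X) (h) :
    P.conc p (x ≫ P.r X) h = p := by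
  have hx : p ≫ P.t X = x := by rw [h, Category.assoc, hP.r_s, Category.comp_id]
  have := comp_conc p (𝟙 _) (P.t X ≫ P.r X) (by simp [hP.r_s])
  rw [hP.conc_r] at this
  subst hx
  simpa using this.symm

theorem conc_r_left (hP : P.IsPreMoore) {X T : E} (p : T ⟶ P.M.obj X) (x : T ⟶ X) (h) :
    P.conc (x ≫ P.r X) p h = p := by
  have hx : p ≫ P.s X = x := by rw [← h, Category.assoc, hP.r_t, Category.comp_id]
  have := comp_conc p (P.s X ≫ P.r X) (𝟙 _) (by simp [hP.r_t])
  rw [hP.r_conc] at this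
  subst hx
  simpa using this.symm

theorem const_map (hP : P.IsPreMoore) {X Y T : E} (x : T ⟶ X) (l : T ⟶ P.M.obj (⊤_ E)) (f : X ⟶ Y) :
    P.const x l ≫ P.M.map f = P.const (x ≫ f) l := by
  have := hP.α_nat f (𝟙 (⊤_ E))
  simp only [const, Category.assoc, ← Functor.map_comp]
  have h2 : (prod.fst : X ⨯ ⊤_ E ⟶ X) ≫ f = prod.map f (𝟙 _) ≫ prod.fst := by simp
  rw [h2, Functor.map_comp, ← Category.assoc (P.α X _), ← this]
  simp [← Category.assoc]

theorem const_s (hP : P.IsPreMoore) {X T : E} (x : T ⟶ X) (l : T ⟶ P.M.obj (⊤_ E)) : P.const x l ≫ P.s X = x := by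
  simp only [const, Category.assoc, hP.s_nat]
  rw [← Category.assoc (P.α X _), hP.α_s]
  simp

theorem const_t (hP : P.IsPreMoore) {X T : E} (x : T ⟶ X) (l : T ⟶ P.M.obj (⊤_ E)) : P.const x l ≫ P.t X = x := by
  simp only [const, Category.assoc, hP.t_nat]
  rw [← Category.assoc (P.α X _), hP.α_t]
  simp

theorem mapConc_t (hP : P.IsPreMoore) {X T : E} (p q : T ⟶ P.M.obj (P.M.obj X))
    (h : p ≫ P.M.map (P.t X) = q ≫ P.M.map (P.s X)) :
    P.mapConc p q h ≫ P.t (P.M.obj X) = P.conc (p ≫ P.t _) (q ≫ P.t _)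
      (by simp only [Category.assoc, ← hP.t_nat, reassoc_of% h]) := by
  unfold mapConc conc
  rw [Category.assoc, Category.assoc, hP.t_nat, ← Category.assoc, ← Category.assoc]
  congr 1
  ext <;> simp [← hP.t_nat]

theorem mapConc_s (hP : P.IsPreMoore) {X T : E} (p q : T ⟶ P.M.obj (P.M.obj X))
    (h : p ≫ P.M.map (P.t X) = q ≫ P.M.map (P.s X)) :
    P.mapConc p q h ≫ P.s (P.M.obj X) = P.conc (p ≫ P.s _) (q ≫ P.s _)
      (by simp only [Category.assoc, ← hP.s_nat, reassoc_of% h]) := by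
  unfold mapConc conc
  rw [Category.assoc, Category.assoc, hP.s_nat, ← Category.assoc, ← Category.assoc]
  congr 1
  ext <;> simp [← hP.s_nat]

theorem Γ_map_t' (hP : P.IsPreMoore) {X T : E} (p : T ⟶ P.M.obj X) :
    (p ≫ P.Γ X) ≫ P.M.map (P.t X) = P.const (p ≫ P.t X) (P.len p) := by
  rw [Category.assoc, hP.Γ_map_t, comp_const, comp_len, Category.comp_id]

/-- The pointwise concatenation of `Γ.p` and `α.(q, M!.p)` makes sense. -/
theorem distrib_aux₁ (hP : P.IsPreMoore) {X T : E} (p q : T ⟶ P.M.obj X) (h : p ≫ P.t X = q ≫ P.s X) :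
    (p ≫ P.Γ X) ≫ P.M.map (P.t X) = P.const q (P.len p) ≫ P.M.map (P.s X) := by
  rw [hP.Γ_map_t', hP.const_map, h]

/-- The pointwise concatenation of `Γ.p` and `α.(q, M!.p)` ends where `Γ.q` starts. -/
theorem distrib_aux₂ (hP : P.IsPreMoore) {X T : E} (p q : T ⟶ P.M.obj X) (h : p ≫ P.t X = q ≫ P.s X) :
    P.mapConc (p ≫ P.Γ X) (P.const q (P.len p)) (hP.distrib_aux₁ p q h) ≫ P.t _ =
      (q ≫ P.Γ X) ≫ P.s _ := by
  rw [hP.mapConc_t, Category.assoc q, hP.Γ_s, Category.comp_id]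
  have h1 : (p ≫ P.Γ X) ≫ P.t _ = (p ≫ P.t X) ≫ P.r X := by simp [hP.Γ_t]
  simp only [hP.const_t, h1]
  exact hP.conc_r_left _ _ _

end IsPreMoore

end lemmas

/-- The axioms of a Moore structure. -/
structure IsMoore : Prop extends IsPreMoore P where
  /-- The distributive law
  `Γ.μ = μ.(Mμ.ν.(Γ.p₁, θ.α.(p₂, M!.p₁)), Γ.p₂)`. -/
  conc_Γ : ∀ {X T : E} (p q : T ⟶ P.M.obj X) (h : p ≫ P.t X = q ≫ P.s X),
    P.conc p q h ≫ P.Γ X =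
      P.conc (P.mapConc (p ≫ P.Γ X) (P.const q (P.len p))
          (toIsPreMoore.distrib_aux₁ p q h))
        (q ≫ P.Γ X) (toIsPreMoore.distrib_aux₂ p q h)

/-- The dual path data: the sources and targets are interchanged, `μ` is replaced by
`μ.(p₂, p₁)`, and `Γ` is replaced by a given `Γ'`. -/
def dual (Γ' : ∀ X : E, P.M.obj X ⟶ P.M.obj (P.M.obj X)) : PathData E where
  M := P.M
  preservesPullbacks := P.preservesPullbacks
  r := P.r
  s := P.t
  t := P.s
  μ X := pullback.lift (pullback.snd _ _) (pullback.fst _ _) pullback.condition.symm ≫ P.μ X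
  Γ := Γ'
  α := P.α

end PathData

/-- A Moore structure on a category with finite limits. -/
structure MooreStructure (E : Type u) [Category.{v} E] [HasFiniteLimits E] extends
    PathData E where
  isMoore : toPathData.IsMoore

/-- A two-sided Moore structure. -/
structure TwoSidedMooreStructure (E : Type u) [Category.{v} E] [HasFiniteLimits E] extends
    MooreStructure E where
  /-- the path cocontraction `Γ^*` -/
  Γ' : ∀ X : E, M.obj X ⟶ M.obj (M.obj X)
  /-- `Γ^*` makes the data with `s` and `t` interchanged into a Moore structure -/
  dual_isMoore : (toPathData.dual Γ').IsMoore
  conc_left_cancel : ∀ {X T : E} (p q q' : T ⟶ M.obj X) (h : p ≫ t X = q ≫ s X)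
    (h' : p ≫ t X = q' ≫ s X), toPathData.conc p q h = toPathData.conc p q' h' → q = q'
  conc_right_cancel : ∀ {X T : E} (p p' q : T ⟶ M.obj X) (h : p ≫ t X = q ≫ s X)
    (h' : p' ≫ t X = q ≫ s X), toPathData.conc p q h = toPathData.conc p' q h' → p = p'
  /-- the sandwich equation `Mμ.ν.(Γ^*, Γ) = α.(1, M!)` -/
  sandwich : ∀ X : E,
    toPathData.mapConc (Γ' X) (Γ X)
        ((dual_isMoore.Γ_map_s X).trans (isMoore.Γ_map_s X).symm) =
      toPathData.const (𝟙 _) (toPathData.len (𝟙 _))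

/-- A symmetric Moore structure: a two-sided Moore structure with a twist map `τ`. -/
structure SymmetricMooreStructure (E : Type u) [Category.{v} E] [HasFiniteLimits E] extends
    TwoSidedMooreStructure E where
  τ : ∀ X : E, M.obj X ⟶ M.obj X
  τ_nat : ∀ {X Y : E} (f : X ⟶ Y), M.map f ≫ τ Y = τ X ≫ M.map f
  τ_τ : ∀ X : E, τ X ≫ τ X = 𝟙 _
  r_τ : ∀ X : E, r X ≫ τ X = r X
  τ_s : ∀ X : E, τ X ≫ s X = t X
  τ_t : ∀ X : E, τ X ≫ t X = s X
  Γ'_eq : ∀ X : E, Γ' X = τ X ≫ Γ X ≫ M.map (τ X) ≫ τ (M.obj X)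
  const_τ : ∀ {X T : E} (x : T ⟶ X) (l : T ⟶ M.obj (⊤_ E)),
    toPathData.const x l ≫ τ X = toPathData.const x (l ≫ τ (⊤_ E))
  conc_τ : ∀ {X T : E} (p q : T ⟶ M.obj X) (h : p ≫ t X = q ≫ s X),
    toPathData.conc p q h ≫ τ X =
      toPathData.conc (q ≫ τ X) (p ≫ τ X) (by
        rw [Category.assoc, Category.assoc]
        exact (congrArg (q ≫ ·) (τ_t X)).trans (h.symm.trans (congrArg (p ≫ ·) (τ_s X)).symm))

/-! ### Dominances -/

/-- A dominance: a class of monomorphisms (the effective cofibrations) which contains all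
isomorphisms, is closed under composition, is stable under pullback, and such that the category
of its members and pullback squares between them has a terminal object. -/
structure Dominance (E : Type u) [Category.{v} E] where
  Cof : MorphismProperty E
  mono : ∀ {A B : E} (m : A ⟶ B), Cof m → Mono m
  isIso_mem : ∀ {A B : E} (m : A ⟶ B), IsIso m → Cof m
  comp_mem : ∀ {A B C : E} (m : A ⟶ B) (n : B ⟶ C), Cof m → Cof n → Cof (m ≫ n)
  pullback_mem : ∀ {A' A B' B : E} {f : A' ⟶ A} {m' : A' ⟶ B'} {m : A ⟶ B} {g : B' ⟶ B},
    IsPullback f m' m g → Cof m → Cof m'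
  exists_terminal : ∃ (U V : E) (tr : U ⟶ V), Cof tr ∧ ∀ {A B : E} (m : A ⟶ B), Cof m →
    ∃! c : (A ⟶ U) × (B ⟶ V), IsPullback c.1 m tr c.2

/-- The additional conditions on a dominance in a category with path data. -/
structure Dominance.IsAdmissible {E : Type u} [Category.{v} E] [HasFiniteLimits E]
    [HasFiniteColimits E] (D : Dominance E) (P : PathData E) : Prop where
  /-- closure under binary unions of subobjects -/
  union_mem : ∀ {X : E} (A B C : Subobject X), D.Cof A.arrow → D.Cof B.arrow →
    IsLUB {A, B} C → D.Cof C.arrow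
  /-- every object is cofibrant -/
  initial_mem : ∀ A : E, D.Cof (initial.to A)
  /-- the trivial path maps are effective cofibrations -/
  r_mem : ∀ X : E, D.Cof (P.r X)

/-! ### Hyperdeformation retracts -/

section HDR

variable {E : Type u} [Category.{v} E] [HasFiniteLimits E]

/-- The structure of a hyperdeformation retract (HDR) on `i : A ⟶ B`. -/
@[ext]
structure HDR (P : PathData E) {A B : E} (i : A ⟶ B) where
  j : B ⟶ A
  H : B ⟶ P.M.obj B
  i_j : i ≫ j = 𝟙 A
  H_s : H ≫ P.s B = 𝟙 B
  H_t : H ≫ P.t B = j ≫ i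
  H_H : H ≫ P.M.map H = H ≫ P.Γ B

/-- Morphisms of HDRs. -/
structure HDR.IsHom {P : PathData E} {A' B' A B : E} {i' : A' ⟶ B'} {i : A ⟶ B}
    (η' : HDR P i') (η : HDR P i) (f : A' ⟶ A) (g : B' ⟶ B) : Prop where
  comm_i : i' ≫ g = f ≫ i
  comm_j : η'.j ≫ f = g ≫ η.j
  comm_H : η'.H ≫ P.M.map g = g ≫ η.H

theorem PathData.conc_congr {P : PathData E} {X T : E} {p q p' q' : T ⟶ P.M.obj X}
    (h : p ≫ P.t X = q ≫ P.s X) (hp : p = p') (hq : q = q') :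
    P.conc p q h = P.conc p' q' (by rw [← hp, ← hq, h]) := by
  subst hp hq; rfl

theorem PathData.mapConc_congr {P : PathData E} {X T : E}
    {p q p' q' : T ⟶ P.M.obj (P.M.obj X)}
    (h : p ≫ P.M.map (P.t X) = q ≫ P.M.map (P.s X)) (hp : p = p') (hq : q = q') :
    P.mapConc p q h = P.mapConc p' q' (by rw [← hp, ← hq, h]) := by
  subst hp hq; rfl

namespace HDR

variable {𝓜 : MooreStructure E}

theorem i_H {A B : E} {i : A ⟶ B} (η : HDR 𝓜.toPathData i) : i ≫ η.H = i ≫ 𝓜.r B := by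
  have hM := 𝓜.isMoore
  have h1 : η.H ≫ 𝓜.t B ≫ η.H = η.H ≫ 𝓜.t B ≫ 𝓜.r B := by
    rw [← hM.t_nat, ← Category.assoc, η.H_H, Category.assoc, hM.Γ_t]
  have h2 : i ≫ η.H ≫ 𝓜.t B = i := by
    rw [η.H_t, ← Category.assoc, η.i_j, Category.id_comp]
  calc i ≫ η.H = i ≫ η.H ≫ 𝓜.t B ≫ η.H := by
        simpa only [Category.assoc] using congrArg (fun k => k ≫ η.H) h2.symm
    _ = i ≫ η.H ≫ 𝓜.t B ≫ 𝓜.r B := by rw [h1]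
    _ = i ≫ 𝓜.r B := by
        simpa only [Category.assoc] using congrArg (fun k => k ≫ 𝓜.r B) h2

theorem H_map_j {A B : E} {i : A ⟶ B} (η : HDR 𝓜.toPathData i) :
    η.H ≫ 𝓜.M.map η.j = 𝓜.const η.j (𝓜.len η.H) := by
  have hM := 𝓜.isMoore
  have hmono : 𝓜.M.map i ≫ 𝓜.M.map η.j = 𝟙 _ := by
    rw [← Functor.map_comp, η.i_j, CategoryTheory.Functor.map_id]
  have : (η.H ≫ 𝓜.M.map η.j) ≫ 𝓜.M.map i = 𝓜.const η.j (𝓜.len η.H) ≫ 𝓜.M.map i := by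
    rw [hM.const_map, Category.assoc, ← Functor.map_comp, ← η.H_t, Functor.map_comp,
      ← Category.assoc, η.H_H, hM.Γ_map_t']
  have h2 := congrArg (fun k => k ≫ 𝓜.M.map η.j) this
  simpa only [Category.assoc, hmono, Category.comp_id] using h2

/-- The vertical composition of HDRs: the retraction is `j₀.j₁` and the homotopy is
`μ.(H₁, M i₁.H₀.j₁)`. -/
def comp {A B C : E} {i₀ : A ⟶ B} {i₁ : B ⟶ C} (η₀ : HDR 𝓜.toPathData i₀)
    (η₁ : HDR 𝓜.toPathData i₁) : HDR 𝓜.toPathData (i₀ ≫ i₁) :=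
  have hM := 𝓜.isMoore
  have hK : η₁.H ≫ 𝓜.t C = (η₁.j ≫ η₀.H ≫ 𝓜.M.map i₁) ≫ 𝓜.s C := by
    rw [η₁.H_t]
    simp only [Category.assoc, hM.s_nat, reassoc_of% η₀.H_s]
  { j := η₁.j ≫ η₀.j
    H := 𝓜.conc η₁.H (η₁.j ≫ η₀.H ≫ 𝓜.M.map i₁) hK
    i_j := by simp only [Category.assoc, reassoc_of% η₁.i_j, η₀.i_j]
    H_s := by rw [hM.conc_s, η₁.H_s]
    H_t := by
      rw [hM.conc_t]
      simp only [Category.assoc, hM.t_nat, reassoc_of% η₀.H_t]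
    H_H := by
      have h1 : i₁ ≫ 𝓜.conc η₁.H (η₁.j ≫ η₀.H ≫ 𝓜.M.map i₁) hK = η₀.H ≫ 𝓜.M.map i₁ := by
        rw [PathData.comp_conc, PathData.conc_congr _ η₁.i_H rfl, hM.conc_r_left,
          ← Category.assoc, η₁.i_j, Category.id_comp]
      rw [hM.conc_map, hM.conc_Γ]
      apply PathData.conc_congr
      · rw [PathData.map_conc, PathData.comp_mapConc]
        apply PathData.mapConc_congr
        · exact η₁.H_H
        · rw [Functor.map_comp, ← Category.assoc, η₁.H_map_j, hM.const_map]
      · simp only [Category.assoc]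
        rw [← Functor.map_comp, h1, Functor.map_comp, hM.Γ_nat, reassoc_of% η₀.H_H] }

end HDR

end HDR

/-! ### Mould squares -/

section Mould

variable {E : Type u} [Category.{v} E] [HasFiniteLimits E]

/-- A mould square
```
A' --i'--> B'
|m         |m'
A  --i-->  B
```
is a morphism of HDRs from `i'` to `i` which is cartesian, i.e. whose square of retractions is
a pullback, and for which `m` is an effective cofibration. -/
structure IsMould (D : Dominance E) {P : PathData E} {A' B' A B : E} {i' : A' ⟶ B'} {i : A ⟶ B}
    (η' : HDR P i') (η : HDR P i) (m : A' ⟶ A) (m' : B' ⟶ B) : Prop where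
  isHom : HDR.IsHom η' η m m'
  cart : IsPullback m' η'.j η.j m
  cof : D.Cof m

namespace IsMould

variable {D : Dominance E} {𝓜 : MooreStructure E}

/-- Horizontal composition of mould squares. -/
theorem hcomp {A' B' C' A B C : E} {i₀' : A' ⟶ B'} {i₁' : B' ⟶ C'} {i₀ : A ⟶ B} {i₁ : B ⟶ C}
    {η₀' : HDR 𝓜.toPathData i₀'} {η₁' : HDR 𝓜.toPathData i₁'}
    {η₀ : HDR 𝓜.toPathData i₀} {η₁ : HDR 𝓜.toPathData i₁}
    {m : A' ⟶ A} {m' : B' ⟶ B} {m'' : C' ⟶ C}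
    (S₀ : IsMould D η₀' η₀ m m') (S₁ : IsMould D η₁' η₁ m' m'') :
    IsMould D (η₀'.comp η₁') (η₀.comp η₁) m m'' where
  isHom :=
    { comm_i := by
        rw [Category.assoc, S₁.isHom.comm_i, reassoc_of% S₀.isHom.comm_i]
      comm_j := by
        dsimp [HDR.comp]
        rw [Category.assoc, S₀.isHom.comm_j, reassoc_of% S₁.isHom.comm_j]
      comm_H := by
        dsimp [HDR.comp]
        rw [𝓜.isMoore.conc_map, PathData.comp_conc]
        apply PathData.conc_congr
        · exact S₁.isHom.comm_H
        · simp only [Category.assoc]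
          rw [← Functor.map_comp, S₁.isHom.comm_i, Functor.map_comp, reassoc_of% S₀.isHom.comm_H,
            reassoc_of% S₁.isHom.comm_j] }
  cart := S₁.cart.paste_vert S₀.cart
  cof := S₀.cof

/-- Vertical composition of mould squares. -/
theorem vcomp {P : PathData E} {A'' B'' A' B' A B : E} {i'' : A'' ⟶ B''} {i' : A' ⟶ B'}
    {i : A ⟶ B} {η'' : HDR P i''} {η' : HDR P i'} {η : HDR P i}
    {w : A'' ⟶ A'} {w' : B'' ⟶ B'} {m : A' ⟶ A} {m' : B' ⟶ B}
    (S₀ : IsMould D η'' η' w w') (S₁ : IsMould D η' η m m') :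
    IsMould D η'' η (w ≫ m) (w' ≫ m') where
  isHom :=
    { comm_i := by rw [reassoc_of% S₀.isHom.comm_i, S₁.isHom.comm_i, Category.assoc]
      comm_j := by
        rw [reassoc_of% S₀.isHom.comm_j, S₁.isHom.comm_j, Category.assoc]
      comm_H := by
        rw [Functor.map_comp, reassoc_of% S₀.isHom.comm_H, S₁.isHom.comm_H, Category.assoc] }
  cart := S₀.cart.paste_horiz S₁.cart
  cof := D.comp_mem _ _ S₀.cof S₁.cof

end IsMould

/-- A cube of the triple category of mould squares: a mould square `S₁` over `i₁`, obtained by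
pulling back a mould square `S₀` over `i₀` along the morphism of HDRs `(u, w) : i₁ ⟶ i₀`. -/
structure IsMouldCube (D : Dominance E) {P : PathData E} {A₁' B₁' A₁ B₁ A₀' B₀' A₀ B₀ : E}
    {i₁' : A₁' ⟶ B₁'} {i₁ : A₁ ⟶ B₁} {i₀' : A₀' ⟶ B₀'} {i₀ : A₀ ⟶ B₀}
    (η₁' : HDR P i₁') (η₁ : HDR P i₁) (η₀' : HDR P i₀') (η₀ : HDR P i₀)
    (m₁ : A₁' ⟶ A₁) (m₁' : B₁' ⟶ B₁) (m₀ : A₀' ⟶ A₀) (m₀' : B₀' ⟶ B₀)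
    (u' : A₁' ⟶ A₀') (w' : B₁' ⟶ B₀') (u : A₁ ⟶ A₀) (w : B₁ ⟶ B₀) : Prop where
  source : IsMould D η₁' η₁ m₁ m₁'
  target : IsMould D η₀' η₀ m₀ m₀'
  isHom' : HDR.IsHom η₁' η₀' u' w'
  isHom : HDR.IsHom η₁ η₀ u w
  cart : IsPullback u' m₁ m₀ u
  cart' : IsPullback w' m₁' m₀' w

end Mould

/-! ### Effective fibrations -/

section EffFib

variable {E : Type u} [Category.{v} E] [HasFiniteLimits E]

/-- The data of a lifting problem of a square (with `i' ≫ m' = m ≫ i`) against `p : Y ⟶ X`: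
```
A' --i'--> B' --a--> Y
|m         |m'       |p
A  --i-->  B  --b--> X
```
together with a map `k : A ⟶ Y`, such that everything commutes. -/
structure IsProblem {Y X A' B' A B : E} (p : Y ⟶ X) (i' : A' ⟶ B') (i : A ⟶ B) (m : A' ⟶ A)
    (m' : B' ⟶ B) (a : B' ⟶ Y) (k : A ⟶ Y) (b : B ⟶ X) : Prop where
  comm : i' ≫ a = m ≫ k
  upper : a ≫ p = m' ≫ b
  left : k ≫ p = i ≫ b

/-- A choice of a filler `B ⟶ Y` for every lifting problem of a mould square against `p`. -/
structure Filling (𝓜 : MooreStructure E) (D : Dominance E) {Y X : E} (p : Y ⟶ X) where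
  fill : ∀ {A' B' A B : E} {i' : A' ⟶ B'} {i : A ⟶ B} {η' : HDR 𝓜.toPathData i'}
    {η : HDR 𝓜.toPathData i} {m : A' ⟶ A} {m' : B' ⟶ B} (_ : IsMould D η' η m m')
    {a : B' ⟶ Y} {k : A ⟶ Y} {b : B ⟶ X}, IsProblem p i' i m m' a k b → (B ⟶ Y)
  upper_fill : ∀ {A' B' A B : E} {i' : A' ⟶ B'} {i : A ⟶ B} {η' : HDR 𝓜.toPathData i'}
    {η : HDR 𝓜.toPathData i} {m : A' ⟶ A} {m' : B' ⟶ B} (S : IsMould D η' η m m')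
    {a : B' ⟶ Y} {k : A ⟶ Y} {b : B ⟶ X} (h : IsProblem p i' i m m' a k b), m' ≫ fill S h = a
  left_fill : ∀ {A' B' A B : E} {i' : A' ⟶ B'} {i : A ⟶ B} {η' : HDR 𝓜.toPathData i'}
    {η : HDR 𝓜.toPathData i} {m : A' ⟶ A} {m' : B' ⟶ B} (S : IsMould D η' η m m')
    {a : B' ⟶ Y} {k : A ⟶ Y} {b : B ⟶ X} (h : IsProblem p i' i m m' a k b), i ≫ fill S h = k
  fill_comp : ∀ {A' B' A B : E} {i' : A' ⟶ B'} {i : A ⟶ B} {η' : HDR 𝓜.toPathData i'}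
    {η : HDR 𝓜.toPathData i} {m : A' ⟶ A} {m' : B' ⟶ B} (S : IsMould D η' η m m')
    {a : B' ⟶ Y} {k : A ⟶ Y} {b : B ⟶ X} (h : IsProblem p i' i m m' a k b), fill S h ≫ p = b

namespace Filling

variable {𝓜 : MooreStructure E} {D : Dominance E} {Y X : E} {p : Y ⟶ X} (φ : Filling 𝓜 D p)

/-- For a horizontal composite of mould squares, the lifting problem for the left square. -/
theorem hproblem₀ {A' B' C' A B C : E} {i₀' : A' ⟶ B'} {i₁' : B' ⟶ C'} {i₀ : A ⟶ B}
    {i₁ : B ⟶ C} {η₁' : HDR 𝓜.toPathData i₁'} {η₁ : HDR 𝓜.toPathData i₁}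
    {m : A' ⟶ A} {m' : B' ⟶ B} {m'' : C' ⟶ C}
    (S₁ : IsMould D η₁' η₁ m' m'') {a : C' ⟶ Y} {k : A ⟶ Y} {b : C ⟶ X}
    (h : IsProblem p (i₀' ≫ i₁') (i₀ ≫ i₁) m m'' a k b) :
    IsProblem p i₀' i₀ m m' (i₁' ≫ a) k (i₁ ≫ b) where
  comm := by rw [← Category.assoc, h.comm]
  upper := by rw [Category.assoc, h.upper, reassoc_of% S₁.isHom.comm_i]
  left := by rw [h.left, Category.assoc]

/-- For a horizontal composite of mould squares, the lifting problem for the right square, once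
the left one has been filled. -/
theorem hproblem₁ {A' B' C' A B C : E} {i₀' : A' ⟶ B'} {i₁' : B' ⟶ C'} {i₀ : A ⟶ B}
    {i₁ : B ⟶ C} {η₀' : HDR 𝓜.toPathData i₀'} {η₁' : HDR 𝓜.toPathData i₁'}
    {η₀ : HDR 𝓜.toPathData i₀} {η₁ : HDR 𝓜.toPathData i₁}
    {m : A' ⟶ A} {m' : B' ⟶ B} {m'' : C' ⟶ C}
    (S₀ : IsMould D η₀' η₀ m m') (S₁ : IsMould D η₁' η₁ m' m'')
    {a : C' ⟶ Y} {k : A ⟶ Y} {b : C ⟶ X}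
    (h : IsProblem p (i₀' ≫ i₁') (i₀ ≫ i₁) m m'' a k b) :
    IsProblem p i₁' i₁ m' m'' a (φ.fill S₀ (hproblem₀ S₁ h)) b where
  comm := (φ.upper_fill S₀ _).symm
  upper := h.upper
  left := φ.fill_comp S₀ _

/-- For a vertical composite of mould squares, the lifting problem for the upper square. -/
theorem vproblem₀ {A'' B'' A' B' A B : E} {i'' : A'' ⟶ B''} {i' : A' ⟶ B'} {i : A ⟶ B}
    {η' : HDR 𝓜.toPathData i'} {η : HDR 𝓜.toPathData i}
    {w : A'' ⟶ A'} {w' : B'' ⟶ B'} {m : A' ⟶ A} {m' : B' ⟶ B}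
    (S₁ : IsMould D η' η m m') {a : B'' ⟶ Y} {k : A ⟶ Y} {b : B ⟶ X}
    (h : IsProblem p i'' i (w ≫ m) (w' ≫ m') a k b) :
    IsProblem p i'' i' w w' a (m ≫ k) (m' ≫ b) where
  comm := by rw [h.comm, Category.assoc]
  upper := by rw [h.upper, Category.assoc]
  left := by rw [Category.assoc, h.left, reassoc_of% S₁.isHom.comm_i]

/-- For a vertical composite of mould squares, the lifting problem for the lower square, once
the upper one has been filled. -/
theorem vproblem₁ {A'' B'' A' B' A B : E} {i'' : A'' ⟶ B''} {i' : A' ⟶ B'} {i : A ⟶ B}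
    {η'' : HDR 𝓜.toPathData i''} {η' : HDR 𝓜.toPathData i'} {η : HDR 𝓜.toPathData i}
    {w : A'' ⟶ A'} {w' : B'' ⟶ B'} {m : A' ⟶ A} {m' : B' ⟶ B}
    (S₀ : IsMould D η'' η' w w') (S₁ : IsMould D η' η m m')
    {a : B'' ⟶ Y} {k : A ⟶ Y} {b : B ⟶ X}
    (h : IsProblem p i'' i (w ≫ m) (w' ≫ m') a k b) :
    IsProblem p i' i m m' (φ.fill S₀ (vproblem₀ S₁ h)) k b where
  comm := φ.left_fill S₀ _
  upper := φ.fill_comp S₀ _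
  left := h.left

/-- For a cube, the lifting problem for the source induced by one for the target. -/
theorem cubeProblem {A₁' B₁' A₁ B₁ A₀' B₀' A₀ B₀ : E}
    {i₁' : A₁' ⟶ B₁'} {i₁ : A₁ ⟶ B₁} {i₀' : A₀' ⟶ B₀'} {i₀ : A₀ ⟶ B₀}
    {η₁' : HDR 𝓜.toPathData i₁'} {η₁ : HDR 𝓜.toPathData i₁}
    {η₀' : HDR 𝓜.toPathData i₀'} {η₀ : HDR 𝓜.toPathData i₀}
    {m₁ : A₁' ⟶ A₁} {m₁' : B₁' ⟶ B₁} {m₀ : A₀' ⟶ A₀} {m₀' : B₀' ⟶ B₀}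
    {u' : A₁' ⟶ A₀'} {w' : B₁' ⟶ B₀'} {u : A₁ ⟶ A₀} {w : B₁ ⟶ B₀}
    (C : IsMouldCube D η₁' η₁ η₀' η₀ m₁ m₁' m₀ m₀' u' w' u w)
    {a : B₀' ⟶ Y} {k : A₀ ⟶ Y} {b : B₀ ⟶ X} (h : IsProblem p i₀' i₀ m₀ m₀' a k b) :
    IsProblem p i₁' i₁ m₁ m₁' (w' ≫ a) (u ≫ k) (w ≫ b) where
  comm := by rw [reassoc_of% C.isHom'.comm_i, h.comm, reassoc_of% C.cart.w]
  upper := by rw [Category.assoc, h.upper, reassoc_of% C.cart'.w]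
  left := by rw [Category.assoc, h.left, reassoc_of% C.isHom.comm_i]

end Filling

/-- The structure of an effective fibration on `p : Y ⟶ X`: a right lifting structure with
respect to the triple category of mould squares, that is, a choice of fillers satisfying the
horizontal, vertical and perpendicular conditions. -/
structure EffFibStr (𝓜 : MooreStructure E) (D : Dominance E) {Y X : E} (p : Y ⟶ X) extends
    Filling 𝓜 D p where
  horizontal : ∀ {A' B' C' A B C : E} {i₀' : A' ⟶ B'} {i₁' : B' ⟶ C'} {i₀ : A ⟶ B}
    {i₁ : B ⟶ C} {η₀' : HDR 𝓜.toPathData i₀'} {η₁' : HDR 𝓜.toPathData i₁'}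
    {η₀ : HDR 𝓜.toPathData i₀} {η₁ : HDR 𝓜.toPathData i₁}
    {m : A' ⟶ A} {m' : B' ⟶ B} {m'' : C' ⟶ C}
    (S₀ : IsMould D η₀' η₀ m m') (S₁ : IsMould D η₁' η₁ m' m'')
    {a : C' ⟶ Y} {k : A ⟶ Y} {b : C ⟶ X}
    (h : IsProblem p (i₀' ≫ i₁') (i₀ ≫ i₁) m m'' a k b),
    fill (S₀.hcomp S₁) h = fill S₁ (toFilling.hproblem₁ S₀ S₁ h)
  vertical : ∀ {A'' B'' A' B' A B : E} {i'' : A'' ⟶ B''} {i' : A' ⟶ B'} {i : A ⟶ B}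
    {η'' : HDR 𝓜.toPathData i''} {η' : HDR 𝓜.toPathData i'} {η : HDR 𝓜.toPathData i}
    {w : A'' ⟶ A'} {w' : B'' ⟶ B'} {m : A' ⟶ A} {m' : B' ⟶ B}
    (S₀ : IsMould D η'' η' w w') (S₁ : IsMould D η' η m m')
    {a : B'' ⟶ Y} {k : A ⟶ Y} {b : B ⟶ X}
    (h : IsProblem p i'' i (w ≫ m) (w' ≫ m') a k b),
    fill (S₀.vcomp S₁) h = fill S₁ (toFilling.vproblem₁ S₀ S₁ h)
  perpendicular : ∀ {A₁' B₁' A₁ B₁ A₀' B₀' A₀ B₀ : E}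
    {i₁' : A₁' ⟶ B₁'} {i₁ : A₁ ⟶ B₁} {i₀' : A₀' ⟶ B₀'} {i₀ : A₀ ⟶ B₀}
    {η₁' : HDR 𝓜.toPathData i₁'} {η₁ : HDR 𝓜.toPathData i₁}
    {η₀' : HDR 𝓜.toPathData i₀'} {η₀ : HDR 𝓜.toPathData i₀}
    {m₁ : A₁' ⟶ A₁} {m₁' : B₁' ⟶ B₁} {m₀ : A₀' ⟶ A₀} {m₀' : B₀' ⟶ B₀}
    {u' : A₁' ⟶ A₀'} {w' : B₁' ⟶ B₀'} {u : A₁ ⟶ A₀} {w : B₁ ⟶ B₀}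
    (C : IsMouldCube D η₁' η₁ η₀' η₀ m₁ m₁' m₀ m₀' u' w' u w)
    {a : B₀' ⟶ Y} {k : A₀ ⟶ Y} {b : B₀ ⟶ X} (h : IsProblem p i₀' i₀ m₀ m₀' a k b),
    w ≫ fill C.target h = fill C.source (Filling.cubeProblem C h)

/-- A lifting problem can be composed with a commutative square. -/
theorem IsProblem.comp {Y' X' Y X A' B' A B : E} {p' : Y' ⟶ X'} {p : Y ⟶ X} {i' : A' ⟶ B'}
    {i : A ⟶ B} {m : A' ⟶ A} {m' : B' ⟶ B} {a : B' ⟶ Y'} {k : A ⟶ Y'} {b : B ⟶ X'}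
    (h : IsProblem p' i' i m m' a k b) {y : Y' ⟶ Y} {x : X' ⟶ X} (hc : y ≫ p = p' ≫ x) :
    IsProblem p i' i m m' (a ≫ y) (k ≫ y) (b ≫ x) where
  comm := by rw [← Category.assoc, h.comm, Category.assoc]
  upper := by rw [Category.assoc, hc, ← Category.assoc, h.upper, Category.assoc]
  left := by rw [Category.assoc, hc, ← Category.assoc, h.left, Category.assoc]

/-- A commutative square `(y, x) : p' ⟶ p` is a morphism of effective fibrations if it preserves
the chosen fillers. -/
structure EffFibStr.IsHom {𝓜 : MooreStructure E} {D : Dominance E} {Y' X' Y X : E}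
    {p' : Y' ⟶ X'} {p : Y ⟶ X} (φ' : EffFibStr 𝓜 D p') (φ : EffFibStr 𝓜 D p)
    (y : Y' ⟶ Y) (x : X' ⟶ X) : Prop where
  comm : y ≫ p = p' ≫ x
  fill_comp : ∀ {A' B' A B : E} {i' : A' ⟶ B'} {i : A ⟶ B} {η' : HDR 𝓜.toPathData i'}
    {η : HDR 𝓜.toPathData i} {m : A' ⟶ A} {m' : B' ⟶ B} (S : IsMould D η' η m m')
    {a : B' ⟶ Y'} {k : A ⟶ Y'} {b : B ⟶ X'} (h : IsProblem p' i' i m m' a k b),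
    φ'.fill S h ≫ y = φ.fill S (h.comp comm)

namespace EffFibStr

variable {𝓜 : MooreStructure E} {D : Dominance E}

theorem fill_congr {Y X : E} {p : Y ⟶ X} (φ : EffFibStr 𝓜 D p)
    {A' B' A B : E} {i' : A' ⟶ B'} {i : A ⟶ B} {η' : HDR 𝓜.toPathData i'}
    {η : HDR 𝓜.toPathData i} {m : A' ⟶ A} {m' : B' ⟶ B} (S : IsMould D η' η m m')
    {a a' : B' ⟶ Y} {k k' : A ⟶ Y} {b b' : B ⟶ X} (h : IsProblem p i' i m m' a k b)
    (ha : a = a') (hk : k = k') (hb : b = b') :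
    φ.fill S h = φ.fill S (a := a') (k := k') (b := b') (by subst ha hk hb; exact h) := by
  subst ha hk hb; rfl

theorem IsHom.id {Y X : E} {p : Y ⟶ X} (φ : EffFibStr 𝓜 D p) : φ.IsHom φ (𝟙 Y) (𝟙 X) where
  comm := by simp
  fill_comp S a k b h := by
    rw [Category.comp_id]
    exact φ.fill_congr S h (by simp) (by simp) (by simp)

theorem IsHom.comp {Y'' X'' Y' X' Y X : E} {p'' : Y'' ⟶ X''} {p' : Y' ⟶ X'} {p : Y ⟶ X}
    {φ'' : EffFibStr 𝓜 D p''} {φ' : EffFibStr 𝓜 D p'} {φ : EffFibStr 𝓜 D p}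
    {y' : Y'' ⟶ Y'} {x' : X'' ⟶ X'} {y : Y' ⟶ Y} {x : X' ⟶ X}
    (h' : φ''.IsHom φ' y' x') (h : φ'.IsHom φ y x) : φ''.IsHom φ (y' ≫ y) (x' ≫ x) where
  comm := by rw [Category.assoc, h.comm, ← Category.assoc, h'.comm, Category.assoc]
  fill_comp S a k b hp := by
    rw [← Category.assoc, h'.fill_comp, h.fill_comp]
    exact φ.fill_congr S _ (by simp) (by simp) (by simp)

/-- The structure of an effective fibration on a pullback of an effective fibration. -/
def pullback {Y' X' Y X : E} {y : Y' ⟶ Y} {p' : Y' ⟶ X'} {p : Y ⟶ X} {x : X' ⟶ X}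
    (sq : IsPullback y p' p x) (φ : EffFibStr 𝓜 D p) : EffFibStr 𝓜 D p' where
  fill S a k b h := sq.lift (φ.fill S (h.comp sq.w)) b (φ.fill_comp S _)
  upper_fill S a k b h := by
    apply sq.hom_ext
    · rw [Category.assoc, sq.lift_fst, φ.upper_fill]
    · rw [Category.assoc, sq.lift_snd, h.upper]
  left_fill S a k b h := by
    apply sq.hom_ext
    · rw [Category.assoc, sq.lift_fst, φ.left_fill]
    · rw [Category.assoc, sq.lift_snd, h.left]
  fill_comp S a k b h := sq.lift_snd _ _ _
  horizontal S₀ S₁ a k b h := by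
    apply sq.hom_ext
    · rw [sq.lift_fst, sq.lift_fst, φ.horizontal]
      exact φ.fill_congr _ _ rfl ((φ.fill_congr _ _ (Category.assoc _ _ _).symm rfl
        (Category.assoc _ _ _).symm).trans (sq.lift_fst _ _ _).symm) rfl
    · rw [sq.lift_snd, sq.lift_snd]
  vertical S₀ S₁ a k b h := by
    apply sq.hom_ext
    · rw [sq.lift_fst, sq.lift_fst, φ.vertical]
      exact φ.fill_congr _ _ ((φ.fill_congr _ _ rfl (Category.assoc _ _ _).symm
        (Category.assoc _ _ _).symm).trans (sq.lift_fst _ _ _).symm) rfl rfl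
    · rw [sq.lift_snd, sq.lift_snd]
  perpendicular C a k b h := by
    apply sq.hom_ext
    · rw [Category.assoc, sq.lift_fst, sq.lift_fst, φ.perpendicular C]
      exact φ.fill_congr _ _ (Category.assoc _ _ _).symm (Category.assoc _ _ _).symm
        (Category.assoc _ _ _).symm
    · rw [Category.assoc, sq.lift_snd, sq.lift_snd]

end EffFibStr

/-- An effective fibration: a morphism with the structure of an effective fibration. -/
structure EffFib (𝓜 : MooreStructure E) (D : Dominance E) where
  {Y X : E}
  p : Y ⟶ X
  str : EffFibStr 𝓜 D p

/-- Morphisms of effective fibrations. -/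
@[ext]
structure EffFib.Hom {𝓜 : MooreStructure E} {D : Dominance E} (F G : EffFib 𝓜 D) where
  top : F.Y ⟶ G.Y
  base : F.X ⟶ G.X
  isHom : F.str.IsHom G.str top base

/-- The category `EffFib` of effective fibrations. -/
instance EffFib.instCategory (𝓜 : MooreStructure E) (D : Dominance E) : Category (EffFib 𝓜 D) where
  Hom := EffFib.Hom
  id F := ⟨𝟙 _, 𝟙 _, .id _⟩
  comp a b := ⟨a.top ≫ b.top, a.base ≫ b.base, a.isHom.comp b.isHom⟩

/-- The forgetful functor from effective fibrations to arrows. -/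
def EffFib.forget (𝓜 : MooreStructure E) (D : Dominance E) : EffFib 𝓜 D ⥤ Arrow E where
  obj F := Arrow.mk F.p
  map {F G} (a : EffFib.Hom F G) := Arrow.homMk a.top a.base a.isHom.comm

/-- A composable pair of effective fibrations, i.e. an object of `EffFib ×_E EffFib`. -/
structure EffFibPair (𝓜 : MooreStructure E) (D : Dominance E) extends CartPair E where
  gStr : EffFibStr 𝓜 D g
  fStr : EffFibStr 𝓜 D f

/-- A morphism of composable pairs of effective fibrations: a pair of morphisms of effective
fibrations with a common side, the one between the fibrations along which one pushes forward
being a pullback square. -/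
@[ext]
structure EffFibPair.Hom {𝓜 : MooreStructure E} {D : Dominance E} (p q : EffFibPair 𝓜 D)
    extends CartPair.Hom p.toCartPair q.toCartPair where
  g_isHom : p.gStr.IsHom q.gStr y x
  f_isHom : p.fStr.IsHom q.fStr z y

/-- The category `EffFib ×_E EffFib` of composable pairs of effective fibrations. -/
instance EffFibPair.instCategory (𝓜 : MooreStructure E) (D : Dominance E) :
    Category (EffFibPair 𝓜 D) where
  Hom := EffFibPair.Hom
  id p := ⟨CategoryStruct.id (obj := CartPair E) p.toCartPair, .id _, .id _⟩
  comp a b := ⟨CategoryStruct.comp (obj := CartPair E) a.toHom b.toHom,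
    a.g_isHom.comp b.g_isHom, a.f_isHom.comp b.f_isHom⟩
  id_comp a := by apply EffFibPair.Hom.ext <;> exact Category.id_comp _
  comp_id a := by apply EffFibPair.Hom.ext <;> exact Category.comp_id _
  assoc a b c := by apply EffFibPair.Hom.ext <;> exact Category.assoc _ _ _

/-- The functor which forgets the structures of effective fibrations. -/
def EffFibPair.forget (𝓜 : MooreStructure E) (D : Dominance E) : EffFibPair 𝓜 D ⥤ CartPair E where
  obj p := p.toCartPair
  map {p q} (a : EffFibPair.Hom p q) := a.toHom

/-- An effective fibration with codomain `X`. -/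
structure EffFibOver (𝓜 : MooreStructure E) (D : Dominance E) (X : E) where
  obj : Over X
  str : EffFibStr 𝓜 D obj.hom

namespace EffFibOver

variable {𝓜 : MooreStructure E} {D : Dominance E}

/-- Maps over `X` between effective fibrations with codomain `X`. -/
instance (X : E) : Category (EffFibOver 𝓜 D X) where
  Hom F G := F.obj ⟶ G.obj
  id F := 𝟙 F.obj
  comp a b := CategoryStruct.comp (obj := Over X) a b

/-- The forgetful functor to the slice category. -/
def forget (𝓜 : MooreStructure E) (D : Dominance E) (X : E) : EffFibOver 𝓜 D X ⥤ Over X where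
  obj F := F.obj
  map a := a

/-- A map over `X` between effective fibrations is structure preserving if it preserves the
chosen fillers. -/
def IsStructured {X : E} {F G : EffFibOver 𝓜 D X} (a : F ⟶ G) : Prop :=
  F.str.IsHom G.str ((forget 𝓜 D X).map a).left (𝟙 X)

/-- An effective fibration with codomain `X`, as an effective fibration. -/
def toEffFib {X : E} (F : EffFibOver 𝓜 D X) : EffFib 𝓜 D := ⟨F.obj.hom, F.str⟩

/-- Pullback of effective fibrations along `g : Y ⟶ X`. -/
def pullback (𝓜 : MooreStructure E) (D : Dominance E) {X Y : E} (g : Y ⟶ X) :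
    EffFibOver 𝓜 D X ⥤ EffFibOver 𝓜 D Y where
  obj F := ⟨(Over.pullback g).obj F.obj, F.str.pullback (IsPullback.of_hasPullback F.obj.hom g)⟩
  map a := (Over.pullback g).map a
  map_id F := (Over.pullback g).map_id F.obj
  map_comp a b := (Over.pullback g).map_comp (X := _) (Y := _) (Z := _) a b

/-- The composable pair of effective fibrations given by an effective fibration `g : Y ⟶ X` and
an effective fibration `F` with codomain `Y`. -/
def pair {X Y : E} (g : Y ⟶ X) (γ : EffFibStr 𝓜 D g) (F : EffFibOver 𝓜 D Y) :
    EffFibPair 𝓜 D :=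
  ⟨⟨g, F.obj.hom⟩, γ, F.str⟩

end EffFibOver

end EffFib

end

end MooreCat

/-! A mould square against `Π_g f` is filled by transposition: pull the square back along `g`, and
fill the resulting problem against `f`. Maps over `X` from `B` into `Π_g f` are maps over `Y` from
`B ×_X Y` to `Z`, so transposing the data costs nothing. What needs proof is that an HDR over `X`
pulls back along `g` to an HDR, and that this respects mould squares, both of their compositions,
and cubes. The three conditions on fillers for `Π_g f` are then those for `f`.

To pull back an HDR, its homotopy `B → MB` has to be lifted to `B ×_X Y` with a prescribed start. A
functorial transport of elements of `Y` along paths of `X` suffices (`Transport`). The map `Γ*`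
sends a path `q` to the path of its initial segments; transporting `e` along all of them at once
gives a path over `q` that starts at `e` (`Transport.pathLift`). The axiom `MH ∘ H = ΓH` requires
that the rest of a lifted path is the lift of the rest of `q` (`Transport.pathLift_Γ`). As transport
is functorial, this is a fact about `q` alone: the initial segment up to a later point is the one up
to an earlier point followed by an initial segment of what remains. That fact
(`map_mapConc_const_Γ'`) follows by appending the remainder of `q` and cancelling it, with the
sandwich equation. Compatibility with composition of HDRs (`Transport.hdr_comp`) rests on the
distributive law for `Γ*`, through `Transport.pathLift_conc`.

An effective fibration has such a transport. Since every object is cofibrant and the initial object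
is strict, each HDR is by itself a mould square out of the empty one, so there are chosen lifts
against HDRs (`EffFibStr.liftHDR`), natural in the HDR and compatible with composition. The elements
of `Y` equipped with a path ending at their image form an object into which `Y` embeds as an HDR,
with `Γ` shrinking the paths (`pathHDR`). Lifting against it gives transport backwards along paths,
and `τ` turns this into forward transport. Functoriality comes from `concMap_isHom`: by the
distributive law for `Γ`, concatenation is a morphism of HDRs out of a composite of two path HDRs.

Pullbacks are determined only up to isomorphism, and chosen ones do not compose strictly. So
arbitrary pullbacks are admitted (`PullBox`), and `PushforwardFill.evalAt_fill` shows that the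
filler may be computed on any of them. Morphisms of effective fibrations preserve transport, hence
pulled-back HDRs, hence fillers. For transposes, the pulled-back mould square is itself the source
of a cube over the original one, and the perpendicular condition applies. -/

namespace MooreCat

noncomputable section

/-! ### Pointwise concatenation, constant paths, and the dual structure. -/

section PathDataLemmas

variable {E : Type u} [Category.{v} E] [HasFiniteLimits E]

namespace PathData

attribute [local simp] pullback.lift_fst pullback.lift_snd pullback.lift_fst_assoc
  pullback.lift_snd_assoc prod.lift_fst prod.lift_snd prod.lift_fst_assoc prod.lift_snd_assoc

variable {P : PathData E}

/-- The comparison isomorphism in `mapConc` only reads off the two components of a path of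
composable pairs; in this form it need not be handled again. -/
theorem comp_map_μ {X T : E} (k : T ⟶ P.M.obj (pullback (P.t X) (P.s X))) :
    k ≫ P.M.map (P.μ X) =
      P.mapConc (k ≫ P.M.map (pullback.fst _ _)) (k ≫ P.M.map (pullback.snd _ _))
        (by simp only [Category.assoc, ← Functor.map_comp, pullback.condition]) := by
  unfold mapConc
  rw [← Category.assoc]
  congr 1
  rw [Iso.eq_comp_inv]
  ext <;> simp

theorem comp_map_conc {X T A : E} (k : T ⟶ P.M.obj A) (a b : A ⟶ P.M.obj X)
    (h : a ≫ P.t X = b ≫ P.s X) :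
    k ≫ P.M.map (P.conc a b h) = P.mapConc (k ≫ P.M.map a) (k ≫ P.M.map b)
      (by simp only [Category.assoc, ← Functor.map_comp, h]) := by
  rw [map_conc, comp_mapConc]

theorem map_isPullback (P : PathData E) {A B C : E} (f : A ⟶ C) (g : B ⟶ C) :
    IsPullback (P.M.map (pullback.fst f g)) (P.M.map (pullback.snd f g)) (P.M.map f)
      (P.M.map g) :=
  (IsPullback.of_hasPullback f g).map P.M

/-- The map from `MX` to the terminal object factors through `s`, and `Ms ∘ Γ = 1`. -/
theorem len_Γ (hP : P.IsPreMoore) {X T : E} (p : T ⟶ P.M.obj X) :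
    P.len (p ≫ P.Γ X) = P.len p := by
  have : terminal.from (P.M.obj X) = P.s X ≫ terminal.from X := Subsingleton.elim _ _
  rw [len, this, Functor.map_comp, Category.assoc, reassoc_of% hP.Γ_map_s X, len]

theorem len_conc (hP : P.IsPreMoore) {X T : E} (p q : T ⟶ P.M.obj X)
    (h : p ≫ P.t X = q ≫ P.s X) :
    P.len (P.conc p q h) = P.conc (P.len p) (P.len q) (Subsingleton.elim _ _) :=
  hP.conc_map _ _ _ _

theorem const_conc (hP : P.IsPreMoore) {X T : E} (x : T ⟶ X) (l l' : T ⟶ P.M.obj (⊤_ E))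
    (h : l ≫ P.t _ = l' ≫ P.s _) :
    P.const x (P.conc l l' h) = P.conc (P.const x l) (P.const x l')
      (by rw [hP.const_t, hP.const_s]) := by
  unfold const
  rw [← Category.assoc, hP.α_conc x l l' h, hP.conc_map]
  simp only [Category.assoc]

/-- A path of constant paths whose lengths are those of the terminal segments of `l`. -/
theorem comp_map_const (hP : P.IsPreMoore) {X T A : E} (k : T ⟶ P.M.obj A) (x : A ⟶ X)
    (l : A ⟶ P.M.obj (⊤_ E)) (x₀ : T ⟶ X) (l₀ : T ⟶ P.M.obj (⊤_ E))
    (hx : k ≫ P.M.map x = P.const x₀ l₀) (hl : k ≫ P.M.map l = l₀ ≫ P.Γ _) :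
    k ≫ P.M.map (P.const x l) = P.const x₀ l₀ ≫ P.Γ X := by
  have h1 : k ≫ P.M.map (prod.lift x l) = prod.lift x₀ (l₀ ≫ P.Γ _) ≫ P.α X (P.M.obj (⊤_ E)) := by
    -- `M` preserves pullbacks but not products; the product is therefore viewed as a pullback over
    -- the terminal object, so that the two projections still determine a map after `M` is applied.
    apply ((IsPullback.of_isLimit_binaryFan_of_isTerminal (prodIsProd X (P.M.obj (⊤_ E)))
      terminalIsTerminal).map P.M).hom_ext
    · change _ ≫ P.M.map prod.fst = _ ≫ P.M.map prod.fst
      have h2 := hP.α_nat (𝟙 X) (terminal.from (P.M.obj (⊤_ E)))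
      have h3 : (prod.fst : X ⨯ P.M.obj (⊤_ E) ⟶ X) =
          prod.map (𝟙 X) (terminal.from _) ≫ prod.fst := by simp
      rw [Category.assoc, ← Functor.map_comp, prod.lift_fst, hx, Category.assoc]
      conv_rhs => rw [h3, Functor.map_comp, ← Category.assoc (P.α _ _), ← h2]
      rw [Category.assoc, ← Category.assoc (prod.lift _ _), prod.lift_map, Category.comp_id]
      change _ = P.const x₀ (P.len (l₀ ≫ P.Γ _))
      rw [len_Γ hP, len]
      congr 1
      have : terminal.from (⊤_ E) = 𝟙 _ := Subsingleton.elim _ _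
      rw [this, CategoryTheory.Functor.map_id, Category.comp_id]
    · change _ ≫ P.M.map prod.snd = _ ≫ P.M.map prod.snd
      rw [Category.assoc, ← Functor.map_comp, prod.lift_snd, hl, Category.assoc, hP.α_snd,
        prod.lift_snd]
  have h4 : prod.lift x₀ (l₀ ≫ P.Γ (⊤_ E)) =
      prod.lift x₀ l₀ ≫ prod.map (𝟙 X) (P.Γ _) := by simp
  rw [const, Functor.map_comp, reassoc_of% h1, const, Category.assoc, Category.assoc, hP.Γ_nat,
    reassoc_of% hP.α_Γ X (⊤_ E), reassoc_of% h4, Functor.map_comp]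

/-- Associativity of `μ`, applied under `M`: as `M` preserves pullbacks, three pointwise composable
paths of paths amount to one path `k` in the object `B` of composable triples. -/
theorem mapConc_assoc (hP : P.IsPreMoore) {X T : E} (p q w : T ⟶ P.M.obj (P.M.obj X))
    (h₁ : p ≫ P.M.map (P.t X) = q ≫ P.M.map (P.s X))
    (h₂ : q ≫ P.M.map (P.t X) = w ≫ P.M.map (P.s X))
    (h₃ : P.mapConc p q h₁ ≫ P.M.map (P.t X) = w ≫ P.M.map (P.s X))
    (h₄ : p ≫ P.M.map (P.t X) = P.mapConc q w h₂ ≫ P.M.map (P.s X)) :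
    P.mapConc (P.mapConc p q h₁) w h₃ = P.mapConc p (P.mapConc q w h₂) h₄ := by
  let A := pullback (P.t X) (P.s X)
  let a : A ⟶ P.M.obj X := pullback.fst _ _
  let b : A ⟶ P.M.obj X := pullback.snd _ _
  have hab : a ≫ P.t X = b ≫ P.s X := pullback.condition
  let B := pullback (b ≫ P.t X) (P.s X)
  let f : B ⟶ A := pullback.fst _ _
  let c : B ⟶ P.M.obj X := pullback.snd _ _
  have hbc : f ≫ b ≫ P.t X = c ≫ P.s X := pullback.condition
  let k₁ : T ⟶ P.M.obj A := (P.map_isPullback _ _).lift p q h₁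
  have hk₁a : k₁ ≫ P.M.map a = p := (P.map_isPullback _ _).lift_fst _ _ _
  have hk₁b : k₁ ≫ P.M.map b = q := (P.map_isPullback _ _).lift_snd _ _ _
  have h₅ : k₁ ≫ P.M.map (b ≫ P.t X) = w ≫ P.M.map (P.s X) := by
    rw [Functor.map_comp, reassoc_of% hk₁b, h₂]
  let k : T ⟶ P.M.obj B := (P.map_isPullback _ _).lift k₁ w h₅
  have hkf : k ≫ P.M.map f = k₁ := (P.map_isPullback _ _).lift_fst _ _ _
  have hc : k ≫ P.M.map c = w := (P.map_isPullback _ _).lift_snd _ _ _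
  have ha : k ≫ P.M.map (f ≫ a) = p := by rw [Functor.map_comp, reassoc_of% hkf, hk₁a]
  have hb : k ≫ P.M.map (f ≫ b) = q := by rw [Functor.map_comp, reassoc_of% hkf, hk₁b]
  have key := congrArg (fun m => k ≫ P.M.map m)
    (hP.conc_assoc (f ≫ a) (f ≫ b) c (by simp [hab]) (by simpa using hbc))
  simp only [comp_map_conc] at key
  exact (mapConc_congr _ (mapConc_congr _ ha.symm hb.symm) hc.symm).trans
    (key.trans (mapConc_congr _ ha (mapConc_congr _ hb hc)))

theorem mapConc_map_t (hP : P.IsPreMoore) {X T : E} (p q : T ⟶ P.M.obj (P.M.obj X))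
    (h : p ≫ P.M.map (P.t X) = q ≫ P.M.map (P.s X)) :
    P.mapConc p q h ≫ P.M.map (P.t X) = q ≫ P.M.map (P.t X) := by
  have h1 := (P.map_isPullback _ _).lift_fst p q h
  have h2 := (P.map_isPullback _ _).lift_snd p q h
  have h3 := comp_map_μ ((P.map_isPullback _ _).lift p q h)
  rw [mapConc_congr _ h1 h2] at h3
  rw [← h3, Category.assoc, ← Functor.map_comp, hP.μ_t, Functor.map_comp, reassoc_of% h2]

theorem mapConc_map_s (hP : P.IsPreMoore) {X T : E} (p q : T ⟶ P.M.obj (P.M.obj X))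
    (h : p ≫ P.M.map (P.t X) = q ≫ P.M.map (P.s X)) :
    P.mapConc p q h ≫ P.M.map (P.s X) = p ≫ P.M.map (P.s X) := by
  have h1 := (P.map_isPullback _ _).lift_fst p q h
  have h2 := (P.map_isPullback _ _).lift_snd p q h
  have h3 := comp_map_μ ((P.map_isPullback _ _).lift p q h)
  rw [mapConc_congr _ h1 h2] at h3
  rw [← h3, Category.assoc, ← Functor.map_comp, hP.μ_s, Functor.map_comp, reassoc_of% h1]

theorem mapConc_const (hP : P.IsPreMoore) {X T : E} (p q : T ⟶ P.M.obj X)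
    (h : p ≫ P.t X = q ≫ P.s X) (l : T ⟶ P.M.obj (⊤_ E)) :
    P.mapConc (P.const p l) (P.const q l) (by rw [hP.const_map, hP.const_map, h]) =
      P.const (P.conc p q h) l := by
  refine Eq.trans ?_ (hP.const_map (pullback.lift p q h) l (P.μ X))
  rw [comp_map_μ]
  symm
  apply mapConc_congr
  · rw [hP.const_map, pullback.lift_fst]
  · rw [hP.const_map, pullback.lift_snd]

/-- This lemma and the next translate the dual structure back, so that its axioms can be read as
laws for `Γ*` in the original order of concatenation. -/
theorem dual_conc {Γ' : ∀ X : E, P.M.obj X ⟶ P.M.obj (P.M.obj X)} {X T : E}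
    (p q : T ⟶ P.M.obj X) (h : q ≫ P.t X = p ≫ P.s X) :
    (P.dual Γ').conc p q h.symm = P.conc q p h := by
  change pullback.lift p q h.symm ≫ pullback.lift (pullback.snd (P.s X) (P.t X))
    (pullback.fst (P.s X) (P.t X)) pullback.condition.symm ≫ P.μ X = _
  rw [conc, ← Category.assoc]
  congr 1
  ext
  · rw [Category.assoc, pullback.lift_fst, pullback.lift_fst, pullback.lift_snd]
  · rw [Category.assoc, pullback.lift_snd, pullback.lift_snd, pullback.lift_fst]

theorem dual_mapConc {Γ' : ∀ X : E, P.M.obj X ⟶ P.M.obj (P.M.obj X)} {X T : E}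
    (p q : T ⟶ P.M.obj (P.M.obj X)) (h : q ≫ P.M.map (P.t X) = p ≫ P.M.map (P.s X)) :
    (P.dual Γ').mapConc p q h.symm = P.mapConc q p h := by
  let k := (P.map_isPullback (P.s X) (P.t X)).lift p q h.symm
  have h1 : k ≫ P.M.map (pullback.fst _ _) = p := (P.map_isPullback _ _).lift_fst _ _ _
  have h2 : k ≫ P.M.map (pullback.snd _ _) = q := (P.map_isPullback _ _).lift_snd _ _ _
  have h3 := comp_map_μ (P := P.dual Γ') k
  refine (mapConc_congr (P := P.dual Γ') _ h1.symm h2.symm).trans (h3.symm.trans ?_)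
  change k ≫ P.M.map (pullback.lift (pullback.snd (P.s X) (P.t X))
    (pullback.fst (P.s X) (P.t X)) pullback.condition.symm ≫ P.μ X) = _
  rw [Functor.map_comp, ← Category.assoc, comp_map_μ]
  apply mapConc_congr
  · rw [Category.assoc, ← Functor.map_comp, pullback.lift_fst, h2]
  · rw [Category.assoc, ← Functor.map_comp, pullback.lift_snd, h1]

end PathData

end PathDataLemmas

/-! ### Initial and terminal segments of paths in a two-sided Moore structure. -/

section TwoSided

variable {E : Type u} [Category.{v} E] [HasFiniteLimits E]

namespace TwoSidedMooreStructure

variable (𝓜 : TwoSidedMooreStructure E)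

theorem isPreMoore : 𝓜.IsPreMoore := 𝓜.isMoore.toIsPreMoore

theorem Γ'_nat {X Y : E} (f : X ⟶ Y) : 𝓜.M.map f ≫ 𝓜.Γ' Y = 𝓜.Γ' X ≫ 𝓜.M.map (𝓜.M.map f) :=
  𝓜.dual_isMoore.Γ_nat f

theorem Γ'_s (X : E) : 𝓜.Γ' X ≫ 𝓜.s _ = 𝓜.s X ≫ 𝓜.r X := 𝓜.dual_isMoore.Γ_t X

theorem Γ'_t (X : E) : 𝓜.Γ' X ≫ 𝓜.t _ = 𝟙 _ := 𝓜.dual_isMoore.Γ_s X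

theorem Γ'_map_t (X : E) : 𝓜.Γ' X ≫ 𝓜.M.map (𝓜.t X) = 𝟙 _ := 𝓜.dual_isMoore.Γ_map_s X

theorem Γ'_map_s {X T : E} (p : T ⟶ 𝓜.M.obj X) :
    (p ≫ 𝓜.Γ' X) ≫ 𝓜.M.map (𝓜.s X) = 𝓜.const (p ≫ 𝓜.s X) (𝓜.len p) :=
  𝓜.dual_isMoore.Γ_map_t' p

theorem sandwich' {X T : E} (p : T ⟶ 𝓜.M.obj X)
    (h : (p ≫ 𝓜.Γ' X) ≫ 𝓜.M.map (𝓜.t X) = (p ≫ 𝓜.Γ X) ≫ 𝓜.M.map (𝓜.s X)) :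
    𝓜.mapConc (p ≫ 𝓜.Γ' X) (p ≫ 𝓜.Γ X) h = 𝓜.const p (𝓜.len p) := by
  rw [← PathData.comp_mapConc p _ _ ((𝓜.Γ'_map_t X).trans (𝓜.isMoore.Γ_map_s X).symm),
    𝓜.sandwich, PathData.comp_const, PathData.comp_len, Category.comp_id]

/-- The distributive law of the dual structure: an initial segment of a concatenation is an initial
segment of `p`, or else `p` followed by an initial segment of `q`. -/
theorem conc_Γ' {X T : E} (p q : T ⟶ 𝓜.M.obj X) (h : p ≫ 𝓜.t X = q ≫ 𝓜.s X)
    (h₁ : 𝓜.const p (𝓜.len q) ≫ 𝓜.M.map (𝓜.t X) = (q ≫ 𝓜.Γ' X) ≫ 𝓜.M.map (𝓜.s X))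
    (h₂ : (p ≫ 𝓜.Γ' X) ≫ 𝓜.t _ =
      𝓜.mapConc (𝓜.const p (𝓜.len q)) (q ≫ 𝓜.Γ' X) h₁ ≫ 𝓜.s _) :
    𝓜.conc p q h ≫ 𝓜.Γ' X =
      𝓜.conc (p ≫ 𝓜.Γ' X) (𝓜.mapConc (𝓜.const p (𝓜.len q)) (q ≫ 𝓜.Γ' X) h₁) h₂ := by
  have h3 := 𝓜.dual_isMoore.conc_Γ q p h.symm
  have h4 := PathData.dual_mapConc (P := 𝓜.toPathData) (Γ' := 𝓜.Γ') _ _ h₁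
  rw [PathData.dual_conc (P := 𝓜.toPathData) (Γ' := 𝓜.Γ') q p h] at h3
  refine h3.trans ?_
  refine (PathData.conc_congr (P := 𝓜.toPathData.dual 𝓜.Γ') _ h4 rfl).trans ?_
  exact PathData.dual_conc (P := 𝓜.toPathData) (Γ' := 𝓜.Γ') _ _ _

/-- Cancellability of concatenation, as a monomorphism between pullbacks. -/
theorem mono_lift_μ (X : E) :
    Mono (pullback.lift (f := 𝓜.t X) (g := 𝓜.t X) (𝓜.μ X) (pullback.snd (𝓜.t X) (𝓜.s X))
      (𝓜.isMoore.μ_t X)) where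
  right_cancellation {T} a b h := by
    have h1 := congrArg (fun m => m ≫ pullback.fst _ _) h
    have h2 := congrArg (fun m => m ≫ pullback.snd _ _) h
    simp only [Category.assoc, pullback.lift_fst, pullback.lift_snd] at h1 h2
    have ha : a = pullback.lift (a ≫ pullback.fst _ _) (a ≫ pullback.snd _ _)
        (by simp only [Category.assoc, pullback.condition]) := by
      apply pullback.hom_ext
      · rw [pullback.lift_fst]
      · rw [pullback.lift_snd]
    have hb : b = pullback.lift (b ≫ pullback.fst _ _) (b ≫ pullback.snd _ _)
        (by simp only [Category.assoc, pullback.condition]) := by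
      apply pullback.hom_ext
      · rw [pullback.lift_fst]
      · rw [pullback.lift_snd]
    have h3 : 𝓜.conc (a ≫ pullback.fst (𝓜.t X) (𝓜.s X)) (a ≫ pullback.snd _ _)
        (by simp only [Category.assoc, pullback.condition]) =
      𝓜.conc (b ≫ pullback.fst (𝓜.t X) (𝓜.s X)) (a ≫ pullback.snd _ _)
        (by rw [h2]; simp only [Category.assoc, pullback.condition]) := by
      refine Eq.trans ?_ (h1.trans ?_)
      · unfold PathData.conc; rw [← ha]
      · refine Eq.trans ?_ (PathData.conc_congr
          (by simp only [Category.assoc, pullback.condition]) rfl h2.symm)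
        unfold PathData.conc; rw [← hb]
    apply pullback.hom_ext
    · exact 𝓜.conc_right_cancel _ _ _ _ _ h3
    · exact h2

/-- A functor that preserves pullbacks preserves monomorphisms, so the right cancellation of
`mono_lift_μ` persists under `MM`. -/
theorem map_map_cancel {X T : E} (a b : T ⟶ 𝓜.M.obj (𝓜.M.obj (pullback (𝓜.t X) (𝓜.s X))))
    (h₁ : a ≫ 𝓜.M.map (𝓜.M.map (𝓜.μ X)) = b ≫ 𝓜.M.map (𝓜.M.map (𝓜.μ X)))
    (h₂ : a ≫ 𝓜.M.map (𝓜.M.map (pullback.snd _ _)) =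
      b ≫ 𝓜.M.map (𝓜.M.map (pullback.snd _ _))) : a = b := by
  have := 𝓜.mono_lift_μ X
  rw [← cancel_mono (𝓜.M.map (𝓜.M.map (pullback.lift (f := 𝓜.t X) (g := 𝓜.t X) (𝓜.μ X)
    (pullback.snd (𝓜.t X) (𝓜.s X)) (𝓜.isMoore.μ_t X))))]
  apply (((𝓜.map_isPullback (𝓜.t X) (𝓜.t X)).map 𝓜.M)).hom_ext
  · simp only [Category.assoc, ← Functor.map_comp, pullback.lift_fst]
    exact h₁
  · simp only [Category.assoc, ← Functor.map_comp, pullback.lift_snd]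
    exact h₂

/-- For a path `q`, cut at a point and with a second point in the terminal segment: the initial
segment up to the second point is the concatenation of the initial segment up to the first point
and of the segment between the two points. -/
theorem map_mapConc_const_Γ' {X T K : E} (q : T ⟶ 𝓜.M.obj X) (k : T ⟶ 𝓜.M.obj K)
    (a b : K ⟶ 𝓜.M.obj X) (hab : a ≫ 𝓜.t X = b ≫ 𝓜.s X)
    (ha : k ≫ 𝓜.M.map a = q ≫ 𝓜.Γ' X) (hb : k ≫ 𝓜.M.map b = q ≫ 𝓜.Γ X)
    (h : 𝓜.const a (𝓜.len b) ≫ 𝓜.M.map (𝓜.t X) = (b ≫ 𝓜.Γ' X) ≫ 𝓜.M.map (𝓜.s X)) :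
    k ≫ 𝓜.M.map (𝓜.mapConc (𝓜.const a (𝓜.len b)) (b ≫ 𝓜.Γ' X) h) =
      q ≫ 𝓜.Γ' X ≫ 𝓜.Γ _ := by
  have hP := 𝓜.isPreMoore
  have hM := 𝓜.isMoore
  have hb' : (b ≫ 𝓜.Γ' X) ≫ 𝓜.M.map (𝓜.t X) = (b ≫ 𝓜.Γ X) ≫ 𝓜.M.map (𝓜.s X) := by
    simp only [Category.assoc, 𝓜.Γ'_map_t, hP.Γ_map_s]
  have hq : (q ≫ 𝓜.Γ' X) ≫ 𝓜.M.map (𝓜.t X) = (q ≫ 𝓜.Γ X) ≫ 𝓜.M.map (𝓜.s X) := by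
    simp only [Category.assoc, 𝓜.Γ'_map_t, hP.Γ_map_s]
  have h3 : 𝓜.mapConc (𝓜.const a (𝓜.len b)) (b ≫ 𝓜.Γ' X) h ≫ 𝓜.M.map (𝓜.t X) =
      (b ≫ 𝓜.Γ X) ≫ 𝓜.M.map (𝓜.s X) := by
    rw [PathData.mapConc_map_t hP, hb']
  -- Paths of ways to cut a path in two: `v` cuts `q` at each of its points, and `u` cuts the
  -- concatenation of `a` and `b` at each point of `b`.
  let u := (𝓜.map_isPullback (𝓜.t X) (𝓜.s X)).lift _ _ h3
  let v := (𝓜.map_isPullback (𝓜.t X) (𝓜.s X)).lift _ _ hq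
  have hu₁ : u ≫ 𝓜.M.map (pullback.fst _ _) = _ := (𝓜.map_isPullback _ _).lift_fst _ _ _
  have hu₂ : u ≫ 𝓜.M.map (pullback.snd _ _) = _ := (𝓜.map_isPullback _ _).lift_snd _ _ _
  have hv₁ : v ≫ 𝓜.M.map (pullback.fst _ _) = _ := (𝓜.map_isPullback _ _).lift_fst _ _ _
  have hv₂ : v ≫ 𝓜.M.map (pullback.snd _ _) = _ := (𝓜.map_isPullback _ _).lift_snd _ _ _
  have hv₃ : v ≫ 𝓜.M.map (𝓜.μ X) = 𝓜.const q (𝓜.len q) := by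
    rw [PathData.comp_map_μ, ← 𝓜.sandwich' q hq]
    exact PathData.mapConc_congr _ hv₁ hv₂
  have hu₃ : u ≫ 𝓜.M.map (𝓜.μ X) = 𝓜.const (𝓜.conc a b hab) (𝓜.len b) := by
    rw [PathData.comp_map_μ, ← PathData.mapConc_const hP]
    refine (PathData.mapConc_congr _ hu₁ hu₂).trans ?_
    rw [PathData.mapConc_assoc hP _ _ _ h hb' h3 (by
      rw [PathData.mapConc_map_s hP, h])]
    exact PathData.mapConc_congr _ rfl (𝓜.sandwich' b hb')
  -- On both sides every cut path is `q`, and the second pieces are the terminal segments of the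
  -- terminal segments of `q`; cancellation makes the first pieces agree too.
  have key : k ≫ 𝓜.M.map u = v ≫ 𝓜.Γ _ := by
    apply 𝓜.map_map_cancel
    · rw [Category.assoc, ← Functor.map_comp, hu₃, Category.assoc, ← hP.Γ_nat,
        reassoc_of% hv₃]
      apply PathData.comp_map_const hP
      · rw [PathData.comp_map_conc, ← 𝓜.sandwich' q hq]
        exact PathData.mapConc_congr _ ha hb
      · rw [PathData.len, Functor.map_comp, reassoc_of% hb, ← hP.Γ_nat, PathData.len,
          Category.assoc]
    · rw [Category.assoc, ← Functor.map_comp, hu₂, Category.assoc, ← hP.Γ_nat, reassoc_of% hv₂,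
        Functor.map_comp, reassoc_of% hb, hP.Γ_Γ]
  have := congrArg (fun m => m ≫ 𝓜.M.map (𝓜.M.map (pullback.fst (𝓜.t X) (𝓜.s X)))) key
  simp only [Category.assoc] at this
  rw [← Functor.map_comp, hu₁, ← hP.Γ_nat, reassoc_of% hv₁] at this
  exact this

end TwoSidedMooreStructure

end TwoSided

/-! ### Transport along paths, and the lifting of paths. -/

section TransportLemmas

variable {E : Type u} [Category.{v} E] [HasFiniteLimits E]

/-- Transport of the elements of `Y` along the paths of `X`, for a map `g : Y ⟶ X`. -/
structure Transport (P : PathData E) {Y X : E} (g : Y ⟶ X) where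
  T : pullback g (P.s X) ⟶ Y
  T_comp : T ≫ g = pullback.snd _ _ ≫ P.t X
  lift_r : ∀ {S : E} (e : S ⟶ Y) (h : e ≫ g = ((e ≫ g) ≫ P.r X) ≫ P.s X),
    pullback.lift e ((e ≫ g) ≫ P.r X) h ≫ T = e
  lift_conc : ∀ {S : E} (e : S ⟶ Y) (p q : S ⟶ P.M.obj X) (hpq : p ≫ P.t X = q ≫ P.s X)
    (h₁ : e ≫ g = p ≫ P.s X) (h₂ : e ≫ g = P.conc p q hpq ≫ P.s X)
    (h₃ : (pullback.lift e p h₁ ≫ T) ≫ g = q ≫ P.s X),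
    pullback.lift e (P.conc p q hpq) h₂ ≫ T = pullback.lift (pullback.lift e p h₁ ≫ T) q h₃ ≫ T

namespace Transport

section PathData

variable {P : PathData E} {Y X : E} {g : Y ⟶ X} (Θ : Transport P g)

/-- The transport of the element `e` along the path `p`. -/
def along {S : E} (e : S ⟶ Y) (p : S ⟶ P.M.obj X) (h : e ≫ g = p ≫ P.s X) : S ⟶ Y :=
  pullback.lift e p h ≫ Θ.T

theorem along_congr {S : E} {e e' : S ⟶ Y} {p p' : S ⟶ P.M.obj X} (h : e ≫ g = p ≫ P.s X)
    (he : e = e') (hp : p = p') : Θ.along e p h = Θ.along e' p' (by rw [← he, ← hp, h]) := by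
  subst he hp; rfl

theorem along_comp {S : E} (e : S ⟶ Y) (p : S ⟶ P.M.obj X) (h : e ≫ g = p ≫ P.s X) :
    Θ.along e p h ≫ g = p ≫ P.t X := by
  rw [along, Category.assoc, Θ.T_comp, pullback.lift_snd_assoc]

theorem comp_along {S' S : E} (f : S' ⟶ S) (e : S ⟶ Y) (p : S ⟶ P.M.obj X)
    (h : e ≫ g = p ≫ P.s X) :
    f ≫ Θ.along e p h = Θ.along (f ≫ e) (f ≫ p) (by rw [Category.assoc, h, Category.assoc]) := by
  unfold along
  rw [← Category.assoc]
  congr 1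
  apply pullback.hom_ext
  · rw [Category.assoc, pullback.lift_fst, pullback.lift_fst]
  · rw [Category.assoc, pullback.lift_snd, pullback.lift_snd]

theorem along_r (hP : P.IsPreMoore) {S : E} (e : S ⟶ Y) (x : S ⟶ X)
    (h : e ≫ g = (x ≫ P.r X) ≫ P.s X) : Θ.along e (x ≫ P.r X) h = e := by
  have hx : e ≫ g = x := by rw [h, Category.assoc, hP.r_s, Category.comp_id]
  subst hx
  exact Θ.lift_r e h

theorem along_conc (hP : P.IsPreMoore) {S : E} (e : S ⟶ Y) (p q : S ⟶ P.M.obj X)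
    (hpq : p ≫ P.t X = q ≫ P.s X) (h : e ≫ g = p ≫ P.s X) :
    Θ.along e (P.conc p q hpq) (by rw [hP.conc_s, h]) =
      Θ.along (Θ.along e p h) q (by rw [along_comp, hpq]) :=
  Θ.lift_conc e p q hpq h _ _

/-- The pointwise transport of a path of elements along a path of paths. -/
def mapAlong {S : E} (a : S ⟶ P.M.obj Y) (p : S ⟶ P.M.obj (P.M.obj X))
    (h : a ≫ P.M.map g = p ≫ P.M.map (P.s X)) : S ⟶ P.M.obj Y :=
  (P.map_isPullback g (P.s X)).lift a p h ≫ P.M.map Θ.T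

theorem mapAlong_congr {S : E} {a a' : S ⟶ P.M.obj Y} {p p' : S ⟶ P.M.obj (P.M.obj X)}
    (h : a ≫ P.M.map g = p ≫ P.M.map (P.s X)) (ha : a = a') (hp : p = p') :
    Θ.mapAlong a p h = Θ.mapAlong a' p' (by rw [← ha, ← hp, h]) := by
  subst ha hp; rfl

theorem comp_mapAlong {S' S : E} (f : S' ⟶ S) (a : S ⟶ P.M.obj Y)
    (p : S ⟶ P.M.obj (P.M.obj X)) (h : a ≫ P.M.map g = p ≫ P.M.map (P.s X)) :
    f ≫ Θ.mapAlong a p h =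
      Θ.mapAlong (f ≫ a) (f ≫ p) (by rw [Category.assoc, h, Category.assoc]) := by
  unfold mapAlong
  rw [← Category.assoc]
  congr 1
  apply (P.map_isPullback g (P.s X)).hom_ext
  · rw [Category.assoc, IsPullback.lift_fst, IsPullback.lift_fst]
  · rw [Category.assoc, IsPullback.lift_snd, IsPullback.lift_snd]

theorem map_along {S : E} (e : S ⟶ Y) (p : S ⟶ P.M.obj X) (h : e ≫ g = p ≫ P.s X) :
    P.M.map (Θ.along e p h) = Θ.mapAlong (P.M.map e) (P.M.map p)
      (by rw [← Functor.map_comp, h, Functor.map_comp]) := by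
  unfold mapAlong along
  rw [Functor.map_comp]
  congr 1
  apply (P.map_isPullback g (P.s X)).hom_ext
  · rw [← Functor.map_comp, pullback.lift_fst, IsPullback.lift_fst]
  · rw [← Functor.map_comp, pullback.lift_snd, IsPullback.lift_snd]

theorem comp_map_along {S' S : E} (k : S' ⟶ P.M.obj S) (e : S ⟶ Y) (p : S ⟶ P.M.obj X)
    (h : e ≫ g = p ≫ P.s X) :
    k ≫ P.M.map (Θ.along e p h) = Θ.mapAlong (k ≫ P.M.map e) (k ≫ P.M.map p)
      (by simp only [Category.assoc, ← Functor.map_comp, h]) := by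
  rw [map_along, comp_mapAlong]

theorem mapAlong_map {S : E} (a : S ⟶ P.M.obj Y) (p : S ⟶ P.M.obj (P.M.obj X))
    (h : a ≫ P.M.map g = p ≫ P.M.map (P.s X)) :
    Θ.mapAlong a p h ≫ P.M.map g = p ≫ P.M.map (P.t X) := by
  rw [mapAlong, Category.assoc, ← Functor.map_comp, Θ.T_comp, Functor.map_comp,
    ← Category.assoc, IsPullback.lift_snd]

theorem mapAlong_s (hP : P.IsPreMoore) {S : E} (a : S ⟶ P.M.obj Y)
    (p : S ⟶ P.M.obj (P.M.obj X)) (h : a ≫ P.M.map g = p ≫ P.M.map (P.s X)) :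
    Θ.mapAlong a p h ≫ P.s Y = Θ.along (a ≫ P.s Y) (p ≫ P.s _)
      (by simp only [Category.assoc, ← hP.s_nat, reassoc_of% h]) := by
  unfold mapAlong along
  rw [Category.assoc, hP.s_nat, ← Category.assoc]
  congr 1
  apply pullback.hom_ext
  · rw [Category.assoc, ← hP.s_nat, ← Category.assoc, IsPullback.lift_fst, pullback.lift_fst]
  · rw [Category.assoc, ← hP.s_nat, ← Category.assoc, IsPullback.lift_snd, pullback.lift_snd]

theorem mapAlong_t (hP : P.IsPreMoore) {S : E} (a : S ⟶ P.M.obj Y)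
    (p : S ⟶ P.M.obj (P.M.obj X)) (h : a ≫ P.M.map g = p ≫ P.M.map (P.s X)) :
    Θ.mapAlong a p h ≫ P.t Y = Θ.along (a ≫ P.t Y) (p ≫ P.t _)
      (by simp only [Category.assoc, ← hP.t_nat, reassoc_of% h]) := by
  unfold mapAlong along
  rw [Category.assoc, hP.t_nat, ← Category.assoc]
  congr 1
  apply pullback.hom_ext
  · rw [Category.assoc, ← hP.t_nat, ← Category.assoc, IsPullback.lift_fst, pullback.lift_fst]
  · rw [Category.assoc, ← hP.t_nat, ← Category.assoc, IsPullback.lift_snd, pullback.lift_snd]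

theorem const_along (hP : P.IsPreMoore) {S : E} (e : S ⟶ Y) (p : S ⟶ P.M.obj X)
    (h : e ≫ g = p ≫ P.s X) (l : S ⟶ P.M.obj (⊤_ E)) :
    P.const (Θ.along e p h) l = Θ.mapAlong (P.const e l) (P.const p l)
      (by rw [hP.const_map, hP.const_map, h]) := by
  unfold mapAlong along
  rw [← hP.const_map]
  congr 1
  apply (P.map_isPullback g (P.s X)).hom_ext
  · rw [hP.const_map, pullback.lift_fst, IsPullback.lift_fst]
  · rw [hP.const_map, pullback.lift_snd, IsPullback.lift_snd]

theorem conc_mapAlong (hP : P.IsPreMoore) {S : E} (a a' : S ⟶ P.M.obj Y)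
    (p p' : S ⟶ P.M.obj (P.M.obj X)) (h : a ≫ P.M.map g = p ≫ P.M.map (P.s X))
    (h' : a' ≫ P.M.map g = p' ≫ P.M.map (P.s X)) (ha : a ≫ P.t _ = a' ≫ P.s _)
    (hp : p ≫ P.t _ = p' ≫ P.s _) (h₁) (h₂) :
    Θ.mapAlong (P.conc a a' ha) (P.conc p p' hp) h₁ =
      P.conc (Θ.mapAlong a p h) (Θ.mapAlong a' p' h') h₂ := by
  have h₃ : (P.map_isPullback g (P.s X)).lift a p h ≫ P.t _ =
      (P.map_isPullback g (P.s X)).lift a' p' h' ≫ P.s _ := by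
    apply pullback.hom_ext
    · rw [Category.assoc, Category.assoc, ← hP.t_nat, ← hP.s_nat, ← Category.assoc,
        ← Category.assoc, IsPullback.lift_fst, IsPullback.lift_fst, ha]
    · rw [Category.assoc, Category.assoc, ← hP.t_nat, ← hP.s_nat, ← Category.assoc,
        ← Category.assoc, IsPullback.lift_snd, IsPullback.lift_snd, hp]
  refine Eq.trans ?_ (hP.conc_map _ _ h₃ Θ.T)
  unfold mapAlong
  congr 1
  apply (P.map_isPullback g (P.s X)).hom_ext
  · rw [IsPullback.lift_fst, hP.conc_map]
    exact PathData.conc_congr _ (IsPullback.lift_fst _ _ _ _).symm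
      (IsPullback.lift_fst _ _ _ _).symm
  · rw [IsPullback.lift_snd, hP.conc_map]
    exact PathData.conc_congr _ (IsPullback.lift_snd _ _ _ _).symm
      (IsPullback.lift_snd _ _ _ _).symm

/-- `along_conc` applied under `M`, with `B` the object of elements of `Y` equipped with two
consecutive paths. -/
theorem mapAlong_mapAlong (hP : P.IsPreMoore) {S : E} (a : S ⟶ P.M.obj Y)
    (p q : S ⟶ P.M.obj (P.M.obj X)) (h : a ≫ P.M.map g = p ≫ P.M.map (P.s X))
    (hpq : p ≫ P.M.map (P.t X) = q ≫ P.M.map (P.s X)) :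
    Θ.mapAlong (Θ.mapAlong a p h) q (by rw [mapAlong_map, hpq]) =
      Θ.mapAlong a (P.mapConc p q hpq) (by rw [PathData.mapConc_map_s hP, h]) := by
  let A := pullback g (P.s X)
  let e : A ⟶ Y := pullback.fst _ _
  let b : A ⟶ P.M.obj X := pullback.snd _ _
  have heb : e ≫ g = b ≫ P.s X := pullback.condition
  let B := pullback (b ≫ P.t X) (P.s X)
  let f : B ⟶ A := pullback.fst _ _
  let c : B ⟶ P.M.obj X := pullback.snd _ _
  have hbc : f ≫ b ≫ P.t X = c ≫ P.s X := pullback.condition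
  let k₁ : S ⟶ P.M.obj A := (P.map_isPullback _ _).lift a p h
  have hk₁e : k₁ ≫ P.M.map e = a := (P.map_isPullback _ _).lift_fst _ _ _
  have hk₁b : k₁ ≫ P.M.map b = p := (P.map_isPullback _ _).lift_snd _ _ _
  have h₅ : k₁ ≫ P.M.map (b ≫ P.t X) = q ≫ P.M.map (P.s X) := by
    rw [Functor.map_comp, reassoc_of% hk₁b, hpq]
  let k : S ⟶ P.M.obj B := (P.map_isPullback _ _).lift k₁ q h₅
  have hkf : k ≫ P.M.map f = k₁ := (P.map_isPullback _ _).lift_fst _ _ _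
  have hc : k ≫ P.M.map c = q := (P.map_isPullback _ _).lift_snd _ _ _
  have he : k ≫ P.M.map (f ≫ e) = a := by rw [Functor.map_comp, reassoc_of% hkf, hk₁e]
  have hb : k ≫ P.M.map (f ≫ b) = p := by rw [Functor.map_comp, reassoc_of% hkf, hk₁b]
  have key := congrArg (fun m => k ≫ P.M.map m)
    (Θ.along_conc hP (f ≫ e) (f ≫ b) c (by simpa using hbc) (by simp [heb]))
  simp only [comp_map_along] at key
  refine (Θ.mapAlong_congr _ (Θ.mapAlong_congr _ he.symm hb.symm) hc.symm).trans
    (key.symm.trans (Θ.mapAlong_congr _ he ?_))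
  rw [PathData.comp_map_conc]
  exact PathData.mapConc_congr _ hb hc

end PathData

section PathLift

variable {𝓜 : TwoSidedMooreStructure E} {Y X : E} {g : Y ⟶ X} (Θ : Transport 𝓜.toPathData g)

theorem pathLift_aux {S : E} (e : S ⟶ Y) (q : S ⟶ 𝓜.M.obj X) (h : e ≫ g = q ≫ 𝓜.s X) :
    𝓜.const e (𝓜.len q) ≫ 𝓜.M.map g = (q ≫ 𝓜.Γ' X) ≫ 𝓜.M.map (𝓜.s X) := by
  rw [𝓜.isPreMoore.const_map, 𝓜.Γ'_map_s, h]

/-- The path over `q` which starts at `e` and is given by transport along the initial segments of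
`q`. -/
def pathLift {S : E} (e : S ⟶ Y) (q : S ⟶ 𝓜.M.obj X) (h : e ≫ g = q ≫ 𝓜.s X) :
    S ⟶ 𝓜.M.obj Y :=
  Θ.mapAlong (𝓜.const e (𝓜.len q)) (q ≫ 𝓜.Γ' X) (pathLift_aux e q h)

theorem pathLift_congr {S : E} {e e' : S ⟶ Y} {q q' : S ⟶ 𝓜.M.obj X} (h : e ≫ g = q ≫ 𝓜.s X)
    (he : e = e') (hq : q = q') : Θ.pathLift e q h = Θ.pathLift e' q' (by rw [← he, ← hq, h]) := by
  subst he hq; rfl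

theorem comp_pathLift {S' S : E} (f : S' ⟶ S) (e : S ⟶ Y) (q : S ⟶ 𝓜.M.obj X)
    (h : e ≫ g = q ≫ 𝓜.s X) :
    f ≫ Θ.pathLift e q h =
      Θ.pathLift (f ≫ e) (f ≫ q) (by rw [Category.assoc, h, Category.assoc]) := by
  unfold pathLift
  rw [comp_mapAlong]
  apply mapAlong_congr
  · rw [PathData.comp_const, PathData.comp_len]
  · rw [Category.assoc]

theorem pathLift_map {S : E} (e : S ⟶ Y) (q : S ⟶ 𝓜.M.obj X) (h : e ≫ g = q ≫ 𝓜.s X) :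
    Θ.pathLift e q h ≫ 𝓜.M.map g = q := by
  rw [pathLift, mapAlong_map, Category.assoc, 𝓜.Γ'_map_t, Category.comp_id]

/-- The first initial segment of a path is trivial, and transport along a trivial path changes
nothing. -/
theorem pathLift_s {S : E} (e : S ⟶ Y) (q : S ⟶ 𝓜.M.obj X) (h : e ≫ g = q ≫ 𝓜.s X) :
    Θ.pathLift e q h ≫ 𝓜.s Y = e := by
  have h1 : (q ≫ 𝓜.Γ' X) ≫ 𝓜.s _ = (q ≫ 𝓜.s X) ≫ 𝓜.r X := by
    simp only [Category.assoc, 𝓜.Γ'_s]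
  rw [pathLift, Θ.mapAlong_s 𝓜.isPreMoore,
    Θ.along_congr _ (𝓜.isPreMoore.const_s e (𝓜.len q)) h1, Θ.along_r 𝓜.isPreMoore]

theorem pathLift_t {S : E} (e : S ⟶ Y) (q : S ⟶ 𝓜.M.obj X) (h : e ≫ g = q ≫ 𝓜.s X) :
    Θ.pathLift e q h ≫ 𝓜.t Y = Θ.along e q h := by
  have h1 : (q ≫ 𝓜.Γ' X) ≫ 𝓜.t _ = q := by rw [Category.assoc, 𝓜.Γ'_t, Category.comp_id]
  rw [pathLift, Θ.mapAlong_t 𝓜.isPreMoore,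
    Θ.along_congr _ (𝓜.isPreMoore.const_t e (𝓜.len q)) h1]

theorem const_len_map_t {S : E} (p q : S ⟶ 𝓜.M.obj X)
    (hpq : p ≫ 𝓜.t X = q ≫ 𝓜.s X) :
    𝓜.const p (𝓜.len q) ≫ 𝓜.M.map (𝓜.t X) = (q ≫ 𝓜.Γ' X) ≫ 𝓜.M.map (𝓜.s X) := by
  rw [𝓜.isPreMoore.const_map, 𝓜.Γ'_map_s, hpq]

/-- By functoriality, transport along `p` and then along an initial segment of `q` is transport
along `p` followed by that segment. -/
theorem pathLift_along {S : E} (e : S ⟶ Y) (p q : S ⟶ 𝓜.M.obj X)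
    (h : e ≫ g = p ≫ 𝓜.s X) (hpq : p ≫ 𝓜.t X = q ≫ 𝓜.s X) :
    Θ.pathLift (Θ.along e p h) q (by rw [along_comp, hpq]) =
      Θ.mapAlong (𝓜.const e (𝓜.len q))
        (𝓜.mapConc (𝓜.const p (𝓜.len q)) (q ≫ 𝓜.Γ' X) (const_len_map_t p q hpq))
        (by rw [PathData.mapConc_map_s 𝓜.isPreMoore, 𝓜.isPreMoore.const_map,
          𝓜.isPreMoore.const_map, h]) := by
  rw [← Θ.mapAlong_mapAlong 𝓜.isPreMoore _ _ _ (by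
    rw [𝓜.isPreMoore.const_map, 𝓜.isPreMoore.const_map, h])]
  exact Θ.mapAlong_congr _ (Θ.const_along 𝓜.isPreMoore _ _ _ _) rfl

/-- The law for `Γ*` on a concatenation splits the initial segments into those of `p` and those that
contain `p`; `pathLift_along` recognises the latter as giving the lift of `q` from the transported
element. -/
theorem pathLift_conc {S : E} (e : S ⟶ Y) (p q : S ⟶ 𝓜.M.obj X)
    (h : e ≫ g = p ≫ 𝓜.s X) (hpq : p ≫ 𝓜.t X = q ≫ 𝓜.s X) :
    Θ.pathLift e (𝓜.conc p q hpq) (by rw [𝓜.isPreMoore.conc_s, h]) =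
      𝓜.conc (Θ.pathLift e p h) (Θ.pathLift (Θ.along e p h) q (by rw [along_comp, hpq]))
        (by rw [pathLift_t, pathLift_s]) := by
  have hP := 𝓜.isPreMoore
  have h₂ : (p ≫ 𝓜.Γ' X) ≫ 𝓜.t _ =
      𝓜.mapConc (𝓜.const p (𝓜.len q)) (q ≫ 𝓜.Γ' X) (const_len_map_t p q hpq) ≫ 𝓜.s _ := by
    have h1 : (q ≫ 𝓜.Γ' X) ≫ 𝓜.s _ = (q ≫ 𝓜.s X) ≫ 𝓜.r X := by
      simp only [Category.assoc, 𝓜.Γ'_s]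
    rw [hP.mapConc_s, PathData.conc_congr _ (hP.const_s p _) h1, hP.conc_r_right, Category.assoc,
      𝓜.Γ'_t, Category.comp_id]
  have hl : 𝓜.len p ≫ 𝓜.t _ = 𝓜.len q ≫ 𝓜.s _ := Subsingleton.elim _ _
  have h₃ : 𝓜.const e (𝓜.len (𝓜.conc p q hpq)) =
      𝓜.conc (𝓜.const e (𝓜.len p)) (𝓜.const e (𝓜.len q)) (by rw [hP.const_t, hP.const_s]) := by
    rw [PathData.len_conc hP, PathData.const_conc hP]
  refine (Θ.mapAlong_congr _ h₃ (𝓜.conc_Γ' p q hpq _ h₂)).trans ?_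
  have h₄ := Θ.pathLift_along e p q h hpq
  rw [Θ.conc_mapAlong hP _ _ _ _ (pathLift_aux e p h) _ _ _ _ (by
    rw [← h₄, pathLift_s]; exact Θ.pathLift_t e p h)]
  exact PathData.conc_congr _ rfl h₄.symm

/-- The path `k` pairs each point of the lifted path with what then remains of `q`. Functoriality of
transport reduces the claim to a fact about segments of `q`, namely `map_mapConc_const_Γ'`. This is
the source of `MH ∘ H = ΓH` for pulled-back HDRs. -/
theorem pathLift_Γ {S : E} (e : S ⟶ Y) (q : S ⟶ 𝓜.M.obj X) (h : e ≫ g = q ≫ 𝓜.s X)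
    (k : S ⟶ 𝓜.M.obj (pullback g (𝓜.s X)))
    (hk₁ : k ≫ 𝓜.M.map (pullback.fst _ _) = Θ.pathLift e q h)
    (hk₂ : k ≫ 𝓜.M.map (pullback.snd _ _) = q ≫ 𝓜.Γ X) :
    Θ.pathLift e q h ≫ 𝓜.Γ Y =
      k ≫ 𝓜.M.map (Θ.pathLift (pullback.fst _ _) (pullback.snd _ _) pullback.condition) := by
  have hP := 𝓜.isPreMoore
  let A := pullback g (𝓜.s X)
  let a : A ⟶ Y := pullback.fst _ _
  let p : A ⟶ 𝓜.M.obj X := pullback.snd _ _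
  have hap : a ≫ g = p ≫ 𝓜.s X := pullback.condition
  let B := pullback (p ≫ 𝓜.t X) (𝓜.s X)
  let f : B ⟶ A := pullback.fst _ _
  let c : B ⟶ 𝓜.M.obj X := pullback.snd _ _
  have hpc : f ≫ p ≫ 𝓜.t X = c ≫ 𝓜.s X := pullback.condition
  let n₁ := (𝓜.map_isPullback g (𝓜.s X)).lift _ _ (pathLift_aux e q h)
  have hn₁a : n₁ ≫ 𝓜.M.map a = 𝓜.const e (𝓜.len q) := (𝓜.map_isPullback _ _).lift_fst _ _ _
  have hn₁p : n₁ ≫ 𝓜.M.map p = q ≫ 𝓜.Γ' X := (𝓜.map_isPullback _ _).lift_snd _ _ _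
  have hn₁ : n₁ ≫ 𝓜.M.map (p ≫ 𝓜.t X) = (q ≫ 𝓜.Γ X) ≫ 𝓜.M.map (𝓜.s X) := by
    rw [Functor.map_comp, reassoc_of% hn₁p, 𝓜.Γ'_map_t, Category.assoc, hP.Γ_map_s]
  -- At each point of `q`, `n` records the fixed element `e`, the initial segment and the terminal
  -- segment; `k` is recovered by transporting `e` along the initial segment.
  let n : S ⟶ 𝓜.M.obj B := (𝓜.map_isPullback _ _).lift n₁ _ hn₁
  have hnf : n ≫ 𝓜.M.map f = n₁ := (𝓜.map_isPullback _ _).lift_fst _ _ _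
  have hnc : n ≫ 𝓜.M.map c = q ≫ 𝓜.Γ X := (𝓜.map_isPullback _ _).lift_snd _ _ _
  have hna : n ≫ 𝓜.M.map (f ≫ a) = 𝓜.const e (𝓜.len q) := by
    rw [Functor.map_comp, reassoc_of% hnf, hn₁a]
  have hnp : n ≫ 𝓜.M.map (f ≫ p) = q ≫ 𝓜.Γ' X := by
    rw [Functor.map_comp, reassoc_of% hnf, hn₁p]
  have hfa : (f ≫ a) ≫ g = (f ≫ p) ≫ 𝓜.s X := by simp only [Category.assoc, hap]
  have hfp : (f ≫ p) ≫ 𝓜.t X = c ≫ 𝓜.s X := by simpa only [Category.assoc] using hpc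
  have hθ : Θ.along (f ≫ a) (f ≫ p) hfa ≫ g = c ≫ 𝓜.s X := by rw [along_comp, hfp]
  have hkn : k = n ≫ 𝓜.M.map (pullback.lift (Θ.along (f ≫ a) (f ≫ p) hfa) c hθ) := by
    apply (𝓜.map_isPullback g (𝓜.s X)).hom_ext
    · rw [hk₁, Category.assoc, ← Functor.map_comp, pullback.lift_fst, comp_map_along]
      exact Θ.mapAlong_congr _ hna.symm hnp.symm
    · rw [hk₂, Category.assoc, ← Functor.map_comp, pullback.lift_snd, hnc]
  rw [hkn, Category.assoc, ← Functor.map_comp, comp_pathLift,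
    Θ.pathLift_congr _ (pullback.lift_fst _ _ _) (pullback.lift_snd _ _ _),
    Θ.pathLift_along _ _ _ hfa hfp, pathLift, mapAlong, mapAlong, Category.assoc, hP.Γ_nat,
    Functor.map_comp, ← Category.assoc, ← Category.assoc]
  congr 1
  -- What remains compares the arguments of `MM Θ.T`: the elements of `Y` form constant paths of
  -- varying length, and the paths of `X` are handled by `map_mapConc_const_Γ'`.
  apply ((𝓜.map_isPullback g (𝓜.s X)).map 𝓜.M).hom_ext
  · rw [Category.assoc, ← hP.Γ_nat, ← Category.assoc, IsPullback.lift_fst, Category.assoc,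
      ← Functor.map_comp, IsPullback.lift_fst]
    symm
    apply PathData.comp_map_const hP _ _ _ _ _ hna
    rw [PathData.len, Functor.map_comp, reassoc_of% hnc, ← hP.Γ_nat, PathData.len, Category.assoc]
  · rw [Category.assoc, ← hP.Γ_nat, ← Category.assoc, IsPullback.lift_snd, Category.assoc,
      Category.assoc, ← Functor.map_comp, IsPullback.lift_snd]
    exact (𝓜.map_mapConc_const_Γ' q n (f ≫ p) c hfp hnp hnc _).symm

end PathLift

end Transport

end TransportLemmas

/-! ### Morphisms and pullbacks of transport, and pullback of HDRs along maps with transport. -/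

section PullbackOfHDRs

variable {E : Type u} [Category.{v} E] [HasFiniteLimits E]

namespace Transport

variable {𝓜 : TwoSidedMooreStructure E}

/-- A square is a morphism of transport structures if it preserves transport. -/
structure IsHom {Y' X' Y X : E} {g' : Y' ⟶ X'} {g : Y ⟶ X} (Θ' : Transport 𝓜.toPathData g')
    (Θ : Transport 𝓜.toPathData g) (y : Y' ⟶ Y) (x : X' ⟶ X) : Prop where
  comm : y ≫ g = g' ≫ x
  along_comp : ∀ {S : E} (e : S ⟶ Y') (p : S ⟶ 𝓜.M.obj X') (h : e ≫ g' = p ≫ 𝓜.s X')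
    (h' : (e ≫ y) ≫ g = (p ≫ 𝓜.M.map x) ≫ 𝓜.s X),
    Θ'.along e p h ≫ y = Θ.along (e ≫ y) (p ≫ 𝓜.M.map x) h'

namespace IsHom

variable {Y' X' Y X : E} {g' : Y' ⟶ X'} {g : Y ⟶ X} {Θ' : Transport 𝓜.toPathData g'}
  {Θ : Transport 𝓜.toPathData g} {y : Y' ⟶ Y} {x : X' ⟶ X}

theorem along_aux (h : Θ'.IsHom Θ y x) {S : E} {e : S ⟶ Y'} {p : S ⟶ 𝓜.M.obj X'}
    (he : e ≫ g' = p ≫ 𝓜.s X') : (e ≫ y) ≫ g = (p ≫ 𝓜.M.map x) ≫ 𝓜.s X := by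
  rw [Category.assoc, h.comm, reassoc_of% he, Category.assoc, 𝓜.isPreMoore.s_nat]

/-- Lifted paths are built from transport, constant paths and `Γ*`; the first is preserved by
assumption and the other two are natural. -/
theorem pathLift_comp (h : Θ'.IsHom Θ y x) {S : E} (e : S ⟶ Y') (p : S ⟶ 𝓜.M.obj X')
    (he : e ≫ g' = p ≫ 𝓜.s X') :
    Θ'.pathLift e p he ≫ 𝓜.M.map y =
      Θ.pathLift (e ≫ y) (p ≫ 𝓜.M.map x) (h.along_aux he) := by
  have hT : Θ'.T ≫ y = Θ.along (pullback.fst _ _ ≫ y) (pullback.snd _ _ ≫ 𝓜.M.map x)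
      (h.along_aux pullback.condition) := by
    rw [← h.along_comp _ _ pullback.condition, along]
    congr 1
    refine (Category.id_comp _).symm.trans ?_
    congr 1
    apply pullback.hom_ext
    · rw [pullback.lift_fst, Category.id_comp]
    · rw [pullback.lift_snd, Category.id_comp]
  unfold pathLift
  conv_lhs => rw [mapAlong, Category.assoc, ← Functor.map_comp, hT, comp_map_along]
  apply mapAlong_congr
  · rw [Functor.map_comp, ← Category.assoc, IsPullback.lift_fst, 𝓜.isPreMoore.const_map,
      PathData.len_map]
  · rw [Functor.map_comp, ← Category.assoc, IsPullback.lift_snd, Category.assoc, Category.assoc,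
      𝓜.Γ'_nat]

theorem comp {Y'' X'' : E} {g'' : Y'' ⟶ X''} {Θ'' : Transport 𝓜.toPathData g''}
    {y' : Y'' ⟶ Y'} {x' : X'' ⟶ X'} (h' : Θ''.IsHom Θ' y' x') (h : Θ'.IsHom Θ y x) :
    Θ''.IsHom Θ (y' ≫ y) (x' ≫ x) where
  comm := by rw [Category.assoc, h.comm, reassoc_of% h'.comm]
  along_comp e p he hc := by
    rw [← Category.assoc, h'.along_comp e p he (h'.along_aux he),
      h.along_comp _ _ _ (h.along_aux (h'.along_aux he))]
    exact Θ.along_congr _ (Category.assoc _ _ _) (by rw [Category.assoc, Functor.map_comp])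

/-- A morphism of transport structures into a pullback. -/
theorem of_comp {Y'' X'' : E} {g'' : Y'' ⟶ X''} {Θ'' : Transport 𝓜.toPathData g''}
    {y' : Y'' ⟶ Y'} {x' : X'' ⟶ X'} (h : Θ'.IsHom Θ y x) (sq : IsPullback y g' g x)
    (hc : y' ≫ g' = g'' ≫ x') (h'' : Θ''.IsHom Θ (y' ≫ y) (x' ≫ x)) : Θ''.IsHom Θ' y' x' where
  comm := hc
  along_comp e p he hc' := by
    apply sq.hom_ext
    · rw [Category.assoc, h''.along_comp e p he (h''.along_aux he),
        h.along_comp _ _ hc' (h.along_aux hc')]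
      exact Θ.along_congr _ (Category.assoc _ _ _).symm
        (by rw [Category.assoc, Functor.map_comp])
    · rw [Category.assoc, hc, Θ'.along_comp, ← Category.assoc, Θ''.along_comp, Category.assoc,
        Category.assoc, 𝓜.isPreMoore.t_nat]

end IsHom

section Pullback

variable {Y' X' Y X : E} {y : Y' ⟶ Y} {g' : Y' ⟶ X'} {g : Y ⟶ X} {x : X' ⟶ X}

theorem pullback_aux (sq : IsPullback y g' g x) {S : E} {e : S ⟶ Y'} {p : S ⟶ 𝓜.M.obj X'}
    (he : e ≫ g' = p ≫ 𝓜.s X') : (e ≫ y) ≫ g = (p ≫ 𝓜.M.map x) ≫ 𝓜.s X := by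
  rw [Category.assoc, sq.w, reassoc_of% he, Category.assoc, 𝓜.isPreMoore.s_nat]

/-- Transport along a pullback. -/
def pullback (sq : IsPullback y g' g x) (Θ : Transport 𝓜.toPathData g) :
    Transport 𝓜.toPathData g' :=
  have aux {S : E} (e : S ⟶ Y') (p : S ⟶ 𝓜.M.obj X') (he : e ≫ g' = p ≫ 𝓜.s X') :
      Θ.along (e ≫ y) (p ≫ 𝓜.M.map x) (pullback_aux sq he) ≫ g = (p ≫ 𝓜.t X') ≫ x := by
    rw [Θ.along_comp, Category.assoc, Category.assoc, 𝓜.isPreMoore.t_nat]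
  let tr {S : E} (e : S ⟶ Y') (p : S ⟶ 𝓜.M.obj X') (he : e ≫ g' = p ≫ 𝓜.s X') : S ⟶ Y' :=
    sq.lift (Θ.along (e ≫ y) (p ≫ 𝓜.M.map x) (pullback_aux sq he)) (p ≫ 𝓜.t X') (aux e p he)
  have lift_tr {S : E} (e : S ⟶ Y') (p : S ⟶ 𝓜.M.obj X') (he : e ≫ g' = p ≫ 𝓜.s X') :
      Limits.pullback.lift e p he ≫ tr (pullback.fst _ _) (pullback.snd _ _) pullback.condition =
        tr e p he := by
    apply sq.hom_ext
    · rw [Category.assoc, sq.lift_fst, sq.lift_fst, comp_along]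
      apply along_congr
      · rw [pullback.lift_fst_assoc]
      · rw [pullback.lift_snd_assoc]
    · rw [Category.assoc, sq.lift_snd, sq.lift_snd, pullback.lift_snd_assoc]
  { T := tr (pullback.fst _ _) (pullback.snd _ _) pullback.condition
    T_comp := sq.lift_snd _ _ _
    lift_r e h := by
      rw [lift_tr]
      have h1 : ((e ≫ g') ≫ 𝓜.r X') ≫ 𝓜.M.map x = ((e ≫ g') ≫ x) ≫ 𝓜.r X := by
        simp only [Category.assoc, ← 𝓜.isPreMoore.r_nat]
      apply sq.hom_ext
      · rw [sq.lift_fst, Θ.along_congr _ rfl h1, Θ.along_r 𝓜.isPreMoore]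
      · rw [sq.lift_snd, Category.assoc, 𝓜.isPreMoore.r_t, Category.comp_id]
    lift_conc e p q hpq h₁ h₂ h₃ := by
      rw [lift_tr, lift_tr]
      have h₅ := lift_tr e p h₁
      apply sq.hom_ext
      · rw [sq.lift_fst, sq.lift_fst, Θ.along_congr _ rfl (𝓜.isPreMoore.conc_map _ _ _ _),
          Θ.along_conc 𝓜.isPreMoore]
        exact Θ.along_congr _ (by rw [h₅, sq.lift_fst]) rfl
      · rw [sq.lift_snd, sq.lift_snd, 𝓜.isPreMoore.conc_t] }

theorem pullback_isHom (sq : IsPullback y g' g x) (Θ : Transport 𝓜.toPathData g) :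
    (Θ.pullback sq).IsHom Θ y x where
  comm := sq.w
  along_comp e p h h' := by
    change (_ ≫ sq.lift _ _ _) ≫ y = _
    rw [Category.assoc, sq.lift_fst, comp_along]
    apply along_congr
    · rw [pullback.lift_fst_assoc]
    · rw [pullback.lift_snd_assoc]

end Pullback

section HDR

variable {A B F G : E} {i : A ⟶ B} {f : F ⟶ A} {g : G ⟶ B} {k : F ⟶ G}

theorem hdr_aux (η : HDR 𝓜.toPathData i) (g : G ⟶ B) : 𝟙 G ≫ g = (g ≫ η.H) ≫ 𝓜.s B := by
  rw [Category.id_comp, Category.assoc, η.H_s, Category.comp_id]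

/-- The pullback of an HDR along a map with transport. -/
def hdr (Θ : Transport 𝓜.toPathData g) (sq : IsPullback k f g i) (η : HDR 𝓜.toPathData i) :
    HDR 𝓜.toPathData k where
  j := sq.lift (Θ.along (𝟙 G) (g ≫ η.H) (hdr_aux η g)) (g ≫ η.j) (by
    rw [Θ.along_comp, Category.assoc, η.H_t, Category.assoc])
  H := Θ.pathLift (𝟙 G) (g ≫ η.H) (hdr_aux η g)
  i_j := by
    apply sq.hom_ext
    · rw [Category.assoc, sq.lift_fst, comp_along]
      -- On the image of `i` the homotopy consists of trivial paths, so transport along it is the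
      -- identity.
      have h1 : k ≫ g ≫ η.H = (k ≫ g) ≫ 𝓜.r B := by
        rw [sq.w_assoc, HDR.i_H (𝓜 := 𝓜.toMooreStructure) η, sq.w, Category.assoc]
      exact (Θ.along_congr _ (Category.comp_id k) h1).trans
        ((Θ.along_r 𝓜.isPreMoore _ _ _).trans (Category.id_comp k).symm)
    · rw [Category.assoc, sq.lift_snd, sq.w_assoc, η.i_j, Category.id_comp, Category.comp_id]
  H_s := Θ.pathLift_s _ _ (hdr_aux η g)
  H_t := by rw [Θ.pathLift_t, sq.lift_fst]
  H_H := by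
    have h1 : Θ.pathLift (𝟙 G) (g ≫ η.H) (hdr_aux η g) =
        Limits.pullback.lift (𝟙 G) (g ≫ η.H) (hdr_aux η g) ≫
          Θ.pathLift (pullback.fst _ _) (pullback.snd _ _) pullback.condition := by
      rw [comp_pathLift]
      exact Θ.pathLift_congr _ (pullback.lift_fst _ _ _).symm (pullback.lift_snd _ _ _).symm
    -- The path supplied for `k` takes each point of the lifted homotopy together with the path that
    -- `η.H` starts at its image; by `η.H_H` the latter are the terminal segments of the original
    -- path.
    rw [Θ.pathLift_Γ _ _ _ (Θ.pathLift (𝟙 G) (g ≫ η.H) (hdr_aux η g) ≫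
      𝓜.M.map (Limits.pullback.lift (𝟙 G) (g ≫ η.H) (hdr_aux η g)))]
    · conv_lhs => arg 2; rw [h1]
      rw [Functor.map_comp, Category.assoc]
    · rw [Category.assoc, ← Functor.map_comp, pullback.lift_fst, CategoryTheory.Functor.map_id,
        Category.comp_id]
    · rw [Category.assoc, ← Functor.map_comp, pullback.lift_snd, Functor.map_comp,
        ← Category.assoc, Θ.pathLift_map, Category.assoc, η.H_H, Category.assoc]

theorem hdr_j_fst (Θ : Transport 𝓜.toPathData g) (sq : IsPullback k f g i)
    (η : HDR 𝓜.toPathData i) :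
    (Θ.hdr sq η).j ≫ k = Θ.along (𝟙 G) (g ≫ η.H) (hdr_aux η g) := sq.lift_fst _ _ _

theorem hdr_j_snd (Θ : Transport 𝓜.toPathData g) (sq : IsPullback k f g i)
    (η : HDR 𝓜.toPathData i) : (Θ.hdr sq η).j ≫ f = g ≫ η.j := sq.lift_snd _ _ _

/-- The projection from a pullback of an HDR is a morphism of HDRs. -/
theorem hdr_isHom_base (Θ : Transport 𝓜.toPathData g) (sq : IsPullback k f g i)
    (η : HDR 𝓜.toPathData i) : HDR.IsHom (Θ.hdr sq η) η f g where
  comm_i := sq.w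
  comm_j := Θ.hdr_j_snd sq η
  comm_H := Θ.pathLift_map _ _ (hdr_aux η g)

variable {A' B' F' G' : E} {i' : A' ⟶ B'} {f' : F' ⟶ A'} {g' : G' ⟶ B'} {k' : F' ⟶ G'}

/-- The new retraction and homotopy are obtained by transport along the old homotopy, and both
transport and the old homotopy are preserved. -/
theorem hdr_isHom {Θ' : Transport 𝓜.toPathData g'} {Θ : Transport 𝓜.toPathData g}
    (sq' : IsPullback k' f' g' i') (sq : IsPullback k f g i)
    {η' : HDR 𝓜.toPathData i'} {η : HDR 𝓜.toPathData i} {u : A' ⟶ A} {w : B' ⟶ B}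
    (hη : HDR.IsHom η' η u w) {x : F' ⟶ F} {y : G' ⟶ G} (hΘ : Θ'.IsHom Θ y w)
    (hx : k' ≫ y = x ≫ k) (hf : x ≫ f = f' ≫ u) :
    HDR.IsHom (Θ'.hdr sq' η') (Θ.hdr sq η) x y where
  comm_i := hx
  comm_j := by
    apply sq.hom_ext
    · rw [Category.assoc, ← hx, ← Category.assoc, hdr_j_fst, Category.assoc, hdr_j_fst,
        hΘ.along_comp _ _ _ (hΘ.along_aux (hdr_aux η' g')), comp_along]
      apply along_congr
      · rw [Category.id_comp, Category.comp_id]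
      · rw [Category.assoc, hη.comm_H, ← Category.assoc, ← hΘ.comm, Category.assoc]
    · rw [Category.assoc, hf, ← Category.assoc, hdr_j_snd, Category.assoc, Category.assoc,
        hdr_j_snd, hη.comm_j, ← Category.assoc, ← hΘ.comm, Category.assoc]
  comm_H := by
    change Θ'.pathLift _ _ (hdr_aux η' g') ≫ _ = y ≫ Θ.pathLift _ _ (hdr_aux η g)
    rw [hΘ.pathLift_comp, comp_pathLift]
    apply pathLift_congr
    · rw [Category.id_comp, Category.comp_id]
    · rw [Category.assoc, hη.comm_H, ← Category.assoc, ← hΘ.comm, Category.assoc]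

/-- The square of `g'` and `g` pasted with the old square of retractions is a pullback; cancelling
the pullback square of `f'` and `f` from it leaves the new square of retractions. The map `n` is a
cofibration as a pullback of `m`. -/
theorem hdr_isMould {D : Dominance E} {Θ' : Transport 𝓜.toPathData g'}
    {Θ : Transport 𝓜.toPathData g} (sq' : IsPullback k' f' g' i') (sq : IsPullback k f g i)
    {η' : HDR 𝓜.toPathData i'} {η : HDR 𝓜.toPathData i} {m : A' ⟶ A} {m' : B' ⟶ B}
    (S : IsMould D η' η m m') {n : F' ⟶ F} {n' : G' ⟶ G} (hΘ : Θ'.IsHom Θ n' m')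
    (hn : k' ≫ n' = n ≫ k) (hf : n ≫ f = f' ≫ m) (hc : IsPullback n' g' g m') :
    IsMould D (Θ'.hdr sq' η') (Θ.hdr sq η) n n' := by
  have h := hdr_isHom sq' sq S.isHom hΘ hn hf
  have h1 : IsPullback n f' f m := by
    have h2 : IsPullback (n ≫ k) f' g (m ≫ i) := by
      rw [← hn, ← S.isHom.comm_i]
      exact sq'.paste_horiz hc
    exact IsPullback.of_right h2 hf sq
  refine ⟨h, ?_, D.pullback_mem h1.flip S.cof⟩
  have h3 : IsPullback n' ((Θ'.hdr sq' η').j ≫ f') ((Θ.hdr sq η).j ≫ f) m := by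
    rw [hdr_j_snd, hdr_j_snd]
    exact hc.paste_vert S.cart
  exact IsPullback.of_bot h3 h.comm_j.symm h1

/-- The homotopy of a composite is a concatenation, so `along_conc` gives the retraction and
`pathLift_conc` the homotopy. The assumption `hΘ` says that the transport on `g` is restricted from
that on `c`. The horizontal condition for pushforwards depends on this equality. -/
theorem hdr_comp {C K : E} {i₁ : B ⟶ C} {k₁ : G ⟶ K} {c : K ⟶ C}
    (Θ : Transport 𝓜.toPathData g) (Θ₁ : Transport 𝓜.toPathData c)
    (sq : IsPullback k f g i) (sq₁ : IsPullback k₁ g c i₁) (hΘ : Θ.IsHom Θ₁ k₁ i₁)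
    (η : HDR 𝓜.toPathData i) (η₁ : HDR 𝓜.toPathData i₁) :
    HDR.comp (𝓜 := 𝓜.toMooreStructure) (Θ.hdr sq η) (Θ₁.hdr sq₁ η₁) =
      Θ₁.hdr (sq.paste_horiz sq₁) (HDR.comp (𝓜 := 𝓜.toMooreStructure) η η₁) := by
  have hP := 𝓜.isPreMoore
  have hK : (c ≫ η₁.H) ≫ 𝓜.t C = (c ≫ η₁.j ≫ η.H ≫ 𝓜.M.map i₁) ≫ 𝓜.s C := by
    simp only [Category.assoc, η₁.H_t, hP.s_nat, reassoc_of% η.H_s]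
  have h1 : c ≫ (HDR.comp (𝓜 := 𝓜.toMooreStructure) η η₁).H =
      𝓜.conc (c ≫ η₁.H) (c ≫ η₁.j ≫ η.H ≫ 𝓜.M.map i₁) hK := by
    dsimp [HDR.comp]
    rw [PathData.comp_conc]
  have h2 : ((Θ₁.hdr sq₁ η₁).j ≫ g ≫ η.H) ≫ 𝓜.M.map i₁ = c ≫ η₁.j ≫ η.H ≫ 𝓜.M.map i₁ := by
    rw [← Category.assoc, hdr_j_snd]
    simp only [Category.assoc]
  apply HDR.ext
  · apply (sq.paste_horiz sq₁).hom_ext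
    · rw [hdr_j_fst]
      dsimp only [HDR.comp]
      rw [Category.assoc, ← Category.assoc _ k k₁, hdr_j_fst,
        hΘ.along_comp _ _ _ (hΘ.along_aux (hdr_aux η g)), comp_along]
      refine Eq.trans ?_ (Θ₁.along_congr (by rw [hP.conc_s, hdr_aux η₁ c]) rfl h1.symm)
      rw [Θ₁.along_conc hP _ _ _ hK (hdr_aux η₁ c)]
      apply along_congr
      · rw [Category.id_comp, hdr_j_fst]
      · rw [← Category.assoc, h2]
    · rw [hdr_j_snd]
      dsimp only [HDR.comp]
      rw [Category.assoc, hdr_j_snd, ← Category.assoc, hdr_j_snd, Category.assoc]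
  · change 𝓜.conc _ _ _ = Θ₁.pathLift _ _ (hdr_aux _ c)
    refine Eq.trans ?_ (Θ₁.pathLift_congr (by rw [hP.conc_s, hdr_aux η₁ c]) rfl h1.symm)
    rw [Θ₁.pathLift_conc _ _ _ (hdr_aux η₁ c) hK]
    apply PathData.conc_congr _ rfl
    change (Θ₁.hdr sq₁ η₁).j ≫ Θ.pathLift _ _ (hdr_aux η g) ≫ _ = _
    rw [hΘ.pathLift_comp, comp_pathLift]
    apply pathLift_congr
    · rw [Category.id_comp, hdr_j_fst]
    · rw [← Category.assoc, h2]

end HDR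

end Transport

end PullbackOfHDRs

section Fillers

variable {E : Type u} [Category.{v} E] [HasFiniteLimits E]

/-! ### Transport from effective fibrations -/

/-- Initial objects of a locally cartesian closed category are strict. -/
theorem LocallyCartesianClosed.isIso_of_isInitial [LocallyCartesianClosed E] {I A : E}
    (hI : IsInitial I) (f : A ⟶ I) : IsIso f := by
  have := LocallyCartesianClosed.isLeftAdjoint f
  have h1 : IsInitial (Over.mk (𝟙 I)) := IsInitial.ofUniqueHom
    (fun Z => Over.homMk (hI.to Z.left) (hI.hom_ext _ _))
    (fun Z m => by ext; exact hI.hom_ext _ _)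
  have h2 : IsInitial ((Over.pullback f).obj (Over.mk (𝟙 I))) := h1.isInitialObj (Over.pullback f) _
  have h3 : IsInitial (Over.mk (𝟙 A)) := h2.ofIso
    (Over.isoMk (asIso (pullback.snd (𝟙 I) f)) (by simp))
  refine ⟨hI.to A, ?_, hI.hom_ext _ _⟩
  -- The identity of `A` is initial in `E / A`, being the pullback of an initial object by a left
  -- adjoint. Sections of the projection `A ⨯ A ⟶ A` are graphs of endomorphisms of `A`, so all
  -- endomorphisms of `A` are equal.
  let a (k : A ⟶ A) : Over.mk (𝟙 A) ⟶ Over.mk (prod.fst : A ⨯ A ⟶ A) :=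
    Over.homMk (prod.lift (𝟙 A) k) (prod.lift_fst _ _)
  have h4 := congrArg (fun m => m.left ≫ prod.snd) (h3.hom_ext (a (f ≫ hI.to A)) (a (𝟙 A)))
  simpa [a, prod.lift_snd] using h4

theorem emptyProblem {E : Type u} [Category.{v} E] [HasInitial E] {Y X A B : E} {p : Y ⟶ X} {i : A ⟶ B} {k : A ⟶ Y} {b : B ⟶ X}
    (h : k ≫ p = i ≫ b) :
    IsProblem p (𝟙 (⊥_ E)) i (initial.to A) (initial.to B) (initial.to Y) k b where
  comm := initialIsInitial.hom_ext _ _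
  upper := initialIsInitial.hom_ext _ _
  left := h

/-! ### Chosen lifts of effective fibrations against HDRs. -/

section Initial

variable [LocallyCartesianClosed E]

/-- Any cone maps to the initial object `I'`, hence has an initial apex by strictness. -/
theorem isPullback_of_isInitial {I I' A B : E} (hI : IsInitial I) (hI' : IsInitial I') (b : I ⟶ B)
    (k : I ⟶ I') (f : B ⟶ A) (a : I' ⟶ A) : IsPullback b k f a := by
  refine ⟨⟨hI.hom_ext _ _⟩, ⟨PullbackCone.IsLimit.mk _ (fun c => ?_) (fun c => ?_)
    (fun c => ?_) (fun c m _ _ => ?_)⟩⟩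
  · exact c.snd ≫ hI'.to I
  all_goals
    have := LocallyCartesianClosed.isIso_of_isInitial hI' c.snd
    have hc : IsInitial c.pt := hI'.ofIso (asIso c.snd).symm
    exact hc.hom_ext _ _

theorem isMould_of_isInitial {D : Dominance E} {P : PathData E} {I I' A B : E} {i' : I ⟶ I'}
    {i : A ⟶ B} (hI : IsInitial I) (hI' : IsInitial I') (η' : HDR P i') (η : HDR P i)
    (m : I ⟶ A) (m' : I' ⟶ B) (hm : D.Cof m) : IsMould D η' η m m' where
  isHom := ⟨hI.hom_ext _ _, hI'.hom_ext _ _, hI'.hom_ext _ _⟩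
  cart := isPullback_of_isInitial hI' hI _ _ _ _
  cof := hm

/-- The filler of a mould square which starts from an initial object does not depend on that
square. -/
theorem EffFibStr.isHom_comp_fill {𝓜 : MooreStructure E} {D : Dominance E} {Y X : E}
    {p : Y ⟶ X} (φ : EffFibStr 𝓜 D p) {I I' J J' A₁ B₁ A₀ B₀ : E} {i₁' : I ⟶ I'} {i₀' : J ⟶ J'}
    {i₁ : A₁ ⟶ B₁} {i₀ : A₀ ⟶ B₀} {η₁' : HDR 𝓜.toPathData i₁'} {η₀' : HDR 𝓜.toPathData i₀'}
    {η₁ : HDR 𝓜.toPathData i₁} {η₀ : HDR 𝓜.toPathData i₀} {u : A₁ ⟶ A₀} {w : B₁ ⟶ B₀}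
    (hI : IsInitial I) (hI' : IsInitial I') (hJ : IsInitial J) (hJ' : IsInitial J')
    (hη : HDR.IsHom η₁ η₀ u w)
    {m₁ : I ⟶ A₁} {m₁' : I' ⟶ B₁} {m₀ : J ⟶ A₀} {m₀' : J' ⟶ B₀}
    (S₁ : IsMould D η₁' η₁ m₁ m₁') (S₀ : IsMould D η₀' η₀ m₀ m₀')
    {a₁ : I' ⟶ Y} {a₀ : J' ⟶ Y} {k : A₀ ⟶ Y} {b : B₀ ⟶ X}
    (h₁ : IsProblem p i₁' i₁ m₁ m₁' a₁ (u ≫ k) (w ≫ b))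
    (h₀ : IsProblem p i₀' i₀ m₀ m₀' a₀ k b) :
    w ≫ φ.fill S₀ h₀ = φ.fill S₁ h₁ := by
  -- Every morphism of HDRs extends to a cube between squares that start from initial objects:
  -- strictness makes the two remaining faces pullbacks.
  have C : IsMouldCube D η₁' η₁ η₀' η₀ m₁ m₁' m₀ m₀' (hI.to J) (hI'.to J') u w :=
    { source := S₁
      target := S₀
      isHom' := ⟨hI.hom_ext _ _, hI'.hom_ext _ _, hI'.hom_ext _ _⟩
      isHom := hη
      cart := (isPullback_of_isInitial hI hJ _ _ _ _).flip
      cart' := (isPullback_of_isInitial hI' hJ' _ _ _ _).flip }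
  exact (φ.perpendicular C h₀).trans (φ.fill_congr _ _ (hI'.hom_ext _ _) rfl rfl)

variable [HasFiniteColimits E]

/-- The HDR structure on the identity of the initial object. -/
def emptyHDR (P : PathData E) : HDR P (𝟙 (⊥_ E)) where
  j := 𝟙 _
  H := P.r _
  i_j := initialIsInitial.hom_ext _ _
  H_s := initialIsInitial.hom_ext _ _
  H_t := initialIsInitial.hom_ext _ _
  H_H := initialIsInitial.hom_ext _ _

variable {𝓜 : MooreStructure E} {D : Dominance E}

/-- Cofibrancy of all objects enters here: it allows an HDR to be treated as a mould square with
nothing prescribed on its upper side. -/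
theorem emptyMould (hD : D.IsAdmissible 𝓜.toPathData) {A B : E} {i : A ⟶ B}
    (η : HDR 𝓜.toPathData i) :
    IsMould D (emptyHDR 𝓜.toPathData) η (initial.to A) (initial.to B) :=
  isMould_of_isInitial initialIsInitial initialIsInitial _ _ _ _ (hD.initial_mem A)

namespace EffFibStr

variable (hD : D.IsAdmissible 𝓜.toPathData) {Y X : E} {p : Y ⟶ X} (φ : EffFibStr 𝓜 D p)

/-- The chosen filler of a square from an HDR. -/
def liftHDR {A B : E} {i : A ⟶ B} (η : HDR 𝓜.toPathData i) (k : A ⟶ Y) (b : B ⟶ X)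
    (h : k ≫ p = i ≫ b) : B ⟶ Y :=
  φ.fill (emptyMould hD η) (emptyProblem h)

theorem liftHDR_congr {A B : E} {i : A ⟶ B} (η : HDR 𝓜.toPathData i) {k k' : A ⟶ Y}
    {b b' : B ⟶ X} (h : k ≫ p = i ≫ b) (hk : k = k') (hb : b = b') :
    φ.liftHDR hD η k b h = φ.liftHDR hD η k' b' (by rw [← hk, ← hb, h]) := by
  subst hk hb; rfl

theorem comp_liftHDR {A B : E} {i : A ⟶ B} (η : HDR 𝓜.toPathData i) (k : A ⟶ Y) (b : B ⟶ X)
    (h : k ≫ p = i ≫ b) : i ≫ φ.liftHDR hD η k b h = k := φ.left_fill _ _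

theorem liftHDR_comp {A B : E} {i : A ⟶ B} (η : HDR 𝓜.toPathData i) (k : A ⟶ Y) (b : B ⟶ X)
    (h : k ≫ p = i ≫ b) : φ.liftHDR hD η k b h ≫ p = b := φ.fill_comp _ _

/-- The perpendicular condition, for squares that start from the initial object. -/
theorem isHom_comp_liftHDR {A₁ B₁ A₀ B₀ : E} {i₁ : A₁ ⟶ B₁} {i₀ : A₀ ⟶ B₀}
    {η₁ : HDR 𝓜.toPathData i₁} {η₀ : HDR 𝓜.toPathData i₀} {u : A₁ ⟶ A₀} {w : B₁ ⟶ B₀}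
    (hη : HDR.IsHom η₁ η₀ u w) (k : A₀ ⟶ Y) (b : B₀ ⟶ X) (h : k ≫ p = i₀ ≫ b) :
    w ≫ φ.liftHDR hD η₀ k b h = φ.liftHDR hD η₁ (u ≫ k) (w ≫ b)
      (by rw [Category.assoc, h, ← Category.assoc, ← hη.comm_i, Category.assoc]) :=
  φ.isHom_comp_fill initialIsInitial initialIsInitial initialIsInitial initialIsInitial hη _ _ _ _

/-- The horizontal condition, once the upper side is adjusted: the composite of two empty squares
starts from `𝟙 ≫ 𝟙` with a composite HDR on it, and `isHom_comp_fill` along identities shows that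
this has no influence on the filler. -/
theorem liftHDR_comp_hdr {A B C : E} {i₀ : A ⟶ B} {i₁ : B ⟶ C} (η₀ : HDR 𝓜.toPathData i₀)
    (η₁ : HDR 𝓜.toPathData i₁) (k : A ⟶ Y) (b : C ⟶ X) (h : k ≫ p = (i₀ ≫ i₁) ≫ b) :
    φ.liftHDR hD (η₀.comp η₁) k b h =
      φ.liftHDR hD η₁ (φ.liftHDR hD η₀ k (i₁ ≫ b) (by rw [h, Category.assoc])) b
        (φ.liftHDR_comp hD _ _ _ _) := by
  have S₀ := emptyMould hD η₀
  have S₁ := emptyMould hD η₁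
  have hp : IsProblem p (𝟙 (⊥_ E) ≫ 𝟙 (⊥_ E)) (i₀ ≫ i₁) (initial.to A) (initial.to C)
      (initial.to Y) k b :=
    ⟨initialIsInitial.hom_ext _ _, initialIsInitial.hom_ext _ _, h⟩
  have hid : HDR.IsHom (η₀.comp η₁) (η₀.comp η₁) (𝟙 A) (𝟙 C) := ⟨by simp, by simp, by simp⟩
  have h1 := φ.isHom_comp_fill initialIsInitial initialIsInitial initialIsInitial
    initialIsInitial hid (emptyMould hD (η₀.comp η₁)) (S₀.hcomp S₁) (k := k) (b := b)
    (emptyProblem (by simpa using h)) hp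
  rw [Category.id_comp] at h1
  refine Eq.trans ?_ (h1.symm.trans ((φ.horizontal S₀ S₁ hp).trans ?_))
  · exact φ.fill_congr _ _ rfl (Category.id_comp _).symm (Category.id_comp _).symm
  · exact φ.fill_congr _ _ rfl (φ.fill_congr _ _ (initialIsInitial.hom_ext _ _) rfl rfl) rfl

theorem IsHom.liftHDR_comp {Y' X' : E} {p' : Y' ⟶ X'} {φ' : EffFibStr 𝓜 D p'}
    {φ : EffFibStr 𝓜 D p} {y : Y' ⟶ Y} {x : X' ⟶ X} (hφ : φ'.IsHom φ y x) {A B : E} {i : A ⟶ B}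
    (η : HDR 𝓜.toPathData i) (k : A ⟶ Y') (b : B ⟶ X') (h : k ≫ p' = i ≫ b) :
    φ'.liftHDR hD η k b h ≫ y = φ.liftHDR hD η (k ≫ y) (b ≫ x)
      (by rw [Category.assoc, hφ.comm, reassoc_of% h]) :=
  (hφ.fill_comp _ _).trans (φ.fill_congr _ _ (initialIsInitial.hom_ext _ _) rfl rfl)

end EffFibStr

end Initial

/-! ### The HDR of paths that end in the image of a map, and concatenation of such paths. -/

section PathHDR

variable {𝓜 : MooreStructure E}

theorem pathHDR_aux (𝓜 : MooreStructure E) {Y X : E} (g : Y ⟶ X) :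
    𝟙 Y ≫ g = (g ≫ 𝓜.r X) ≫ 𝓜.t X := by
  rw [Category.id_comp, Category.assoc, 𝓜.isMoore.r_t, Category.comp_id]

theorem pathHDR_aux' (𝓜 : MooreStructure E) {Y X : E} (g : Y ⟶ X) :
    𝓜.const (pullback.fst g (𝓜.t X)) (𝓜.len (pullback.snd g (𝓜.t X))) ≫ 𝓜.M.map g =
      (pullback.snd g (𝓜.t X) ≫ 𝓜.Γ X) ≫ 𝓜.M.map (𝓜.t X) := by
  rw [𝓜.isMoore.const_map, 𝓜.isMoore.Γ_map_t', pullback.condition]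

/-- The HDR from `Y` to the object of paths in `X` which end at the image of an element of `Y`. -/
def pathHDR (𝓜 : MooreStructure E) {Y X : E} (g : Y ⟶ X) :
    HDR 𝓜.toPathData (pullback.lift (𝟙 Y) (g ≫ 𝓜.r X) (pathHDR_aux 𝓜 g)) :=
  have hM := 𝓜.isMoore
  { j := pullback.fst _ _
    -- The element of `Y` is held fixed while the path shrinks through its terminal segments to the
    -- trivial path; these all have the same end, so the pair stays in the pullback.
    H := (𝓜.map_isPullback g (𝓜.t X)).lift _ _ (pathHDR_aux' 𝓜 g)
    i_j := pullback.lift_fst _ _ _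
    H_s := by
      apply pullback.hom_ext
      · rw [Category.assoc, ← hM.s_nat, ← Category.assoc, IsPullback.lift_fst, hM.const_s,
          Category.id_comp]
      · rw [Category.assoc, ← hM.s_nat, ← Category.assoc, IsPullback.lift_snd, Category.assoc,
          hM.Γ_s, Category.id_comp, Category.comp_id]
    H_t := by
      apply pullback.hom_ext
      · rw [Category.assoc, ← hM.t_nat, ← Category.assoc, IsPullback.lift_fst, hM.const_t,
          Category.assoc, pullback.lift_fst, Category.comp_id]
      · rw [Category.assoc, ← hM.t_nat, ← Category.assoc, IsPullback.lift_snd, Category.assoc,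
          hM.Γ_t, Category.assoc, pullback.lift_snd, ← Category.assoc, ← Category.assoc,
          pullback.condition]
    H_H := by
      apply ((𝓜.map_isPullback g (𝓜.t X)).map 𝓜.M).hom_ext
      · rw [Category.assoc, ← Functor.map_comp, IsPullback.lift_fst, Category.assoc, ← hM.Γ_nat,
          ← Category.assoc, IsPullback.lift_fst]
        apply PathData.comp_map_const hM.toIsPreMoore
        · rw [IsPullback.lift_fst]
        · change _ ≫ 𝓜.M.map (pullback.snd _ _ ≫ 𝓜.M.map _) = (pullback.snd _ _ ≫ 𝓜.M.map _) ≫ _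
          rw [Functor.map_comp, ← Category.assoc, IsPullback.lift_snd, Category.assoc, ← hM.Γ_nat,
            Category.assoc]
      · rw [Category.assoc, ← Functor.map_comp, IsPullback.lift_snd, Category.assoc, ← hM.Γ_nat,
          Functor.map_comp, ← Category.assoc, ← Category.assoc, IsPullback.lift_snd,
          Category.assoc, Category.assoc, hM.Γ_Γ] }

theorem pathHDR_H_fst {Y X : E} (g : Y ⟶ X) :
    (pathHDR 𝓜 g).H ≫ 𝓜.M.map (pullback.fst _ _) =
      𝓜.const (pullback.fst g (𝓜.t X)) (𝓜.len (pullback.snd g (𝓜.t X))) :=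
  IsPullback.lift_fst _ _ _ _

theorem pathHDR_H_snd {Y X : E} (g : Y ⟶ X) :
    (pathHDR 𝓜 g).H ≫ 𝓜.M.map (pullback.snd _ _) = pullback.snd g (𝓜.t X) ≫ 𝓜.Γ X :=
  IsPullback.lift_snd _ _ _ _

theorem pathMap_aux {Y' X' Y X : E} {g' : Y' ⟶ X'} {g : Y ⟶ X} {y : Y' ⟶ Y} {x : X' ⟶ X}
    (h : y ≫ g = g' ≫ x) :
    (pullback.fst g' (𝓜.t X') ≫ y) ≫ g = (pullback.snd g' (𝓜.t X') ≫ 𝓜.M.map x) ≫ 𝓜.t X := by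
  rw [Category.assoc, h, pullback.condition_assoc, Category.assoc, 𝓜.isMoore.t_nat]

/-- Constant paths and `Γ` are natural. The lemma serves for morphisms of fibrations, and in
`back_conc` with the transport map itself in the place of `y`. -/
theorem pathHDR_isHom {Y' X' Y X : E} {g' : Y' ⟶ X'} {g : Y ⟶ X} {y : Y' ⟶ Y} {x : X' ⟶ X}
    (h : y ≫ g = g' ≫ x) :
    HDR.IsHom (pathHDR 𝓜 g') (pathHDR 𝓜 g) y (pullback.lift _ _ (pathMap_aux h)) where
  comm_i := by
    apply pullback.hom_ext
    · simp only [Category.assoc, pullback.lift_fst, pullback.lift_fst_assoc, Category.id_comp,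
        Category.comp_id]
    · simp only [Category.assoc, pullback.lift_snd, pullback.lift_snd_assoc]
      rw [← 𝓜.isMoore.r_nat, reassoc_of% h]
  comm_j := (pullback.lift_fst _ _ _).symm
  comm_H := by
    apply (𝓜.map_isPullback g (𝓜.t X)).hom_ext
    · rw [Category.assoc, ← Functor.map_comp, pullback.lift_fst, Functor.map_comp,
        ← Category.assoc, pathHDR_H_fst, Category.assoc, pathHDR_H_fst, 𝓜.isMoore.const_map,
        PathData.comp_const, PathData.comp_len, pullback.lift_fst, pullback.lift_snd,
        PathData.len_map]
    · rw [Category.assoc, ← Functor.map_comp, pullback.lift_snd, Functor.map_comp,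
        ← Category.assoc, pathHDR_H_snd, Category.assoc, Category.assoc, pathHDR_H_snd,
        pullback.lift_snd_assoc, Category.assoc, 𝓜.isMoore.Γ_nat]

theorem concMap_aux {Y X : E} (g : Y ⟶ X) :
    pullback.snd (pullback.snd g (𝓜.t X) ≫ 𝓜.s X) (𝓜.t X) ≫ 𝓜.t X =
      (pullback.fst (pullback.snd g (𝓜.t X) ≫ 𝓜.s X) (𝓜.t X) ≫ pullback.snd g (𝓜.t X)) ≫
        𝓜.s X := by
  rw [Category.assoc, pullback.condition]

/-- Concatenation of two paths which end at the image of an element of `Y`. -/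
def concMap (𝓜 : MooreStructure E) {Y X : E} (g : Y ⟶ X) :
    pullback (pullback.snd g (𝓜.t X) ≫ 𝓜.s X) (𝓜.t X) ⟶ pullback g (𝓜.t X) :=
  pullback.lift (pullback.fst _ _ ≫ pullback.fst _ _)
    (𝓜.conc (pullback.snd _ _) (pullback.fst _ _ ≫ pullback.snd _ _) (concMap_aux g))
    (by rw [𝓜.isMoore.conc_t, Category.assoc, Category.assoc, pullback.condition])

theorem comp_concMap {Y X : E} (g : Y ⟶ X) :
    pullback.lift _ _ (pathHDR_aux 𝓜 (pullback.snd g (𝓜.t X) ≫ 𝓜.s X)) ≫ concMap 𝓜 g = 𝟙 _ := by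
  apply pullback.hom_ext
  · rw [Category.assoc, concMap, pullback.lift_fst, pullback.lift_fst_assoc]
  · rw [Category.assoc, concMap, pullback.lift_snd, PathData.comp_conc,
      PathData.conc_congr _ (pullback.lift_snd _ _ _) rfl, 𝓜.isMoore.conc_r_left,
      pullback.lift_fst_assoc]

/-- The homotopy of the composite HDR first shrinks the earlier path with the later one attached,
and then the later one. The distributive law says that `Γ` shrinks their concatenation in the same
way. -/
theorem concMap_isHom {Y X : E} (g : Y ⟶ X) :
    HDR.IsHom ((pathHDR 𝓜 g).comp (pathHDR 𝓜 (pullback.snd g (𝓜.t X) ≫ 𝓜.s X))) (pathHDR 𝓜 g)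
      (𝟙 Y) (concMap 𝓜 g) where
  comm_i := by rw [Category.assoc, comp_concMap, Category.comp_id, Category.id_comp]
  comm_j := by
    change (pullback.fst _ _ ≫ pullback.fst _ _) ≫ 𝟙 _ = concMap 𝓜 g ≫ pullback.fst _ _
    rw [concMap, pullback.lift_fst, Category.comp_id]
  comm_H := by
    have hM := 𝓜.isMoore
    let h : pullback g (𝓜.t X) ⟶ X := pullback.snd g (𝓜.t X) ≫ 𝓜.s X
    let e : pullback h (𝓜.t X) ⟶ Y := pullback.fst _ _ ≫ pullback.fst _ _
    let p : pullback h (𝓜.t X) ⟶ 𝓜.M.obj X := pullback.snd _ _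
    let q : pullback h (𝓜.t X) ⟶ 𝓜.M.obj X := pullback.fst _ _ ≫ pullback.snd _ _
    have hpq : p ≫ 𝓜.t X = q ≫ 𝓜.s X := concMap_aux g
    have hc₁ : concMap 𝓜 g ≫ pullback.fst g (𝓜.t X) = e := pullback.lift_fst _ _ _
    have hc₂ : concMap 𝓜 g ≫ pullback.snd g (𝓜.t X) = 𝓜.conc p q hpq := pullback.lift_snd _ _ _
    have h0 := congrArg 𝓜.M.map (comp_concMap (𝓜 := 𝓜) g)
    rw [Functor.map_comp, CategoryTheory.Functor.map_id] at h0
    -- The two halves of the homotopy after concatenation: in `c₁` the path `p` shrinks with `q`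
    -- attached, in `c₂` only `q` is left and shrinks.
    let c₁ : pullback h (𝓜.t X) ⟶ 𝓜.M.obj (pullback g (𝓜.t X)) :=
      (pathHDR 𝓜 h).H ≫ 𝓜.M.map (concMap 𝓜 g)
    let c₂ : pullback h (𝓜.t X) ⟶ 𝓜.M.obj (pullback g (𝓜.t X)) :=
      pullback.fst h (𝓜.t X) ≫ (pathHDR 𝓜 g).H
    have hc₁₁ : c₁ ≫ 𝓜.M.map (pullback.fst _ _) = 𝓜.const e (𝓜.len p) := by
      rw [Category.assoc, ← Functor.map_comp, hc₁, Functor.map_comp, ← Category.assoc,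
        pathHDR_H_fst, hM.const_map]
    have hc₂₁ : c₂ ≫ 𝓜.M.map (pullback.fst _ _) = 𝓜.const e (𝓜.len q) := by
      rw [Category.assoc, pathHDR_H_fst, PathData.comp_const, PathData.comp_len]
    have hc₁₂ : c₁ ≫ 𝓜.M.map (pullback.snd _ _) =
        𝓜.mapConc (p ≫ 𝓜.Γ X) (𝓜.const q (𝓜.len p)) (hM.distrib_aux₁ p q hpq) := by
      rw [Category.assoc, ← Functor.map_comp, hc₂, PathData.comp_map_conc]
      apply PathData.mapConc_congr
      · rw [pathHDR_H_snd]
      · rw [Functor.map_comp, ← Category.assoc, pathHDR_H_fst, hM.const_map]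
    have hc₂₂ : c₂ ≫ 𝓜.M.map (pullback.snd _ _) = q ≫ 𝓜.Γ X := by
      rw [Category.assoc, pathHDR_H_snd, Category.assoc]
    have h2 : (pullback.fst h (𝓜.t X) ≫ (pathHDR 𝓜 g).H ≫
        𝓜.M.map (pullback.lift _ _ (pathHDR_aux 𝓜 h))) ≫ 𝓜.M.map (concMap 𝓜 g) = c₂ := by
      rw [Category.assoc (pullback.fst _ _), Category.assoc (pathHDR 𝓜 g).H, h0, Category.comp_id]
    have h3 : (concMap 𝓜 g ≫ (pathHDR 𝓜 g).H) ≫ 𝓜.M.map (pullback.fst _ _) =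
        𝓜.conc (𝓜.const e (𝓜.len p)) (𝓜.const e (𝓜.len q)) (by rw [hM.const_t, hM.const_s]) := by
      rw [Category.assoc, pathHDR_H_fst, PathData.comp_const, PathData.comp_len, hc₁, hc₂,
        PathData.len_conc hM.toIsPreMoore, PathData.const_conc hM.toIsPreMoore]
    have h4 : (concMap 𝓜 g ≫ (pathHDR 𝓜 g).H) ≫ 𝓜.M.map (pullback.snd _ _) = _ :=
      (by rw [Category.assoc, pathHDR_H_snd, ← Category.assoc, hc₂] :
        _ = 𝓜.conc p q hpq ≫ 𝓜.Γ X).trans (hM.conc_Γ p q hpq)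
    refine (hM.conc_map _ _ _ _).trans ((PathData.conc_congr (p' := c₁) _ rfl h2).trans ?_)
    apply (𝓜.map_isPullback g (𝓜.t X)).hom_ext
    · exact (hM.conc_map _ _ _ _).trans ((PathData.conc_congr _ hc₁₁ hc₂₁).trans h3.symm)
    · exact (hM.conc_map _ _ _ _).trans ((PathData.conc_congr _ hc₁₂ hc₂₂).trans h4.symm)

end PathHDR

end Fillers

/-! ### Backward and forward transport of an effective fibration. -/

section TransportOfEffectiveFibration

variable {E : Type u} [Category.{v} E] [HasFiniteLimits E]

namespace EffFibStr

theorem transport_aux {𝓜 : SymmetricMooreStructure E} {S Y X : E} {g : Y ⟶ X} {e : S ⟶ Y}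
    {p : S ⟶ 𝓜.M.obj X} (h : e ≫ g = p ≫ 𝓜.s X) : e ≫ g = (p ≫ 𝓜.τ X) ≫ 𝓜.t X := by
  rw [Category.assoc, 𝓜.τ_t, h]

variable [LocallyCartesianClosed E] [HasFiniteColimits E]

section Backward

variable {𝓜 : MooreStructure E} {D : Dominance E} (hD : D.IsAdmissible 𝓜.toPathData)
  {Y X : E} {g : Y ⟶ X} (φ : EffFibStr 𝓜 D g)

/-- Transport against the direction of paths. -/
def back {S : E} (e : S ⟶ Y) (p : S ⟶ 𝓜.M.obj X) (h : e ≫ g = p ≫ 𝓜.t X) : S ⟶ Y :=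
  Limits.pullback.lift e p h ≫ φ.liftHDR hD (pathHDR 𝓜 g) (𝟙 Y) (pullback.snd _ _ ≫ 𝓜.s X)
    (by rw [pullback.lift_snd_assoc, Category.assoc, 𝓜.isMoore.r_s, Category.comp_id,
      Category.id_comp])

theorem back_congr {S : E} {e e' : S ⟶ Y} {p p' : S ⟶ 𝓜.M.obj X} (h : e ≫ g = p ≫ 𝓜.t X)
    (he : e = e') (hp : p = p') : φ.back hD e p h = φ.back hD e' p' (by rw [← he, ← hp, h]) := by
  subst he hp; rfl

theorem comp_back {S' S : E} (f : S' ⟶ S) (e : S ⟶ Y) (p : S ⟶ 𝓜.M.obj X)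
    (h : e ≫ g = p ≫ 𝓜.t X) :
    f ≫ φ.back hD e p h =
      φ.back hD (f ≫ e) (f ≫ p) (by rw [Category.assoc, h, Category.assoc]) := by
  unfold back
  rw [← Category.assoc]
  congr 1
  apply pullback.hom_ext
  · rw [Category.assoc, pullback.lift_fst, pullback.lift_fst]
  · rw [Category.assoc, pullback.lift_snd, pullback.lift_snd]

theorem back_comp {S : E} (e : S ⟶ Y) (p : S ⟶ 𝓜.M.obj X) (h : e ≫ g = p ≫ 𝓜.t X) :
    φ.back hD e p h ≫ g = p ≫ 𝓜.s X := by
  rw [back, Category.assoc, liftHDR_comp, pullback.lift_snd_assoc]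

theorem back_r {S : E} (e : S ⟶ Y) (h : e ≫ g = ((e ≫ g) ≫ 𝓜.r X) ≫ 𝓜.t X) :
    φ.back hD e ((e ≫ g) ≫ 𝓜.r X) h = e := by
  have h1 : Limits.pullback.lift e ((e ≫ g) ≫ 𝓜.r X) h =
      e ≫ Limits.pullback.lift _ _ (pathHDR_aux 𝓜 g) := by
    apply pullback.hom_ext
    · rw [pullback.lift_fst, Category.assoc, pullback.lift_fst, Category.comp_id]
    · rw [pullback.lift_snd, Category.assoc, Category.assoc, pullback.lift_snd]
  rw [back, h1, Category.assoc, comp_liftHDR, Category.comp_id]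

/-- Let `T` be the universal backward transport. By `concMap_isHom` and naturality of lifts, `T`
after concatenation is a lift against a composite of two path HDRs. The horizontal condition makes
it the lift of `T` against the second of them, and `pathHDR_isHom` for the square `(T, 𝟙 X)`
identifies this with `T` applied twice. -/
theorem back_conc {S : E} (e : S ⟶ Y) (p q : S ⟶ 𝓜.M.obj X) (hpq : p ≫ 𝓜.t X = q ≫ 𝓜.s X)
    (h : e ≫ g = q ≫ 𝓜.t X) :
    φ.back hD e (𝓜.conc p q hpq) (by rw [𝓜.isMoore.conc_t, h]) =
      φ.back hD (φ.back hD e q h) p (by rw [back_comp, hpq]) := by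
  have hM := 𝓜.isMoore
  let c : Limits.pullback g (𝓜.t X) ⟶ X := pullback.snd g (𝓜.t X) ≫ 𝓜.s X
  let W := Limits.pullback c (𝓜.t X)
  have h₀ : 𝟙 Y ≫ g =
      Limits.pullback.lift _ _ (pathHDR_aux 𝓜 g) ≫ pullback.snd _ _ ≫ 𝓜.s X := by
    rw [pullback.lift_snd_assoc, Category.assoc, 𝓜.isMoore.r_s, Category.comp_id,
      Category.id_comp]
  let T := φ.liftHDR hD (pathHDR 𝓜 g) (𝟙 Y) (pullback.snd _ _ ≫ 𝓜.s X) h₀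
  have hT : T ≫ g = c ≫ 𝟙 X := by
    rw [Category.comp_id]; exact φ.liftHDR_comp hD _ _ _ _
  have h1 := φ.isHom_comp_liftHDR hD (concMap_isHom (𝓜 := 𝓜) g) _ _ h₀
  have h2 := φ.isHom_comp_liftHDR hD (pathHDR_isHom (𝓜 := 𝓜) hT) _ _ h₀
  have key : concMap 𝓜 g ≫ T = Limits.pullback.lift _ _ (pathMap_aux (𝓜 := 𝓜) hT) ≫ T := by
    refine h1.trans ((φ.liftHDR_comp_hdr hD _ _ _ _ _).trans (Eq.trans ?_ h2.symm))
    apply liftHDR_congr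
    · refine Eq.trans ?_ (Category.comp_id T).symm
      apply liftHDR_congr
      · rw [Category.id_comp]
      · rw [← Category.assoc, comp_concMap, Category.id_comp]
    · rw [concMap, pullback.lift_snd_assoc, hM.conc_s, pullback.lift_snd_assoc,
        CategoryTheory.Functor.map_id, Category.comp_id]
  have hw : Limits.pullback.lift e q h ≫ c = p ≫ 𝓜.t X := by
    rw [pullback.lift_snd_assoc, hpq]
  let w : S ⟶ W := Limits.pullback.lift _ _ hw
  have hw₁ : w ≫ pullback.fst _ _ = Limits.pullback.lift e q h := pullback.lift_fst _ _ _
  have hw₂ : w ≫ pullback.snd _ _ = p := pullback.lift_snd _ _ _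
  have key' := congrArg (fun m => w ≫ m) key
  simp only [← Category.assoc] at key'
  refine Eq.trans ?_ (key'.trans ?_)
  · unfold back
    congr 1
    apply pullback.hom_ext
    · rw [pullback.lift_fst, Category.assoc, concMap, pullback.lift_fst, ← Category.assoc, hw₁,
        pullback.lift_fst]
    · rw [pullback.lift_snd, Category.assoc, concMap, pullback.lift_snd, PathData.comp_conc]
      exact PathData.conc_congr _ hw₂.symm (by rw [← Category.assoc, hw₁, pullback.lift_snd])
  · conv_rhs => unfold back
    congr 1
    apply pullback.hom_ext
    · rw [pullback.lift_fst, Category.assoc, pullback.lift_fst, ← Category.assoc, hw₁]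
    · rw [pullback.lift_snd, Category.assoc, pullback.lift_snd, ← Category.assoc, hw₂,
        CategoryTheory.Functor.map_id, Category.comp_id]

theorem IsHom.back_comp {Y' X' : E} {g' : Y' ⟶ X'} {φ' : EffFibStr 𝓜 D g'}
    {y : Y' ⟶ Y} {x : X' ⟶ X} {φ : EffFibStr 𝓜 D g} (hφ : φ'.IsHom φ y x) {S : E} (e : S ⟶ Y')
    (p : S ⟶ 𝓜.M.obj X') (h : e ≫ g' = p ≫ 𝓜.t X')
    (h' : (e ≫ y) ≫ g = (p ≫ 𝓜.M.map x) ≫ 𝓜.t X) :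
    φ'.back hD e p h ≫ y = φ.back hD (e ≫ y) (p ≫ 𝓜.M.map x) h' := by
  have h1 : Limits.pullback.lift (e ≫ y) (p ≫ 𝓜.M.map x) h' =
      Limits.pullback.lift e p h ≫ Limits.pullback.lift _ _ (pathMap_aux (𝓜 := 𝓜) hφ.comm) := by
    apply pullback.hom_ext
    · rw [pullback.lift_fst, Category.assoc, pullback.lift_fst, pullback.lift_fst_assoc]
    · rw [pullback.lift_snd, Category.assoc, pullback.lift_snd, pullback.lift_snd_assoc]
  unfold back
  rw [h1, Category.assoc, Category.assoc, hφ.liftHDR_comp hD,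
    φ.isHom_comp_liftHDR hD (pathHDR_isHom hφ.comm)]
  congr 1
  apply liftHDR_congr
  · rw [Category.id_comp, Category.comp_id]
  · rw [pullback.lift_snd_assoc, Category.assoc, Category.assoc, 𝓜.isMoore.s_nat]

end Backward

section Forward

variable {𝓜 : SymmetricMooreStructure E} {D : Dominance E} (hD : D.IsAdmissible 𝓜.toPathData)
  {Y X : E} {g : Y ⟶ X} (φ : EffFibStr 𝓜.toMooreStructure D g)

theorem lift_comp_back {S : E} (e : S ⟶ Y) (p : S ⟶ 𝓜.M.obj X) (h : e ≫ g = p ≫ 𝓜.s X) :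
    Limits.pullback.lift e p h ≫ φ.back hD (pullback.fst _ _) (pullback.snd _ _ ≫ 𝓜.τ X)
      (transport_aux pullback.condition) = φ.back hD e (p ≫ 𝓜.τ X) (transport_aux h) := by
  rw [comp_back]
  apply back_congr
  · rw [pullback.lift_fst]
  · rw [pullback.lift_snd_assoc]

/-- The transport of an effective fibration. -/
def transport : Transport 𝓜.toPathData g where
  T := φ.back hD (pullback.fst _ _) (pullback.snd _ _ ≫ 𝓜.τ X) (transport_aux pullback.condition)
  T_comp := by rw [back_comp, Category.assoc, 𝓜.τ_s]
  lift_r e h := by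
    rw [lift_comp_back]
    have h1 : ((e ≫ g) ≫ 𝓜.r X) ≫ 𝓜.τ X = (e ≫ g) ≫ 𝓜.r X := by rw [Category.assoc, 𝓜.r_τ]
    rw [φ.back_congr hD _ rfl h1, φ.back_r]
  lift_conc e p q hpq h₁ h₂ h₃ := by
    rw [lift_comp_back, lift_comp_back]
    -- Both `τ` and backward transport reverse the order of concatenation, so `p` is again used
    -- before `q`.
    rw [φ.back_congr hD _ rfl (𝓜.conc_τ p q hpq), φ.back_conc hD _ _ _ _ (transport_aux h₁)]
    exact φ.back_congr hD _ (φ.lift_comp_back hD _ _ _).symm rfl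

theorem transport_along {S : E} (e : S ⟶ Y) (p : S ⟶ 𝓜.M.obj X) (h : e ≫ g = p ≫ 𝓜.s X) :
    (φ.transport hD).along e p h = φ.back hD e (p ≫ 𝓜.τ X) (transport_aux h) :=
  φ.lift_comp_back hD e p h

theorem IsHom.transport {Y' X' : E} {g' : Y' ⟶ X'} {φ' : EffFibStr 𝓜.toMooreStructure D g'}
    {y : Y' ⟶ Y} {x : X' ⟶ X} {φ : EffFibStr 𝓜.toMooreStructure D g} (hφ : φ'.IsHom φ y x) :
    (φ'.transport hD).IsHom (φ.transport hD) y x where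
  comm := hφ.comm
  along_comp e p h h' := by
    have h1 : (p ≫ 𝓜.τ X') ≫ 𝓜.M.map x = (p ≫ 𝓜.M.map x) ≫ 𝓜.τ X := by
      rw [Category.assoc, Category.assoc, 𝓜.τ_nat]
    rw [transport_along, transport_along, hφ.back_comp hD _ _ _ (by
      rw [h1]; exact transport_aux h')]
    exact φ.back_congr hD _ rfl h1

end Forward

end EffFibStr

end TransportOfEffectiveFibration

/-! ### Pulling back HDRs along a map with transport -/

section

variable {E : Type u} [Category.{v} E] [HasFiniteLimits E]

theorem HDR.eq_of_isHom_id {P : PathData E} {A B : E} {i : A ⟶ B} {η η' : HDR P i}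
    (h : HDR.IsHom η η' (𝟙 A) (𝟙 B)) : η = η' := by
  apply HDR.ext
  · simpa using h.comm_j
  · simpa using h.comm_H

/-- The HDRs occur in the type of the mould square; this form covers HDRs that are equal without
being definitionally so, such as the pullback of a composite and the composite of pullbacks. -/
theorem EffFibStr.fill_congr_hdr {𝓜 : MooreStructure E} {D : Dominance E} {Y X : E} {p : Y ⟶ X}
    (φ : EffFibStr 𝓜 D p) {A' B' A B : E} {i' : A' ⟶ B'} {i : A ⟶ B}
    {η₁' η₂' : HDR 𝓜.toPathData i'} {η₁ η₂ : HDR 𝓜.toPathData i} {m : A' ⟶ A} {m' : B' ⟶ B}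
    (S₁ : IsMould D η₁' η₁ m m') (S₂ : IsMould D η₂' η₂ m m') (h' : η₁' = η₂') (h : η₁ = η₂)
    {a a' : B' ⟶ Y} {k k' : A ⟶ Y} {b b' : B ⟶ X} (hp : IsProblem p i' i m m' a k b)
    (hp' : IsProblem p i' i m m' a' k' b') (ha : a = a') (hk : k = k') (hb : b = b') :
    φ.fill S₁ hp = φ.fill S₂ hp' := by
  subst h' h ha hk hb; rfl

end

/-! ### Pullbacks of HDRs, mould squares and cubes over the base of a map with transport. -/

section PullBox

variable {E : Type u} [Category.{v} E]

/-- The pullback of a map `i : A ⟶ B` over `X` along `g : Y ⟶ X`. -/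
structure PullBox {Y X A B : E} (g : Y ⟶ X) (i : A ⟶ B) (b : B ⟶ X) where
  {F G : E}
  k : F ⟶ G
  a : F ⟶ A
  c : G ⟶ B
  y : G ⟶ Y
  sqA : IsPullback k a c i
  sqB : IsPullback y c g b

namespace PullBox

variable {Y X : E} {g : Y ⟶ X}

/-- Maps between pullbacks which are induced by a commutative square over `X`. -/
structure Hom {A' B' A B : E} {i' : A' ⟶ B'} {i : A ⟶ B} {b' : B' ⟶ X} {b : B ⟶ X}
    (V' : PullBox g i' b') (V : PullBox g i b) (u : A' ⟶ A) (w : B' ⟶ B) (x : V'.F ⟶ V.F)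
    (z : V'.G ⟶ V.G) : Prop where
  base : w ≫ b = b'
  k : V'.k ≫ z = x ≫ V.k
  a : x ≫ V.a = V'.a ≫ u
  c : z ≫ V.c = V'.c ≫ w
  y : z ≫ V.y = V'.y

theorem exists_hom_of {A' B' A B : E} {i' : A' ⟶ B'} {i : A ⟶ B} {b' : B' ⟶ X} {b : B ⟶ X}
    (V' : PullBox g i' b') (V : PullBox g i b) {u : A' ⟶ A} {w : B' ⟶ B} (hi : i' ≫ w = u ≫ i)
    (hb : w ≫ b = b') {z : V'.G ⟶ V.G} (hc : z ≫ V.c = V'.c ≫ w) (hy : z ≫ V.y = V'.y) :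
    ∃ x, Hom V' V u w x z := by
  have h : (V'.k ≫ z) ≫ V.c = (V'.a ≫ u) ≫ i := by
    rw [Category.assoc, hc, V'.sqA.w_assoc, hi, Category.assoc]
  exact ⟨V.sqA.lift _ _ h, hb, (V.sqA.lift_fst _ _ _).symm, V.sqA.lift_snd _ _ _, hc, hy⟩

theorem exists_hom {A' B' A B : E} {i' : A' ⟶ B'} {i : A ⟶ B} {b' : B' ⟶ X} {b : B ⟶ X}
    (V' : PullBox g i' b') (V : PullBox g i b) {u : A' ⟶ A} {w : B' ⟶ B} (hi : i' ≫ w = u ≫ i)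
    (hb : w ≫ b = b') : ∃ x z, Hom V' V u w x z := by
  have h : V'.y ≫ g = (V'.c ≫ w) ≫ b := by rw [V'.sqB.w, Category.assoc, hb]
  obtain ⟨x, H⟩ := exists_hom_of V' V hi hb (V.sqB.lift_snd _ _ h) (V.sqB.lift_fst _ _ h)
  exact ⟨x, _, H⟩

namespace Hom

variable {A' B' A B : E} {i' : A' ⟶ B'} {i : A ⟶ B} {b' : B' ⟶ X} {b : B ⟶ X}
  {V' : PullBox g i' b'} {V : PullBox g i b} {u : A' ⟶ A} {w : B' ⟶ B} {x : V'.F ⟶ V.F}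
  {z : V'.G ⟶ V.G}

theorem comp {A'' B'' : E} {i'' : A'' ⟶ B''} {b'' : B'' ⟶ X} {V'' : PullBox g i'' b''}
    {u' : A'' ⟶ A'} {w' : B'' ⟶ B'} {x' : V''.F ⟶ V'.F} {z' : V''.G ⟶ V'.G}
    (H' : Hom V'' V' u' w' x' z') (H : Hom V' V u w x z) :
    Hom V'' V (u' ≫ u) (w' ≫ w) (x' ≫ x) (z' ≫ z) where
  base := by rw [Category.assoc, H.base, H'.base]
  k := by rw [← Category.assoc, H'.k, Category.assoc, H.k, Category.assoc]
  a := by rw [Category.assoc, H.a, ← Category.assoc, H'.a, Category.assoc]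
  c := by rw [Category.assoc, H.c, ← Category.assoc, H'.c, Category.assoc]
  y := by rw [Category.assoc, H.y, H'.y]

theorem eq_of_eq {x₁ : V'.F ⟶ V.F} {z₁ : V'.G ⟶ V.G} {u₁ : A' ⟶ A} {w₁ : B' ⟶ B}
    (H : Hom V' V u w x z) (H₁ : Hom V' V u₁ w₁ x₁ z₁) (hu : u = u₁) (hw : w = w₁) :
    x = x₁ ∧ z = z₁ := by
  subst hu hw
  have hz : z = z₁ := by
    apply V.sqB.hom_ext
    · rw [H.y, H₁.y]
    · rw [H.c, H₁.c]
  refine ⟨?_, hz⟩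
  apply V.sqA.hom_ext
  · rw [← H.k, ← H₁.k, hz]
  · rw [H.a, H₁.a]

/-- Both boxes are pullbacks of the same `g`, so the square between them is a pullback by
cancellation. -/
theorem cart (H : Hom V' V u w x z) : IsPullback z V'.c V.c w := by
  refine IsPullback.of_right ?_ H.c V.sqB
  rw [H.y, H.base]
  exact V'.sqB

theorem cartA (H : Hom V' V u w x z) (hi : i' ≫ w = u ≫ i) : IsPullback x V'.a V.a u := by
  refine IsPullback.of_right ?_ H.a V.sqA
  rw [← H.k, ← hi]
  exact V'.sqA.paste_horiz H.cart

end Hom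

variable [HasFiniteLimits E]

/-- The chosen pullback. -/
def canon (g : Y ⟶ X) {A B : E} (i : A ⟶ B) (b : B ⟶ X) : PullBox g i b where
  k := pullback.fst (pullback.fst b g) i
  a := pullback.snd (pullback.fst b g) i
  c := pullback.fst b g
  y := pullback.snd b g
  sqA := IsPullback.of_hasPullback _ _
  sqB := (IsPullback.of_hasPullback b g).flip

variable {𝓜 : TwoSidedMooreStructure E} (Θ : Transport 𝓜.toPathData g)

/-- The pullback of an HDR. -/
def hdr {A B : E} {i : A ⟶ B} {b : B ⟶ X} (V : PullBox g i b) (η : HDR 𝓜.toPathData i) :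
    HDR 𝓜.toPathData V.k :=
  (Θ.pullback V.sqB).hdr V.sqA η

section

variable {A' B' A B : E} {i' : A' ⟶ B'} {i : A ⟶ B} {b' : B' ⟶ X} {b : B ⟶ X}
  {V' : PullBox g i' b'} {V : PullBox g i b} {u : A' ⟶ A} {w : B' ⟶ B} {x : V'.F ⟶ V.F}
  {z : V'.G ⟶ V.G}

/-- Both transports are pulled back from that of `g`, and `z` and `w` commute with the projections
to `Y` and `X`. -/
theorem Hom.isHom_transport (H : Hom V' V u w x z) :
    (Θ.pullback V'.sqB).IsHom (Θ.pullback V.sqB) z w := by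
  refine Transport.IsHom.of_comp (Θ.pullback_isHom V.sqB) V.sqB H.c ?_
  have h := Θ.pullback_isHom V'.sqB
  have h1 := H.y
  have h2 := H.base
  generalize z ≫ V.y = z' at h1 ⊢
  generalize w ≫ b = w' at h2 ⊢
  subst h1 h2
  exact h

theorem Hom.isHom_hdr (H : Hom V' V u w x z) {η' : HDR 𝓜.toPathData i'}
    {η : HDR 𝓜.toPathData i} (hη : HDR.IsHom η' η u w) :
    HDR.IsHom (V'.hdr Θ η') (V.hdr Θ η) x z :=
  Transport.hdr_isHom _ _ hη (H.isHom_transport Θ) H.k H.a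

theorem Hom.isMould {D : Dominance E} (H : Hom V' V u w x z) {η' : HDR 𝓜.toPathData i'}
    {η : HDR 𝓜.toPathData i} (S : IsMould D η' η u w) :
    IsMould D (V'.hdr Θ η') (V.hdr Θ η) x z :=
  Transport.hdr_isMould _ _ S (H.isHom_transport Θ) H.k H.a H.cart

end

/-- Maps between boxes over given maps are unique, which gives the commutative faces. The faces that
must be pullbacks are obtained by cancelling the pullback faces lying over `g` from a pasting with
the original cube. -/
theorem isMouldCube {D : Dominance E} {A₁' B₁' A₁ B₁ A₀' B₀' A₀ B₀ : E}
    {i₁' : A₁' ⟶ B₁'} {i₁ : A₁ ⟶ B₁} {i₀' : A₀' ⟶ B₀'} {i₀ : A₀ ⟶ B₀}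
    {b₁' : B₁' ⟶ X} {b₁ : B₁ ⟶ X} {b₀' : B₀' ⟶ X} {b₀ : B₀ ⟶ X}
    {V₁' : PullBox g i₁' b₁'} {V₁ : PullBox g i₁ b₁} {V₀' : PullBox g i₀' b₀'}
    {V₀ : PullBox g i₀ b₀}
    {η₁' : HDR 𝓜.toPathData i₁'} {η₁ : HDR 𝓜.toPathData i₁}
    {η₀' : HDR 𝓜.toPathData i₀'} {η₀ : HDR 𝓜.toPathData i₀}
    {m₁ : A₁' ⟶ A₁} {m₁' : B₁' ⟶ B₁} {m₀ : A₀' ⟶ A₀} {m₀' : B₀' ⟶ B₀}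
    {u' : A₁' ⟶ A₀'} {w' : B₁' ⟶ B₀'} {u : A₁ ⟶ A₀} {w : B₁ ⟶ B₀}
    (C : IsMouldCube D η₁' η₁ η₀' η₀ m₁ m₁' m₀ m₀' u' w' u w)
    {n₁ : V₁'.F ⟶ V₁.F} {n₁' : V₁'.G ⟶ V₁.G} {n₀ : V₀'.F ⟶ V₀.F} {n₀' : V₀'.G ⟶ V₀.G}
    {x' : V₁'.F ⟶ V₀'.F} {z' : V₁'.G ⟶ V₀'.G} {x : V₁.F ⟶ V₀.F} {z : V₁.G ⟶ V₀.G}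
    (H₁ : Hom V₁' V₁ m₁ m₁' n₁ n₁') (H₀ : Hom V₀' V₀ m₀ m₀' n₀ n₀')
    (K' : Hom V₁' V₀' u' w' x' z') (K : Hom V₁ V₀ u w x z) :
    IsMouldCube D (V₁'.hdr Θ η₁') (V₁.hdr Θ η₁) (V₀'.hdr Θ η₀') (V₀.hdr Θ η₀) n₁ n₁' n₀ n₀'
      x' z' x z := by
  obtain ⟨h1, h2⟩ := (K'.comp H₀).eq_of_eq (H₁.comp K) C.cart.w C.cart'.w
  refine ⟨H₁.isMould Θ C.source, H₀.isMould Θ C.target, K'.isHom_hdr Θ C.isHom',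
    K.isHom_hdr Θ C.isHom, ?_, ?_⟩
  · refine IsPullback.of_right ?_ h1 (H₀.cartA C.target.isHom.comm_i).flip
    rw [K'.a, K.a]
    exact (H₁.cartA C.source.isHom.comm_i).flip.paste_horiz C.cart
  · refine IsPullback.of_right ?_ h2 H₀.cart.flip
    rw [K'.c, K.c]
    exact H₁.cart.flip.paste_horiz C.cart'

/-- For a composite `i₀ ≫ i₁`, the pullback of `i₀` which fits with a given pullback of `i₁`. -/
def left {A B C : E} {i₁ : B ⟶ C} {b : C ⟶ X} (V : PullBox g i₁ b) (i₀ : A ⟶ B) :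
    PullBox g i₀ (i₁ ≫ b) where
  k := pullback.fst V.a i₀
  a := pullback.snd V.a i₀
  c := V.a
  y := V.k ≫ V.y
  sqA := IsPullback.of_hasPullback _ _
  sqB := V.sqA.flip.paste_vert V.sqB.flip |>.flip

/-- For a composite `i₀ ≫ i₁`, the pullback of `i₀ ≫ i₁` which fits with a given pullback
of `i₁`. -/
def total {A B C : E} {i₁ : B ⟶ C} {b : C ⟶ X} (V : PullBox g i₁ b) (i₀ : A ⟶ B) :
    PullBox g (i₀ ≫ i₁) b where
  k := (V.left i₀).k ≫ V.k
  a := (V.left i₀).a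
  c := V.c
  y := V.y
  sqA := (V.left i₀).sqA.paste_horiz V.sqA
  sqB := V.sqB

/-- The map `x` on the smaller objects of the `i₁`-boxes is the map on the larger objects of the
`i₀`-boxes, so the two pulled-back squares share a side strictly and can be composed. -/
theorem Hom.exists_left {A' B' C' A B C : E} {i₀' : A' ⟶ B'} {i₁' : B' ⟶ C'} {i₀ : A ⟶ B}
    {i₁ : B ⟶ C} {b' : C' ⟶ X} {b : C ⟶ X} {V' : PullBox g i₁' b'} {V : PullBox g i₁ b}
    {m : A' ⟶ A} {m' : B' ⟶ B} {m'' : C' ⟶ C} {x : V'.F ⟶ V.F} {z : V'.G ⟶ V.G}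
    (H : Hom V' V m' m'' x z) (hi₀ : i₀' ≫ m' = m ≫ i₀) (hi₁ : i₁' ≫ m'' = m' ≫ i₁) :
    ∃ n, Hom (V'.left i₀') (V.left i₀) m m' n x ∧ Hom (V'.total i₀') (V.total i₀) m m'' n z := by
  have hb : m' ≫ i₁ ≫ b = i₁' ≫ b' := by
    rw [← Category.assoc, ← hi₁, Category.assoc, H.base]
  have hy : x ≫ V.k ≫ V.y = V'.k ≫ V'.y := by
    rw [← Category.assoc, ← H.k, Category.assoc, H.y]
  obtain ⟨n, H₀⟩ := exists_hom_of (V'.left i₀') (V.left i₀) hi₀ hb (z := x) H.a hy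
  refine ⟨n, H₀, H.base, ?_, H₀.a, H.c, H.y⟩
  have h := H₀.k
  calc ((V'.left i₀').k ≫ V'.k) ≫ z = (V'.left i₀').k ≫ x ≫ V.k :=
        (Category.assoc _ _ _).trans (congrArg (fun l => (V'.left i₀').k ≫ l) H.k)
    _ = ((V'.left i₀').k ≫ x) ≫ V.k := (Category.assoc _ _ _).symm
    _ = (n ≫ (V.left i₀).k) ≫ V.k := congrArg (fun l => l ≫ V.k) h
    _ = n ≫ (V.left i₀).k ≫ V.k := Category.assoc _ _ _

/-- The box of `i₀` is a pullback along `V.a`, so its transport is a restriction of the one on `V`;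
`Transport.hdr_comp` then applies. -/
theorem hdr_total {A B C : E} {i₀ : A ⟶ B} {i₁ : B ⟶ C} {b : C ⟶ X} (V : PullBox g i₁ b)
    (η₀ : HDR 𝓜.toPathData i₀) (η₁ : HDR 𝓜.toPathData i₁) :
    (V.total i₀).hdr Θ (HDR.comp (𝓜 := 𝓜.toMooreStructure) η₀ η₁) =
      HDR.comp (𝓜 := 𝓜.toMooreStructure) ((V.left i₀).hdr Θ η₀) (V.hdr Θ η₁) :=
  (Transport.hdr_comp _ _ _ _ (Transport.IsHom.of_comp (Θ.pullback_isHom V.sqB) V.sqB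
    V.sqA.w (Θ.pullback_isHom (V.left i₀).sqB)) _ _).symm

end PullBox

end PullBox

/-! ### Fillers for pushforwards -/

/-! ### Maps into a pushforward and their values. -/

section Evaluation

variable {E : Type u} [Category.{v} E] [HasPullbacks E] [LocallyCartesianClosed E]
  {X Y Z : E} (g : Y ⟶ X) (f : Z ⟶ Y)

theorem evalAt_congr {T : E} {a a' : T ⟶ ((pushforward g).obj (Over.mk f)).left} {y y' : T ⟶ Y}
    (h : a ≫ pushforwardHom g f = y ≫ g) (ha : a = a') (hy : y = y') :
    evalAt g f a y h = evalAt g f a' y' (by rw [← ha, ← hy, h]) := by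
  subst ha hy; rfl

/-- The values of the transpose of a map are the values of that map. -/
theorem evalAt_homEquiv {W : Over X} (θ : (Over.pullback g).obj W ⟶ Over.mk f) {T : E}
    (a : T ⟶ W.left) (y : T ⟶ Y)
    (h : (a ≫ ((pushforwardAdj g).homEquiv W (Over.mk f) θ).left) ≫ pushforwardHom g f = y ≫ g)
    (h' : a ≫ W.hom = y ≫ g) :
    evalAt g f (a ≫ ((pushforwardAdj g).homEquiv W (Over.mk f) θ).left) y h =
      pullback.lift a y h' ≫ θ.left := by
  have h0 : ((pushforwardAdj g).homEquiv W (Over.mk f)).symm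
      ((pushforwardAdj g).homEquiv W (Over.mk f) θ) = θ := Equiv.symm_apply_apply _ _
  rw [Adjunction.homEquiv_counit] at h0
  conv_rhs => rw [← h0]
  unfold evalAt
  rw [Over.comp_left, ← Category.assoc]
  congr 1
  apply pullback.hom_ext
  · rw [Category.assoc]
    change _ = pullback.lift a y h' ≫ pullback.lift _ _ _ ≫ pullback.fst _ _
    rw [pullback.lift_fst, pullback.lift_fst, ← Category.assoc, pullback.lift_fst]
  · rw [Category.assoc]
    change _ = pullback.lift a y h' ≫ pullback.lift _ _ _ ≫ pullback.snd _ _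
    rw [pullback.lift_snd, pullback.lift_snd, pullback.lift_snd]

/-- The transpose of a map over `Y`. -/
def curry {B : E} (b : B ⟶ X) (z : pullback b g ⟶ Z) (hz : z ≫ f = pullback.snd b g) :
    B ⟶ ((pushforward g).obj (Over.mk f)).left :=
  ((pushforwardAdj g).homEquiv (Over.mk b) (Over.mk f) (Over.homMk z hz)).left

theorem curry_comp {B : E} (b : B ⟶ X) (z : pullback b g ⟶ Z) (hz : z ≫ f = pullback.snd b g) :
    curry g f b z hz ≫ pushforwardHom g f = b :=
  Over.w ((pushforwardAdj g).homEquiv (Over.mk b) (Over.mk f) (Over.homMk z hz))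

theorem evalAt_curry {B : E} (b : B ⟶ X) (z : pullback b g ⟶ Z) (hz : z ≫ f = pullback.snd b g)
    (h : (pullback.fst b g ≫ curry g f b z hz) ≫ pushforwardHom g f = pullback.snd b g ≫ g) :
    evalAt g f (pullback.fst b g ≫ curry g f b z hz) (pullback.snd b g) h = z := by
  refine (evalAt_homEquiv g f (W := Over.mk b) (Over.homMk z hz) _ _ h
    pullback.condition).trans ?_
  refine Eq.trans ?_ (Category.id_comp z)
  change _ ≫ z = _
  congr 1
  apply pullback.hom_ext
  · rw [pullback.lift_fst, Category.id_comp]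
    rfl
  · rw [pullback.lift_snd, Category.id_comp]
    rfl

/-- A map into a pushforward is determined by its values on the pullback of its domain. -/
theorem pushforward_ext_of_isPullback {B G : E} {b : B ⟶ X} {y : G ⟶ Y} {c : G ⟶ B}
    (sq : IsPullback y c g b) {k l : B ⟶ ((pushforward g).obj (Over.mk f)).left}
    (hk : k ≫ pushforwardHom g f = b) (hl : l ≫ pushforwardHom g f = b)
    (h : ∀ (h₁ : (c ≫ k) ≫ pushforwardHom g f = y ≫ g)
      (h₂ : (c ≫ l) ≫ pushforwardHom g f = y ≫ g),
      evalAt g f (c ≫ k) y h₁ = evalAt g f (c ≫ l) y h₂) : k = l := by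
  apply pushforward_ext g f (hk.trans hl.symm)
  intro T e y' h₁ h₂
  have he : y' ≫ g = e ≫ b := by rw [← h₁, Category.assoc, hk]
  have h₃ := h (by rw [Category.assoc, hk, sq.w]) (by rw [Category.assoc, hl, sq.w])
  have h₄ := congrArg (fun m => sq.lift _ _ he ≫ m) h₃
  simp only [comp_evalAt] at h₄
  refine (evalAt_congr g f _ ?_ ?_).trans (h₄.trans (evalAt_congr g f _ ?_ ?_))
  · rw [← Category.assoc, sq.lift_snd]
  · rw [sq.lift_fst]
  · rw [← Category.assoc, sq.lift_snd]
  · rw [sq.lift_fst]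

end Evaluation

/-! ### The effective fibration structure on a pushforward. -/

section Pushforward

variable {E : Type u} [Category.{v} E] [HasFiniteLimits E]

theorem exists_canon_hom {𝓜 : MooreStructure E} {D : Dominance E} {X Y : E} (g : Y ⟶ X)
    {A' B' A B : E} {i' : A' ⟶ B'} {i : A ⟶ B} {m : A' ⟶ A} {m' : B' ⟶ B}
    {η' : HDR 𝓜.toPathData i'} {η : HDR 𝓜.toPathData i} (S : IsMould D η' η m m') (b : B ⟶ X) :
    ∃ x z, PullBox.Hom (PullBox.canon g i' (m' ≫ b)) (PullBox.canon g i b) m m' x z :=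
  PullBox.exists_hom _ _ S.isHom.comm_i rfl

variable [LocallyCartesianClosed E]

theorem PullBox.value_aux {X Y Z : E} {g : Y ⟶ X} {f : Z ⟶ Y} {T B : E}
    {b : B ⟶ X} {a : B ⟶ ((pushforward g).obj (Over.mk f)).left}
    (ha : a ≫ pushforwardHom g f = b) {c : T ⟶ B} {y : T ⟶ Y} (h : y ≫ g = c ≫ b) :
    (c ≫ a) ≫ pushforwardHom g f = y ≫ g := by
  rw [Category.assoc, ha, h]

namespace PushforwardFill

variable {𝓜 : TwoSidedMooreStructure E} {D : Dominance E} {X Y Z : E} {g : Y ⟶ X} {f : Z ⟶ Y}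

section Problem

variable {A' B' A B : E} {i' : A' ⟶ B'} {i : A ⟶ B} {m : A' ⟶ A} {m' : B' ⟶ B}
  {a : B' ⟶ ((pushforward g).obj (Over.mk f)).left}
  {k : A ⟶ ((pushforward g).obj (Over.mk f)).left} {b : B ⟶ X} {b' : B' ⟶ X}
  {V' : PullBox g i' b'} {V : PullBox g i b} {n : V'.F ⟶ V.F} {n' : V'.G ⟶ V.G}

theorem upper_aux (h : IsProblem (pushforwardHom g f) i' i m m' a k b)
    (H : PullBox.Hom V' V m m' n n') : (V'.c ≫ a) ≫ pushforwardHom g f = V'.y ≫ g := by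
  rw [Category.assoc, h.upper, H.base, V'.sqB.w]

theorem left_aux (h : IsProblem (pushforwardHom g f) i' i m m' a k b) (V : PullBox g i b) :
    (V.a ≫ k) ≫ pushforwardHom g f = (V.k ≫ V.y) ≫ g := by
  rw [Category.assoc, h.left, Category.assoc, V.sqB.w, V.sqA.w_assoc]

/-- The transpose of a lifting problem. -/
theorem transpose_problem (h : IsProblem (pushforwardHom g f) i' i m m' a k b)
    (H : PullBox.Hom V' V m m' n n') :
    IsProblem f V'.k V.k n n' (evalAt g f (V'.c ≫ a) V'.y (upper_aux h H))
      (evalAt g f (V.a ≫ k) (V.k ≫ V.y) (left_aux h V)) V.y where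
  comm := by
    rw [comp_evalAt, comp_evalAt]
    apply evalAt_congr
    · rw [V'.sqA.w_assoc, h.comm, ← Category.assoc, ← H.a, Category.assoc]
    · rw [← H.y, ← Category.assoc, H.k, Category.assoc]
  upper := by rw [evalAt_comp, H.y]
  left := evalAt_comp _ _ _ _ _

end Problem

variable (Θ : Transport 𝓜.toPathData g) (ψ : EffFibStr 𝓜.toMooreStructure D f)

section Fill

variable {A' B' A B : E} {i' : A' ⟶ B'} {i : A ⟶ B} {m : A' ⟶ A} {m' : B' ⟶ B}
  {η' : HDR 𝓜.toPathData i'} {η : HDR 𝓜.toPathData i}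
  {a : B' ⟶ ((pushforward g).obj (Over.mk f)).left}
  {k : A ⟶ ((pushforward g).obj (Over.mk f)).left} {b : B ⟶ X}

/-- The filler for a transposed lifting problem. -/
def value (S : IsMould D η' η m m') (h : IsProblem (pushforwardHom g f) i' i m m' a k b)
    {b' : B' ⟶ X} {V' : PullBox g i' b'} {V : PullBox g i b} {n : V'.F ⟶ V.F} {n' : V'.G ⟶ V.G}
    (H : PullBox.Hom V' V m m' n n') : V.G ⟶ Z :=
  ψ.fill (H.isMould Θ S) (transpose_problem h H)

theorem value_comp (S : IsMould D η' η m m')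
    (h : IsProblem (pushforwardHom g f) i' i m m' a k b)
    {b' : B' ⟶ X} {V' : PullBox g i' b'} {V : PullBox g i b} {n : V'.F ⟶ V.F} {n' : V'.G ⟶ V.G}
    (H : PullBox.Hom V' V m m' n n') : value Θ ψ S h H ≫ f = V.y :=
  ψ.fill_comp _ _

end Fill

/-- The values for a lifting problem and for its pullback to the source of a cube. -/
theorem comp_value {A₁' B₁' A₁ B₁ A₀' B₀' A₀ B₀ : E}
    {i₁' : A₁' ⟶ B₁'} {i₁ : A₁ ⟶ B₁} {i₀' : A₀' ⟶ B₀'} {i₀ : A₀ ⟶ B₀}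
    {η₁' : HDR 𝓜.toPathData i₁'} {η₁ : HDR 𝓜.toPathData i₁}
    {η₀' : HDR 𝓜.toPathData i₀'} {η₀ : HDR 𝓜.toPathData i₀}
    {m₁ : A₁' ⟶ A₁} {m₁' : B₁' ⟶ B₁} {m₀ : A₀' ⟶ A₀} {m₀' : B₀' ⟶ B₀}
    {u' : A₁' ⟶ A₀'} {w' : B₁' ⟶ B₀'} {u : A₁ ⟶ A₀} {w : B₁ ⟶ B₀}
    (C : IsMouldCube D η₁' η₁ η₀' η₀ m₁ m₁' m₀ m₀' u' w' u w)
    {a₁ : B₁' ⟶ ((pushforward g).obj (Over.mk f)).left}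
    {k₁ : A₁ ⟶ ((pushforward g).obj (Over.mk f)).left} {b₁ : B₁ ⟶ X}
    {a₀ : B₀' ⟶ ((pushforward g).obj (Over.mk f)).left}
    {k₀ : A₀ ⟶ ((pushforward g).obj (Over.mk f)).left} {b₀ : B₀ ⟶ X}
    (h₁ : IsProblem (pushforwardHom g f) i₁' i₁ m₁ m₁' a₁ k₁ b₁)
    (h₀ : IsProblem (pushforwardHom g f) i₀' i₀ m₀ m₀' a₀ k₀ b₀)
    (ha : w' ≫ a₀ = a₁) (hk : u ≫ k₀ = k₁) (hb : w ≫ b₀ = b₁)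
    {b₁' : B₁' ⟶ X} {b₀' : B₀' ⟶ X}
    {V₁' : PullBox g i₁' b₁'} {V₁ : PullBox g i₁ b₁} {V₀' : PullBox g i₀' b₀'}
    {V₀ : PullBox g i₀ b₀}
    {n₁ : V₁'.F ⟶ V₁.F} {n₁' : V₁'.G ⟶ V₁.G} {n₀ : V₀'.F ⟶ V₀.F} {n₀' : V₀'.G ⟶ V₀.G}
    (H₁ : PullBox.Hom V₁' V₁ m₁ m₁' n₁ n₁') (H₀ : PullBox.Hom V₀' V₀ m₀ m₀' n₀ n₀')
    {x : V₁.F ⟶ V₀.F} {z : V₁.G ⟶ V₀.G} (K : PullBox.Hom V₁ V₀ u w x z) :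
    z ≫ value Θ ψ C.target h₀ H₀ = value Θ ψ C.source h₁ H₁ := by
  have hb' : w' ≫ b₀' = b₁' := by
    rw [← H₀.base, ← H₁.base, ← hb, ← Category.assoc, C.cart'.w, Category.assoc]
  obtain ⟨x', z', K'⟩ := PullBox.exists_hom V₁' V₀' C.isHom'.comm_i hb'
  have CC := PullBox.isMouldCube Θ C H₁ H₀ K' K
  refine (ψ.perpendicular CC (transpose_problem h₀ H₀)).trans (ψ.fill_congr _ _ ?_ ?_ K.y)
  · rw [comp_evalAt]
    apply evalAt_congr
    · rw [← Category.assoc, K'.c, Category.assoc, ha]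
    · exact K'.y
  · rw [comp_evalAt]
    apply evalAt_congr
    · rw [← Category.assoc, K.a, Category.assoc, hk]
    · rw [← Category.assoc, ← K.k, Category.assoc, K.y]

section Fill

variable {A' B' A B : E} {i' : A' ⟶ B'} {i : A ⟶ B} {m : A' ⟶ A} {m' : B' ⟶ B}
  {η' : HDR 𝓜.toPathData i'} {η : HDR 𝓜.toPathData i}
  {a : B' ⟶ ((pushforward g).obj (Over.mk f)).left}
  {k : A ⟶ ((pushforward g).obj (Over.mk f)).left} {b : B ⟶ X}

/-- The filler for a lifting problem against a pushforward. -/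
def fill (S : IsMould D η' η m m') (h : IsProblem (pushforwardHom g f) i' i m m' a k b) :
    B ⟶ ((pushforward g).obj (Over.mk f)).left :=
  curry g f b (value Θ ψ S h (exists_canon_hom g S b).choose_spec.choose_spec)
    (value_comp Θ ψ S h _)

theorem fill_comp (S : IsMould D η' η m m')
    (h : IsProblem (pushforwardHom g f) i' i m m' a k b) :
    fill Θ ψ S h ≫ pushforwardHom g f = b := curry_comp _ _ _ _ _

/-- Independence of the choice of pullbacks: any box maps to the canonical one over the identity,
and the perpendicular condition for `f` compares the two fillers. All later computations with `fill`
go through this lemma. -/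
theorem evalAt_fill (S : IsMould D η' η m m')
    (h : IsProblem (pushforwardHom g f) i' i m m' a k b)
    {b' : B' ⟶ X} {V' : PullBox g i' b'} {V : PullBox g i b} {n : V'.F ⟶ V.F} {n' : V'.G ⟶ V.G}
    (H : PullBox.Hom V' V m m' n n')
    (hc : (V.c ≫ fill Θ ψ S h) ≫ pushforwardHom g f = V.y ≫ g) :
    evalAt g f (V.c ≫ fill Θ ψ S h) V.y hc = value Θ ψ S h H := by
  have id_hom {A B : E} {i : A ⟶ B} (η : HDR 𝓜.toPathData i) : HDR.IsHom η η (𝟙 A) (𝟙 B) :=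
    ⟨by simp, by simp, by simp⟩
  -- The constant cube on `S`; after pulling back, its two ends differ only in the boxes used.
  have C : IsMouldCube D η' η η' η m m' m m' (𝟙 _) (𝟙 _) (𝟙 _) (𝟙 _) :=
    ⟨S, S, id_hom _, id_hom _, IsPullback.id_horiz _, IsPullback.id_horiz _⟩
  obtain ⟨x, z, K⟩ := PullBox.exists_hom V (PullBox.canon g i b) (u := 𝟙 A) (w := 𝟙 B)
    (by simp) (by simp)
  have hz₁ : z ≫ (PullBox.canon g i b).c = V.c := by rw [K.c, Category.comp_id]
  have h1 := comp_value Θ ψ C h h (Category.id_comp _) (Category.id_comp _) (Category.id_comp _)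
    H (exists_canon_hom g S b).choose_spec.choose_spec K
  have h2 := evalAt_curry g f b _
    (value_comp Θ ψ S h (exists_canon_hom g S b).choose_spec.choose_spec)
    (PullBox.value_aux (fill_comp Θ ψ S h) pullback.condition.symm)
  have h3 := (comp_evalAt g f z _ _ _).symm.trans (congrArg (fun l => z ≫ l) h2)
  refine (evalAt_congr g f _ ?_ ?_).trans (h3.trans h1)
  · exact (congrArg (fun l => l ≫ fill Θ ψ S h) hz₁.symm).trans (Category.assoc _ _ _)
  · exact K.y.symm

end Fill

/-- The fillers for a pushforward. -/
def filling : Filling 𝓜.toMooreStructure D (pushforwardHom g f) where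
  fill S a k b h := fill Θ ψ S h
  fill_comp S a k b h := fill_comp Θ ψ S h
  upper_fill {A' B' A B i' i η' η m m'} S {a k b} h := by
    obtain ⟨n, n', H⟩ := exists_canon_hom g S b
    -- Maps over `X` into the pushforward agree when their transposes do, so each law reduces to the
    -- corresponding law for `ψ`.
    apply pushforward_ext_of_isPullback g f (PullBox.canon g i' (m' ≫ b)).sqB
      (by rw [Category.assoc, fill_comp]) h.upper
    intro h₁ h₂
    have h3 := evalAt_fill Θ ψ S h H
      (PullBox.value_aux (fill_comp Θ ψ S h) pullback.condition.symm)
    have h4 := (comp_evalAt g f n' _ _ _).symm.trans ((congrArg (fun l => n' ≫ l) h3).trans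
      (ψ.upper_fill (H.isMould Θ S) (transpose_problem h H)))
    refine (evalAt_congr g f _ ?_ H.y.symm).trans h4
    rw [← Category.assoc, ← Category.assoc, H.c]
  left_fill {A' B' A B i' i η' η m m'} S {a k b} h := by
    obtain ⟨n, n', H⟩ := exists_canon_hom g S b
    -- Pasting the two squares of the box shows that `F` is the pullback of `A` along `g`.
    apply pushforward_ext_of_isPullback g f
      ((PullBox.canon g i b).sqA.flip.paste_vert (PullBox.canon g i b).sqB.flip).flip
      (by rw [Category.assoc, fill_comp]) h.left
    intro h₁ h₂
    have h3 := evalAt_fill Θ ψ S h H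
      (PullBox.value_aux (fill_comp Θ ψ S h) pullback.condition.symm)
    have h4 := (comp_evalAt g f (PullBox.canon g i b).k _ _ _).symm.trans
      ((congrArg (fun l => (PullBox.canon g i b).k ≫ l) h3).trans
        (ψ.left_fill (H.isMould Θ S) (transpose_problem h H)))
    refine (evalAt_congr g f _ ?_ rfl).trans h4
    rw [← Category.assoc, ← Category.assoc, (PullBox.canon g i b).sqA.w]

/-- The structure of an effective fibration on a pushforward. -/
def str : EffFibStr 𝓜.toMooreStructure D (pushforwardHom g f) where
  toFilling := filling Θ ψ
  horizontal {A' B' C' A B C i₀' i₁' i₀ i₁ η₀' η₁' η₀ η₁ m m' m''} S₀ S₁ {a k b} h := by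
    obtain ⟨n', n'', H₁⟩ := exists_canon_hom g S₁ b
    -- The boxes for `i₀` and for the composite are derived from the one for `i₁`, not chosen
    -- canonically, so that the pulled-back squares compose strictly.
    obtain ⟨n, H₀, H⟩ := H₁.exists_left S₀.isHom.comm_i S₁.isHom.comm_i
    apply pushforward_ext_of_isPullback g f (PullBox.canon g i₁ b).sqB (fill_comp Θ ψ _ _)
      (fill_comp Θ ψ _ _)
    intro h₁ h₂
    refine (evalAt_fill Θ ψ (S₀.hcomp S₁) h H h₁).trans
      (Eq.trans ?_ (evalAt_fill Θ ψ S₁ _ H₁ h₂).symm)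
    -- The value involves the pullback of a composite HDR, while the horizontal condition for `ψ`
    -- speaks of a composite of pullbacks; `hdr_total` exchanges them.
    refine (ψ.fill_congr_hdr _ ((H₀.isMould Θ S₀).hcomp (H₁.isMould Θ S₁))
      (PullBox.hdr_total Θ _ η₀' η₁') (PullBox.hdr_total Θ _ η₀ η₁) _
      (transpose_problem h H) rfl rfl rfl).trans ?_
    refine (ψ.horizontal (H₀.isMould Θ S₀) (H₁.isMould Θ S₁) (transpose_problem h H)).trans
      (ψ.fill_congr _ _ rfl ?_ rfl)
    refine Eq.trans ?_ (evalAt_fill Θ ψ S₀ (Filling.hproblem₀ S₁ h) H₀ (left_aux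
      ((filling Θ ψ).hproblem₁ S₀ S₁ h) (PullBox.canon g i₁ b))).symm
    refine ψ.fill_congr _ _ ?_ ?_ rfl
    · refine (comp_evalAt _ _ _ _ _ _).trans (evalAt_congr _ _ _ ?_ rfl)
      exact (PullBox.canon g i₁' (m'' ≫ b)).sqA.w_assoc _
    · exact evalAt_congr _ _ _ rfl (Category.assoc _ _ _)
  vertical {A'' B'' A' B' A B i'' i' i η'' η' η w w' m m'} S₀ S₁ {a k b} h := by
    obtain ⟨n, n', H₁⟩ := exists_canon_hom g S₁ b
    obtain ⟨l, l', H₀⟩ := exists_canon_hom g S₀ (m' ≫ b)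
    apply pushforward_ext_of_isPullback g f (PullBox.canon g i b).sqB (fill_comp Θ ψ _ _)
      (fill_comp Θ ψ _ _)
    intro h₁ h₂
    refine (evalAt_fill Θ ψ (S₀.vcomp S₁) h (H₀.comp H₁) h₁).trans
      (Eq.trans ?_ (evalAt_fill Θ ψ S₁ _ H₁ h₂).symm)
    refine (ψ.vertical (H₀.isMould Θ S₀) (H₁.isMould Θ S₁) _).trans
      (ψ.fill_congr _ _ ?_ rfl rfl)
    refine Eq.trans ?_ (evalAt_fill Θ ψ S₀ (Filling.vproblem₀ S₁ h) H₀
      (upper_aux ((filling Θ ψ).vproblem₁ S₀ S₁ h) H₁)).symm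
    refine ψ.fill_congr _ _ rfl ?_ H₁.y
    refine (comp_evalAt _ _ _ _ _ _).trans (evalAt_congr _ _ _ ?_ ?_)
    · rw [← Category.assoc, H₁.a, Category.assoc]
    · rw [← Category.assoc, ← H₁.k, Category.assoc, H₁.y]
  perpendicular {A₁' B₁' A₁ B₁ A₀' B₀' A₀ B₀ i₁' i₁ i₀' i₀ η₁' η₁ η₀' η₀ m₁ m₁' m₀ m₀'
      u' w' u w} C {a k b} h := by
    obtain ⟨n₀, n₀', H₀⟩ := exists_canon_hom g C.target b
    obtain ⟨n₁, n₁', H₁⟩ := exists_canon_hom g C.source (w ≫ b)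
    obtain ⟨x, z, K⟩ := PullBox.exists_hom (PullBox.canon g i₁ (w ≫ b)) (PullBox.canon g i₀ b)
      C.isHom.comm_i rfl
    apply pushforward_ext_of_isPullback g f (PullBox.canon g i₁ (w ≫ b)).sqB
      ((Category.assoc _ _ _).trans (congrArg (fun l => w ≫ l) (fill_comp Θ ψ C.target h)))
      (fill_comp Θ ψ _ _)
    intro h₁ h₂
    have h3 := evalAt_fill Θ ψ C.target h H₀
      (PullBox.value_aux (fill_comp Θ ψ C.target h) pullback.condition.symm)
    -- `comp_value` is the perpendicular condition for `ψ` on the pulled-back cube.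
    refine Eq.trans ?_ ((comp_value Θ ψ C (Filling.cubeProblem C h) h rfl rfl rfl H₁ H₀
      K).trans (evalAt_fill Θ ψ C.source (Filling.cubeProblem C h) H₁ h₂).symm)
    refine Eq.trans ?_ (congrArg (fun l => z ≫ l) h3)
    refine Eq.trans (evalAt_congr _ _ _ ?_ K.y.symm) (comp_evalAt _ _ z _ _ _).symm
    exact (Category.assoc _ _ _).symm.trans ((congrArg (fun l => l ≫ fill Θ ψ C.target h)
      K.c.symm).trans (Category.assoc _ _ _))

end PushforwardFill

end Pushforward

/-! ### Change of the fibration along a pullback square. -/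

section PullBoxMap

variable {E : Type u} [Category.{v} E]

/-- A pullback along `g'` is a pullback along `g`, if `g'` is a pullback of `g`. -/
def PullBox.map {Y' X' Y X : E} {g' : Y' ⟶ X'} {g : Y ⟶ X} {y : Y' ⟶ Y} {x : X' ⟶ X}
    (sq : IsPullback y g' g x) {A B : E} {i : A ⟶ B} {b : B ⟶ X'} (V : PullBox g' i b) :
    PullBox g i (b ≫ x) where
  k := V.k
  a := V.a
  c := V.c
  y := V.y ≫ y
  sqA := V.sqA
  sqB := V.sqB.paste_horiz sq

theorem PullBox.Hom.map {Y' X' Y X : E} {g' : Y' ⟶ X'} {g : Y ⟶ X} {y : Y' ⟶ Y} {x : X' ⟶ X}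
    (sq : IsPullback y g' g x) {A' B' A B : E} {i' : A' ⟶ B'} {i : A ⟶ B} {b' : B' ⟶ X'}
    {b : B ⟶ X'} {V' : PullBox g' i' b'} {V : PullBox g' i b} {m : A' ⟶ A} {m' : B' ⟶ B}
    {n : V'.F ⟶ V.F} {n' : V'.G ⟶ V.G} (H : PullBox.Hom V' V m m' n n') :
    PullBox.Hom (V'.map sq) (V.map sq) m m' n n' where
  base := by rw [← Category.assoc, H.base]
  k := H.k
  a := H.a
  c := H.c
  y := (Category.assoc _ _ _).symm.trans (congrArg (fun l => l ≫ y) H.y)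

/-- The box is a pullback along both `g'` and `g`, and as transport is preserved by the square
between these, both induce the same transport on `V.c`. Identities are then a morphism between the
two pulled-back HDRs, which forces them to be equal. -/
theorem PullBox.hdr_map [HasFiniteLimits E] {𝓜 : TwoSidedMooreStructure E} {Y' X' Y X : E}
    {g' : Y' ⟶ X'} {g : Y ⟶ X} {Θ' : Transport 𝓜.toPathData g'} {Θ : Transport 𝓜.toPathData g}
    {y : Y' ⟶ Y} {x : X' ⟶ X} (sq : IsPullback y g' g x) (hΘ : Θ'.IsHom Θ y x) {A B : E}
    {i : A ⟶ B} {b : B ⟶ X'} (V : PullBox g' i b) (η : HDR 𝓜.toPathData i) :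
    V.hdr Θ' η = (V.map sq).hdr Θ η := by
  have h : (Θ'.pullback V.sqB).IsHom (Θ.pullback (V.map sq).sqB) (𝟙 V.G) (𝟙 B) := by
    refine Transport.IsHom.of_comp (Θ.pullback_isHom (V.map sq).sqB) (V.map sq).sqB
      ((Category.id_comp _).trans (Category.comp_id _).symm) ?_
    have h1 := (Θ'.pullback_isHom V.sqB).comp hΘ
    rw [Category.id_comp]
    exact (Category.id_comp (V.y ≫ y)).symm ▸ h1
  exact HDR.eq_of_isHom_id (Transport.hdr_isHom V.sqA V.sqA
    ⟨by simp, by simp, by simp⟩ h ((Category.comp_id _).trans (Category.id_comp _).symm)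
    ((Category.id_comp _).trans (Category.comp_id _).symm))

end PullBoxMap

/-! ### Functoriality of pushforward, and the adjunction with pullback. -/

section Functoriality

variable {E : Type u} [Category.{v} E] [HasFiniteLimits E] [LocallyCartesianClosed E]

namespace PushforwardFill

variable {𝓜 : TwoSidedMooreStructure E} {D : Dominance E}

/-- The action of pushforward on morphisms preserves fillers. -/
theorem str_isHom {p q : CartPair E} (u : CartPair.Hom p q) {Θ' : Transport 𝓜.toPathData p.g}
    {Θ : Transport 𝓜.toPathData q.g} (hΘ : Θ'.IsHom Θ u.y u.x)
    {ψ' : EffFibStr 𝓜.toMooreStructure D p.f} {ψ : EffFibStr 𝓜.toMooreStructure D q.f}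
    (hψ : ψ'.IsHom ψ u.z u.y) : (str Θ' ψ').IsHom (str Θ ψ) (pushforwardMap u) u.x where
  comm := pushforwardMap_comp_hom u
  fill_comp {A' B' A B i' i η' η m m'} S {a k b} h := by
    obtain ⟨n, n', H⟩ := exists_canon_hom p.g S b
    have hc : ((PullBox.canon p.g i b).c ≫ fill Θ' ψ' S h) ≫ pushforwardHom p.g p.f =
        (PullBox.canon p.g i b).y ≫ p.g :=
      PullBox.value_aux (fill_comp Θ' ψ' S h) pullback.condition.symm
    have hp := h.comp (pushforwardMap_comp_hom u)
    have eval {T : E} (e : T ⟶ ((pushforward p.g).obj (Over.mk p.f)).left) (y : T ⟶ p.Y)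
        (he : e ≫ pushforwardHom p.g p.f = y ≫ p.g) :=
      evalAt_pushforwardMap u e y he (by
        rw [Category.assoc, pushforwardMap_comp_hom, reassoc_of% he, Category.assoc, u.cart.w])
    -- As the square of `u` is a pullback, a pullback along `p.g` is also one along `q.g`. The same
    -- box thus computes both fillers, and `hdr_map` matches the HDRs on it.
    apply pushforward_ext_of_isPullback q.g q.f ((PullBox.canon p.g i b).map u.cart).sqB
      (by
        rw [Category.assoc, pushforwardMap_comp_hom, ← Category.assoc]
        exact congrArg (fun l => l ≫ u.x) (fill_comp Θ' ψ' S h))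
      (fill_comp Θ ψ S hp)
    intro h₁ h₂
    refine (evalAt_congr q.g q.f _ (Category.assoc _ _ _).symm rfl).trans ((eval _ _ hc).trans ?_)
    refine Eq.trans ?_ (evalAt_fill Θ ψ S hp (H.map u.cart) h₂).symm
    refine (congrArg (fun l => l ≫ u.z) (evalAt_fill Θ' ψ' S h H hc)).trans ?_
    refine (hψ.fill_comp (H.isMould Θ' S) (transpose_problem h H)).trans ?_
    refine ψ.fill_congr_hdr _ _ (PullBox.hdr_map u.cart hΘ _ η') (PullBox.hdr_map u.cart hΘ _ η)
      _ _ ?_ ?_ rfl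
    · exact (eval _ _ _).symm.trans (evalAt_congr _ _ _ (Category.assoc _ _ _) rfl)
    · exact (eval _ _ _).symm.trans
        (evalAt_congr _ _ _ (Category.assoc _ _ _) (Category.assoc _ _ _))

variable {X Y Z : E} {g : Y ⟶ X} {f : Z ⟶ Y}

/-- The transpose of a map which preserves fillers preserves fillers. -/
theorem homEquiv_isHom (Θ : Transport 𝓜.toPathData g) (ψ : EffFibStr 𝓜.toMooreStructure D f)
    {W : Over X} (χ : EffFibStr 𝓜.toMooreStructure D W.hom)
    (θ : (Over.pullback g).obj W ⟶ Over.mk f)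
    (hθ : (χ.pullback (IsPullback.of_hasPullback W.hom g)).IsHom ψ θ.left (𝟙 Y)) :
    χ.IsHom (str Θ ψ) ((pushforwardAdj g).homEquiv W (Over.mk f) θ).left (𝟙 X) where
  comm := (Over.w ((pushforwardAdj g).homEquiv W (Over.mk f) θ)).trans
    (Category.comp_id _).symm
  fill_comp {A' B' A B i' i η' η m m'} S {a k b} h := by
    have hw : ((pushforwardAdj g).homEquiv W (Over.mk f) θ).left ≫ pushforwardHom g f = W.hom :=
      Over.w ((pushforwardAdj g).homEquiv W (Over.mk f) θ)
    have hp := h.comp (hw.trans (Category.comp_id _).symm)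
    -- The base map is `b ≫ 𝟙 X` because the problem against the pushforward is the given one
    -- composed with a square over `𝟙 X`. The boxes are kept opaque, as any boxes will do.
    obtain ⟨V', V, n, n', H⟩ : ∃ (V' : PullBox g i' (m' ≫ b ≫ 𝟙 X)) (V : PullBox g i (b ≫ 𝟙 X))
        (n : V'.F ⟶ V.F) (n' : V'.G ⟶ V.G), PullBox.Hom V' V m m' n n' :=
      ⟨_, _, exists_canon_hom g S _⟩
    have eval {T : E} (e : T ⟶ W.left) (y : T ⟶ Y) (he : e ≫ W.hom = y ≫ g) :=
      evalAt_homEquiv g f θ e y (by rw [Category.assoc, hw, he]) he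
    -- The projections from the boxes make the pulled-back mould square the source of a cube over
    -- `S`, so the perpendicular condition for `χ` relates the fillers for both squares.
    have C : IsMouldCube D (V'.hdr Θ η')
        (V.hdr Θ η) η' η n n' m m' _ _ _ _ :=
      ⟨H.isMould Θ S, S, Transport.hdr_isHom_base _ _ _, Transport.hdr_isHom_base _ _ _,
        (H.cartA S.isHom.comm_i).flip, H.cart.flip⟩
    have hb : V.y ≫ g = V.c ≫ b := V.sqB.w.trans (congrArg (fun l => V.c ≫ l) (Category.comp_id b))
    have h₀ : (V.c ≫ χ.fill S h) ≫ W.hom =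
        V.y ≫ g := by
      rw [Category.assoc, χ.fill_comp, hb]
    have hu : (V'.c ≫ a) ≫ W.hom =
        V'.y ≫ g := by
      rw [Category.assoc, h.upper, V'.sqB.w]
      exact congrArg (fun l => V'.c ≫ m' ≫ l) (Category.comp_id b).symm
    have hl : (V.a ≫ k) ≫ W.hom =
        (V.k ≫ V.y) ≫ g := by
      rw [Category.assoc, h.left, Category.assoc, hb, V.sqA.w_assoc]
    have hq : IsProblem (pullback.snd W.hom g) V'.k V.k n n' (pullback.lift _ _ hu)
        (pullback.lift _ _ hl) V.y := by
      refine ⟨?_, ?_, pullback.lift_snd _ _ _⟩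
      · apply pullback.hom_ext
        · rw [Category.assoc, Category.assoc, pullback.lift_fst, pullback.lift_fst,
            V'.sqA.w_assoc, h.comm, reassoc_of% H.a]
        · rw [Category.assoc, Category.assoc, pullback.lift_snd, pullback.lift_snd, ← H.y,
            reassoc_of% H.k]
      · rw [pullback.lift_snd, H.y]
    -- Consequently the chosen filler for the pullback of `W` along `g` is induced by the filler for
    -- `W`; this is the filler that `θ` is assumed to preserve.
    have h₃ : pullback.lift _ _ h₀ =
        (χ.pullback (IsPullback.of_hasPullback W.hom g)).fill (H.isMould Θ S) hq := by
      apply (IsPullback.of_hasPullback W.hom g).hom_ext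
      · rw [pullback.lift_fst]
        refine (χ.perpendicular C h).trans
          (Eq.trans ?_ ((IsPullback.of_hasPullback W.hom g).lift_fst _ _ _).symm)
        exact χ.fill_congr _ _ (pullback.lift_fst _ _ _).symm (pullback.lift_fst _ _ _).symm
          hb.symm
      · exact (pullback.lift_snd _ _ _).trans (Filling.fill_comp _ _ _).symm
    apply pushforward_ext_of_isPullback g f V.sqB
      (by rw [Category.assoc, hw, χ.fill_comp, Category.comp_id]) (fill_comp Θ ψ S hp)
    intro h₁ h₂
    refine (evalAt_congr g f _ (Category.assoc _ _ _).symm rfl).trans ((eval _ _ h₀).trans ?_)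
    refine Eq.trans ?_ (evalAt_fill Θ ψ S hp H h₂).symm
    rw [h₃]
    refine (hθ.fill_comp (H.isMould Θ S) hq).trans (ψ.fill_congr _ _ ?_ ?_ (Category.comp_id _))
    · exact (eval _ _ _).symm.trans (evalAt_congr _ _ _ (Category.assoc _ _ _) rfl)
    · exact (eval _ _ _).symm.trans (evalAt_congr _ _ _ (Category.assoc _ _ _) rfl)

end PushforwardFill

variable [HasFiniteColimits E] {𝓜 : SymmetricMooreStructure E} {D : Dominance E}
  (hD : D.IsAdmissible 𝓜.toPathData)

/-- Pushforward as a functor on effective fibrations. -/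
def effFibPushforward : EffFibPair 𝓜.toMooreStructure D ⥤ EffFib 𝓜.toMooreStructure D where
  obj p := ⟨pushforwardHom p.g p.f, PushforwardFill.str (p.gStr.transport hD) p.fStr⟩
  map {p q} u := ⟨pushforwardMap u.toHom, u.x,
    PushforwardFill.str_isHom u.toHom (EffFibStr.IsHom.transport hD u.g_isHom) u.f_isHom⟩
  map_id p := by
    apply EffFib.Hom.ext
    · exact congrArg (fun l => l.left) ((pushforwardFunctor E).map_id p.toCartPair)
    · rfl
  map_comp {p q r} u w := by
    apply EffFib.Hom.ext
    · exact congrArg (fun l => l.left) ((pushforwardFunctor E).map_comp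
        ((EffFibPair.forget _ D).map u) ((EffFibPair.forget _ D).map w))
    · rfl

theorem effFibPushforward_forget : effFibPushforward hD ⋙ EffFib.forget 𝓜.toMooreStructure D =
    EffFibPair.forget 𝓜.toMooreStructure D ⋙ pushforwardFunctor E := rfl

variable {X Y : E} (g : Y ⟶ X) (γ : EffFibStr 𝓜.toMooreStructure D g)

namespace EffFibOver

/-- Pushforward of effective fibrations along an effective fibration. -/
def pushforward : EffFibOver 𝓜.toMooreStructure D Y ⥤ EffFibOver 𝓜.toMooreStructure D X where
  obj F := ⟨(MooreCat.pushforward g).obj F.obj,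
    PushforwardFill.str (f := F.obj.hom) (γ.transport hD) F.str⟩
  map a := (MooreCat.pushforward g).map a
  map_id F := (MooreCat.pushforward g).map_id F.obj
  map_comp a b := (MooreCat.pushforward g).map_comp (X := _) (Y := _) (Z := _) a b

/-- Pushforward of effective fibrations is right adjoint to pullback. -/
def pullbackPushforwardAdj :
    EffFibOver.pullback 𝓜.toMooreStructure D g ⊣ EffFibOver.pushforward hD g γ :=
  -- Morphisms here are arbitrary maps over the base, so the bijection of the adjunction between
  -- slices can be used unchanged.
  Adjunction.mkOfHomEquiv
    { homEquiv := fun H F => (pushforwardAdj g).homEquiv H.obj F.obj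
      homEquiv_naturality_left_symm := fun {H' H F} u k =>
        (pushforwardAdj g).homEquiv_naturality_left_symm (X := H.obj) (X' := H'.obj) (Y := F.obj)
          u k
      homEquiv_naturality_right := fun {H F F'} k w =>
        (pushforwardAdj g).homEquiv_naturality_right (X := H.obj) (Y := F.obj) (Y' := F'.obj)
          k w }

end EffFibOver

end Functoriality

end

end MooreCat

/-! ### The pushforward theorem. -/

theorem mainTheorem1 {E : Type u} [Category.{v} E] [HasFiniteLimits E] [HasFiniteColimits E]
    [MooreCat.LocallyCartesianClosed E] (𝓜 : MooreCat.SymmetricMooreStructure E)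
    (D : MooreCat.Dominance E) (hD : D.IsAdmissible 𝓜.toPathData) :
    ∃ Pi : MooreCat.EffFibPair 𝓜.toMooreStructure D ⥤ MooreCat.EffFib 𝓜.toMooreStructure D,
      Pi ⋙ MooreCat.EffFib.forget 𝓜.toMooreStructure D =
        MooreCat.EffFibPair.forget 𝓜.toMooreStructure D ⋙ MooreCat.pushforwardFunctor E ∧
      ∀ {X Y : E} (g : Y ⟶ X) (γ : MooreCat.EffFibStr 𝓜.toMooreStructure D g),
        ∃ (R : MooreCat.EffFibOver 𝓜.toMooreStructure D Y ⥤
            MooreCat.EffFibOver 𝓜.toMooreStructure D X)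
          (adj : MooreCat.EffFibOver.pullback 𝓜.toMooreStructure D g ⊣ R),
          R ⋙ MooreCat.EffFibOver.forget 𝓜.toMooreStructure D X =
            MooreCat.EffFibOver.forget 𝓜.toMooreStructure D Y ⋙ MooreCat.pushforward g ∧
          (∀ F, (R.obj F).toEffFib = Pi.obj (MooreCat.EffFibOver.pair g γ F)) ∧
          ∀ (H : MooreCat.EffFibOver 𝓜.toMooreStructure D X)
            (F : MooreCat.EffFibOver 𝓜.toMooreStructure D Y)
            (k : (MooreCat.EffFibOver.pullback 𝓜.toMooreStructure D g).obj H ⟶ F),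
            MooreCat.EffFibOver.IsStructured k →
              MooreCat.EffFibOver.IsStructured (adj.homEquiv H F k) := by
  refine ⟨MooreCat.effFibPushforward hD, MooreCat.effFibPushforward_forget hD, fun {X Y} g γ =>
    ⟨MooreCat.EffFibOver.pushforward hD g γ, MooreCat.EffFibOver.pullbackPushforwardAdj hD g γ, rfl,
      fun _ => rfl, fun H F k hk => ?_⟩⟩
  have h := MooreCat.PushforwardFill.homEquiv_isHom (γ.transport hD) F.str H.str k hk
  rw [MooreCat.EffFibOver.pullbackPushforwardAdj, Adjunction.mkOfHomEquiv_homEquiv]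
  exact h
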